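/- Let $(M,g)$ be a smooth four-dimensional Riemannian manifold and $f$ a smooth non-constant function on $M$ such that $(M,g,f)$ is a gradient Ricci soliton, i.e. $\nabla df=-Rc+\lambda g$ for a constant $\lambda\in\mathbb R$, and assume that $g$ has harmonic Weyl curvature, $\delta W=0$. Put $\mathcal A=Rc-\frac R6 g$, where $R$ is the scalar curvature, and let $M_{\mathcal A}$ be the set of points of $M$ near which the number of distinct eigenvalues of $\mathcal A$ is constant. Let $U$ be an open subset of $M_{\mathcal A}\cap\{\nabla f\neq 0\}$ with an adapted frame field $E_1,\dots,E_4$ on $U$, that is, smooth orthonormal vector fields with $Rc(E_i,\cdot)=\lambda_i\,g(E_i,\cdot)$ for functions $\lambda_i$ on $U$, with $E_1=\nabla f/|\nabla f|$ and $E_2,E_3,E_4$ tangent to the level hypersurfaces of $f$, and listed eigenspace by eigenspace. Suppose that $\lambda_2=\lambda_3=\lambda_4\neq\lambda_1$ at every point of $U$. Then each point $p_0\in U$ has a neighborhood $V\subset U$ with smooth coordinates $(s,x_2,x_3,x_4)$, ranging over a product of an open interval $I$ and an open set $W\subset\mathbb R^3$, such that $ds=df/|\nabla f|$ and $$g=ds^2+h(s)^2\,\tilde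 g\quad\text{on } V,$$ where $h$ is a positive smooth function on $I$ and $\tilde g$ is a Riemannian metric of constant sectional curvature on $W$. In particular, $g$ is locally conformally flat on $U$: every point of $U$ has a neighborhood in $U$ with a smooth function $\varphi$ on it such that the metric $e^{2\varphi}g$ is flat. -/

import Mathlib

open scoped Manifold ContDiff Topology

noncomputable section

namespace RicciSoliton

/-- The model space `ℝⁿ`. -/
abbrev Eu (n : ℕ) : Type := EuclideanSpace ℝ (Fin n)

/-! ### Tensor calculus in a coordinate domain of `ℝⁿ`

A metric in coordinates is a matrix-valued function `G = (g_ij)`. -/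

section Coordinates

variable {n : ℕ}

/-- The partial derivative `∂_i F` at `y`. -/
def pd (i : Fin n) (F : Eu n → ℝ) (y : Eu n) : ℝ :=
  fderiv ℝ F y (EuclideanSpace.single i 1)

/-- The matrix function `G` is a smooth Riemannian metric on the open set `W`. -/
def IsMetricOn (G : Eu n → Matrix (Fin n) (Fin n) ℝ) (W : Set (Eu n)) : Prop :=
  (∀ i j, ContDiffOn ℝ ∞ (fun y => G y i j) W) ∧ ∀ y ∈ W, (G y).PosDef

/-- Christoffel symbols `Γ^k_ij = ½ g^{kl} (∂_i g_lj + ∂_j g_li - ∂_l g_ij)`. -/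
def christoffel (G : Eu n → Matrix (Fin n) (Fin n) ℝ) (k i j : Fin n) (y : Eu n) : ℝ :=
  (1 / 2) * ∑ l, (G y)⁻¹ k l *
    (pd i (fun z => G z l j) y + pd j (fun z => G z l i) y - pd l (fun z => G z i j) y)

/-- The coefficient of `∂_l` in `∇_i ∇_j ∂_k - ∇_j ∇_i ∂_k`. -/
def riemannUp (G : Eu n → Matrix (Fin n) (Fin n) ℝ) (i j k l : Fin n) (y : Eu n) : ℝ :=
  pd i (christoffel G l j k) y - pd j (christoffel G l i k) y
    + ∑ m, (christoffel G m j k y * christoffel G l i m y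
      - christoffel G m i k y * christoffel G l j m y)

/-- `R_ijkl = ⟨∇_i ∇_j ∂_k - ∇_j ∇_i ∂_k, ∂_l⟩`; with this convention the sectional curvature
of an orthonormal pair is `R(X, Y, Y, X)`. -/
def riemann (G : Eu n → Matrix (Fin n) (Fin n) ℝ) (i j k l : Fin n) (y : Eu n) : ℝ :=
  ∑ m, riemannUp G i j k m y * G y m l

/-- The Ricci tensor `R_jk`, the trace of `R_ijkl` in `i` and `l`. -/
def ricci (G : Eu n → Matrix (Fin n) (Fin n) ℝ) (j k : Fin n) (y : Eu n) : ℝ :=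
  ∑ i, riemannUp G i j k i y

/-- The scalar curvature. -/
def scalarCurv (G : Eu n → Matrix (Fin n) (Fin n) ℝ) (y : Eu n) : ℝ :=
  ∑ j, ∑ k, (G y)⁻¹ j k * ricci G j k y

/-- The Hessian `(∇ d F)_ij = ∂_i ∂_j F - Γ^k_ij ∂_k F`. -/
def hessian (G : Eu n → Matrix (Fin n) (Fin n) ℝ) (F : Eu n → ℝ) (i j : Fin n) (y : Eu n) : ℝ :=
  pd i (pd j F) y - ∑ k, christoffel G k i j y * pd k F y

/-- The Weyl tensor `W_ijkl` (meant for `3 ≤ n`), the totally trace-free part of `R_ijkl`. -/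
def weyl (G : Eu n → Matrix (Fin n) (Fin n) ℝ) (i j k l : Fin n) (y : Eu n) : ℝ :=
  riemann G i j k l y
    - 1 / ((n : ℝ) - 2) * (ricci G j k y * G y i l + ricci G i l y * G y j k
        - ricci G i k y * G y j l - ricci G j l y * G y i k)
    + scalarCurv G y / (((n : ℝ) - 1) * ((n : ℝ) - 2))
        * (G y j k * G y i l - G y i k * G y j l)

/-- The components `∇_m T_ijkl` of the covariant derivative of a covariant 4-tensor. -/
def covDeriv4 (G : Eu n → Matrix (Fin n) (Fin n) ℝ)
    (T : Fin n → Fin n → Fin n → Fin n → Eu n → ℝ) (m i j k l : Fin n) (y : Eu n) : ℝ :=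
  pd m (T i j k l) y
    - ∑ a, (christoffel G a m i y * T a j k l y + christoffel G a m j y * T i a k l y
      + christoffel G a m k y * T i j a l y + christoffel G a m l y * T i j k a y)

/-- `(δW)_jkl = - g^{mi} ∇_m W_ijkl`. -/
def divWeyl (G : Eu n → Matrix (Fin n) (Fin n) ℝ) (j k l : Fin n) (y : Eu n) : ℝ :=
  -∑ m, ∑ i, (G y)⁻¹ m i * covDeriv4 G (weyl G) m i j k l y

/-- All sectional curvatures of `G` on `W` are equal to `κ`:
`R(X, Y, Y, X) = κ (|X|² |Y|² - ⟨X, Y⟩²)` for all tangent vectors `X, Y`. -/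
def HasConstantCurvatureOn (G : Eu n → Matrix (Fin n) (Fin n) ℝ) (W : Set (Eu n)) (κ : ℝ) :
    Prop :=
  ∀ y ∈ W, ∀ X Y : Fin n → ℝ,
    (∑ i, ∑ j, ∑ k, ∑ l, riemann G i j k l y * X i * Y j * Y k * X l)
      = κ * ((∑ i, ∑ j, G y i j * X i * X j) * (∑ i, ∑ j, G y i j * Y i * Y j)
          - (∑ i, ∑ j, G y i j * X i * Y j) ^ 2)

/-- The curvature tensor of `G` vanishes on `W`. -/
def IsFlatOn (G : Eu n → Matrix (Fin n) (Fin n) ℝ) (W : Set (Eu n)) : Prop :=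
  ∀ y ∈ W, ∀ i j k l, riemann G i j k l y = 0

/-- The point `(x_2, …, x_{n+1})` of `ℝⁿ` obtained from `(s, x_2, …, x_{n+1})`. -/
def tailPt (y : Eu (n + 1)) : Eu n := WithLp.toLp 2 fun i => y i.succ

/-- The warped product `ds² + h(s)² g̃`, where `s` is the coordinate of index `0` and `g̃` is a
metric in the remaining coordinates. -/
def warped (h : ℝ → ℝ) (Gt : Eu n → Matrix (Fin n) (Fin n) ℝ) (y : Eu (n + 1)) :
    Matrix (Fin (n + 1)) (Fin (n + 1)) ℝ :=
  Matrix.of (Fin.cons (Fin.cons 1 fun _ => 0)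
    fun i => Fin.cons 0 fun j => h (y 0) ^ 2 * Gt (tailPt y) i j)

end Coordinates

/-! ### Riemannian manifolds -/

section Manifold

variable {n : ℕ} {M : Type*} [TopologicalSpace M] [ChartedSpace (Eu n) M]
  [IsManifold (𝓡 n) ∞ M]

variable (n M) in
/-- Smooth Riemannian metrics on the `n`-manifold `M`. -/
abbrev RMetric : Type _ :=
  Bundle.ContMDiffRiemannianMetric (𝓡 n) ∞ (Eu n) (fun x : M => TangentSpace (𝓡 n) x)

variable (n M) in
/-- All smooth charts of `M`. -/
abbrev Charts : Set (OpenPartialHomeomorph M (Eu n)) := IsManifold.maximalAtlas (𝓡 n) ∞ M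

/-- The coordinate vector field `∂_i` of the chart `e`, at the point with coordinates `y`. -/
def coordField (e : OpenPartialHomeomorph M (Eu n)) (i : Fin n) (y : Eu n) :
    TangentSpace (𝓡 n) (e.symm y) :=
  mfderiv (𝓡 n) (𝓡 n) e.symm y (EuclideanSpace.single i (1 : ℝ) : Eu n)

/-- The components `g_ij = g(∂_i, ∂_j)` of the metric in the chart `e`, as functions on
`e.target`. -/
def inChart (g : RMetric n M) (e : OpenPartialHomeomorph M (Eu n)) (y : Eu n) :
    Matrix (Fin n) (Fin n) ℝ :=
  Matrix.of fun i j => g.inner (e.symm y) (coordField e i y) (coordField e j y)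

/-- The component with index `i` of a tangent vector in the chart `e`. -/
def comp (e : OpenPartialHomeomorph M (Eu n)) {x : M} (v : TangentSpace (𝓡 n) x) (i : Fin n) : ℝ :=
  let u : Eu n := mfderiv (𝓡 n) (𝓡 n) e x v
  u i

/-- `Rc(v, w)`, computed in the chart `e`. -/
def ricciForm (g : RMetric n M) (e : OpenPartialHomeomorph M (Eu n)) {x : M}
    (v w : TangentSpace (𝓡 n) x) : ℝ :=
  ∑ i, ∑ j, ricci (inChart g e) i j (e x) * comp e v i * comp e w j

/-- `𝒜(v, w)` for `𝒜 = Rc - R / (2n - 2) g`, computed in the chart `e`. -/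
def codazziForm (g : RMetric n M) (e : OpenPartialHomeomorph M (Eu n)) {x : M}
    (v w : TangentSpace (𝓡 n) x) : ℝ :=
  ricciForm g e v w
    - scalarCurv (inChart g e) (e x) / (2 * (n : ℝ) - 2) * g.inner x v w

/-- `(M, g, f)` is a gradient Ricci soliton, `∇df = -Rc + λ g`, with constant `lam`; the tensor
equation is required in all smooth charts. -/
def IsGradientRicciSoliton (g : RMetric n M) (f : M → ℝ) (lam : ℝ) : Prop :=
  ContMDiff (𝓡 n) 𝓘(ℝ, ℝ) ∞ f ∧
    ∀ e ∈ Charts n M, ∀ y ∈ e.target, ∀ i j,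
      hessian (inChart g e) (f ∘ e.symm) i j y
        = -ricci (inChart g e) i j y + lam * inChart g e y i j

/-- Harmonic Weyl curvature, `δW = 0`. -/
def HasHarmonicWeyl (g : RMetric n M) : Prop :=
  ∀ e ∈ Charts n M, ∀ y ∈ e.target, ∀ j k l, divWeyl (inChart g e) j k l y = 0

/-- `Rc(v, ·) = μ g(v, ·)` at `x`. -/
def RicciEigen (g : RMetric n M) (x : M) (v : TangentSpace (𝓡 n) x) (μ : ℝ) : Prop :=
  ∀ e ∈ Charts n M, x ∈ e.source → ∀ w : TangentSpace (𝓡 n) x,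
    ricciForm g e v w = μ * g.inner x v w

/-- `𝒜(v, ·) = μ g(v, ·)` at `x`. -/
def CodazziEigen (g : RMetric n M) (x : M) (v : TangentSpace (𝓡 n) x) (μ : ℝ) : Prop :=
  ∀ e ∈ Charts n M, x ∈ e.source → ∀ w : TangentSpace (𝓡 n) x,
    codazziForm g e v w = μ * g.inner x v w

/-- The number of distinct eigenvalues of `𝒜` at `x`. -/
def numEigenvalues (g : RMetric n M) (x : M) : ℕ :=
  Set.ncard {μ : ℝ | ∃ v : TangentSpace (𝓡 n) x, v ≠ 0 ∧ CodazziEigen g x v μ}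

/-- The set `M_𝒜` of points near which the number of distinct eigenvalues of `𝒜` is constant. -/
def regularSet (g : RMetric n M) : Set M :=
  {x | ∀ᶠ z in 𝓝 x, numEigenvalues g z = numEigenvalues g x}

theorem inner_injective (g : RMetric n M) (x : M) :
    Function.Injective (g.inner x) := by
  rw [injective_iff_map_eq_zero]
  intro v hv
  by_contra h
  have := g.pos x v h
  rw [hv] at this
  simp at this

theorem exists_grad (g : RMetric n M) (f : M → ℝ) (x : M) :
    ∃ u : TangentSpace (𝓡 n) x, ∀ v : TangentSpace (𝓡 n) x,
      g.inner x u v = (mfderiv (𝓡 n) 𝓘(ℝ, ℝ) f x v : ℝ) := by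
  let B : Eu n →ₗ[ℝ] (Eu n →L[ℝ] ℝ) := (g.inner x).toLinearMap
  have hB : Function.Injective B := inner_injective g x
  have hd : Module.finrank ℝ (Eu n) = Module.finrank ℝ (Eu n →L[ℝ] ℝ) := by
    rw [← (LinearMap.toContinuousLinearMap (𝕜 := ℝ) (E := Eu n) (F' := ℝ)).finrank_eq]
    exact (Subspace.dual_finrank_eq (K := ℝ) (V := Eu n)).symm
  obtain ⟨u, hu⟩ := (LinearMap.injective_iff_surjective_of_finrank_eq_finrank hd).1 hB
    (mfderiv (𝓡 n) 𝓘(ℝ, ℝ) f x)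
  exact ⟨u, fun v => DFunLike.congr_fun hu v⟩

/-- The gradient `∇f`, characterized by `g(∇f, v) = df(v)`. -/
def grad (g : RMetric n M) (f : M → ℝ) (x : M) : TangentSpace (𝓡 n) x :=
  (exists_grad g f x).choose

/-- `|∇f|`. -/
def gradNorm (g : RMetric n M) (f : M → ℝ) (x : M) : ℝ :=
  √(g.inner x (grad g f x) (grad g f x))

/-- `E_1, …, E_n` (indexed from `0`) is an adapted frame field of `(M, g, f)` on `U` with Ricci
eigenfunctions `lam_1, …, lam_n`. -/
structure IsAdaptedFrame [NeZero n] (g : RMetric n M) (f : M → ℝ) (U : Set M)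
    (E : Fin n → (x : M) → TangentSpace (𝓡 n) x) (lam : Fin n → M → ℝ) : Prop where
  smooth : ∀ i, ContMDiffOn (𝓡 n) (𝓡 n).tangent ∞
    (fun x => (⟨x, E i x⟩ : TangentBundle (𝓡 n) M)) U
  orthonormal : ∀ x ∈ U, ∀ i j, g.inner x (E i x) (E j x) = if i = j then 1 else 0
  ricci_eigen : ∀ x ∈ U, ∀ i, RicciEigen g x (E i x) (lam i x)
  first : ∀ x ∈ U, E 0 x = (gradNorm g f x)⁻¹ • grad g f x
  tangent_levels : ∀ x ∈ U, ∀ i, i ≠ 0 → (mfderiv (𝓡 n) 𝓘(ℝ, ℝ) f x (E i x) : ℝ) = 0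
  /-- the frame is listed eigenspace by eigenspace -/
  blocks : ∀ x ∈ U, ∀ i j k, i ≤ j → j ≤ k → lam i x = lam k x → lam i x = lam j x

/-- `g` is locally conformally flat on the open set `U`: near every point of `U` there is a
smooth function `φ` such that the metric `e^{2φ} g` is flat. -/
def IsLocallyConformallyFlatOn (g : RMetric n M) (U : Set M) : Prop :=
  ∀ p ∈ U, ∃ e ∈ Charts n M, p ∈ e.source ∧ e.source ⊆ U ∧
    ∃ φ : Eu n → ℝ, ContDiffOn ℝ ∞ φ e.target ∧
      IsFlatOn (fun y => Real.exp (2 * φ y) • inChart g e y) e.target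

end Manifold

end RicciSoliton

end

open RicciSoliton

/-! Write μ for the common Ricci eigenvalue on directions tangent to the levels of f. A tangential
vector ∂_a has no component along E_1, so Rc(∂_a, ·) = μ g(∂_a, ·), and the soliton equation becomes
information on the level hypersurfaces. Its mixed part gives Hess f(∂_a, ∇f) = 0, so |∇f| is
constant on levels; with arclength s along ∇f the metric is ds² + g_s (`exists_geodesic_chart`). Its
tangential part reads ∂_s g_s = 2ζ g_s with ζ = (λ - μ)/|∇f|, so the levels are totally umbilic. The
Codazzi equation gives Rc(∂_a, ∂_s) = -2 ∂_a ζ, and the left side vanishes; hence ζ depends on s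
only and g_s = exp(2∫ζ) g_{s₀}. The traced Gauss equation then makes g_{s₀} Einstein, since μ = λ -
|∇f|ζ is constant on a level, and a three-dimensional Einstein metric has constant curvature
(`isSpaceForm_of_einstein`). This is `exists_warped_chart`.

For conformal flatness put dt = ds/h, so that g = h²(dt² + g̃). It remains to make dt² + g̃ flat by
a factor w⁻² when g̃ has curvature κ. By the conformal change of the curvature
(`riemannUp_conformal`), -log w must produce the Schouten tensor κ/2 (g̃ - dt²). For κ ≥ 0 the
function w = exp(√κ t) does so. For κ ≤ 0 a positive function u on the fibre with Hess u = -κ u g̃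
and |du|² = -κ u² does so; these are local conditions on a space form, solved in
`IsSpaceForm.exists_horospherical`.

Two existence theorems support the geometry. Smooth dependence of flows on initial values
(`exists_smooth_flow`) comes from the inverse function theorem in a Banach space of curves, and
gives the coordinates that straighten ∇f. Local solvability of integrable linear total differential
systems (`exists_total_solution`) comes from solving along rays, and gives the function u. -/

noncomputable section

namespace RicciSoliton

/-! ### Smooth dependence of flows on time and initial value. -/

section SmoothFlow

open ContinuousMap

/-- Pointwise application of operators, as a continuous linear map in the operator function. -/
def pointwiseApply (K : Type) [TopologicalSpace K] [CompactSpace K]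
    (E F : Type) [NormedAddCommGroup E] [NormedSpace ℝ E]
    [NormedAddCommGroup F] [NormedSpace ℝ F] :
    C(K, E →L[ℝ] F) →L[ℝ] C(K, E) →L[ℝ] C(K, F) :=
  LinearMap.mkContinuous₂
    (LinearMap.mk₂ ℝ (fun (A : C(K, E →L[ℝ] F)) (h : C(K, E)) =>
      (⟨fun t => A t (h t), by fun_prop⟩ : C(K, F)))
      (fun A B h => by ext; simp) (fun c A h => by ext; simp)
      (fun A h k => by ext; simp) (fun c A h => by ext; simp)) 1
    (fun A h => by
      rw [one_mul, ContinuousMap.norm_le _ (by positivity)]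
      intro t
      exact (A t).le_of_opNorm_le_of_le (A.norm_coe_le_norm t) (h.norm_coe_le_norm t))

/-- The mean value inequality is applied on each segment from γ(t) to γ(t) + h(t); the estimate is
uniform in t because γ ↦ v' ∘ γ is continuous for the sup norm on curves over a compact space. -/
theorem hasFDerivAt_postcomp {K : Type} [TopologicalSpace K] [CompactSpace K]
    {E F : Type} [NormedAddCommGroup E] [NormedSpace ℝ E]
    [NormedAddCommGroup F] [NormedSpace ℝ F] (v : C(E, F)) (v' : C(E, E →L[ℝ] F))
    (hv : ∀ x, HasFDerivAt v (v' x) x) (γ : C(K, E)) :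
    HasFDerivAt (fun γ : C(K, E) => v.comp γ) (pointwiseApply K E F (v'.comp γ)) γ := by
  rw [hasFDerivAt_iff_isLittleO_nhds_zero, Asymptotics.isLittleO_iff]
  intro c hc
  have hcont : ContinuousAt (fun γ : C(K, E) => v'.comp γ) γ :=
    (ContinuousMap.continuous_postcomp v').continuousAt
  obtain ⟨δ, hδ, hball⟩ := (Metric.continuousAt_iff
    (f := fun γ : C(K, E) => v'.comp γ) (a := γ)).1 hcont c hc
  filter_upwards [Metric.ball_mem_nhds (0 : C(K, E)) hδ] with h hh
  rw [mem_ball_zero_iff] at hh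
  rw [ContinuousMap.norm_le _ (by positivity)]
  intro t
  -- Continuity of γ ↦ v' ∘ γ is used at the intermediate curves γ + θh, 0 ≤ θ ≤ 1, all of which lie
  -- in the δ-ball around γ.
  have key : ∀ z ∈ segment ℝ (γ t) (γ t + h t), ‖v' z - v' (γ t)‖ ≤ c := by
    intro z hz
    rw [segment_eq_image'] at hz
    obtain ⟨θ, hθ, rfl⟩ := hz
    have h1 : dist (γ + θ • h) γ < δ := by
      rw [dist_eq_norm, add_sub_cancel_left, norm_smul, Real.norm_of_nonneg hθ.1]
      nlinarith [norm_nonneg h, hθ.1, hθ.2]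
    have h2 := hball h1
    have h3 := (ContinuousMap.dist_apply_le_dist (f := v'.comp (γ + θ • h)) (g := v'.comp γ) t)
    have h4 := h3.trans h2.le
    rw [dist_eq_norm] at h4
    simpa using h4
  have := (convex_segment (γ t) (γ t + h t)).norm_image_sub_le_of_norm_hasFDerivWithin_le'
    (f := v) (f' := v') (φ := v' (γ t)) (C := c)
    (fun z _ => (hv z).hasFDerivWithinAt) key (left_mem_segment ℝ _ _) (right_mem_segment ℝ _ _)
  rw [add_sub_cancel_left] at this
  refine this.trans ?_
  gcongr
  exact h.norm_coe_le_norm t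

/-- Induction on the order. The target F must vary in the induction, because the derivative is
governed by v', which takes values in E →L F. -/
theorem contDiff_postcomp_nat {K : Type} [TopologicalSpace K] [CompactSpace K]
    {E : Type} [NormedAddCommGroup E] [NormedSpace ℝ E] (n : ℕ) :
    ∀ {F : Type} [NormedAddCommGroup F] [NormedSpace ℝ F] (v : C(E, F)),
      ContDiff ℝ n v → ContDiff ℝ n (fun γ : C(K, E) => v.comp γ) := by
  induction n with
  | zero =>
    intro F _ _ v hv
    exact contDiff_zero.2 (ContinuousMap.continuous_postcomp v)
  | succ n ih =>
    intro F _ _ v hv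
    have hv' : ContDiff ℝ (n + 1) v := by exact_mod_cast hv
    have h1 := (contDiff_succ_iff_fderiv.1 hv').2.2
    let v' : C(E, E →L[ℝ] F) := ⟨fderiv ℝ v, h1.continuous⟩
    have hd : ∀ x, HasFDerivAt v (v' x) x := fun x =>
      ((hv'.differentiable (by simp)) x).hasFDerivAt
    have : ContDiff ℝ (n + 1) (fun γ : C(K, E) => v.comp γ) := by
      refine (contDiff_succ_iff_hasFDerivAt).2 ⟨fun γ => pointwiseApply K E F (v'.comp γ), ?_, ?_⟩
      · exact (pointwiseApply K E F).contDiff.comp (ih v' h1)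
      · exact fun γ => hasFDerivAt_postcomp v v' hd γ
    exact_mod_cast this

/-- Composition with a smooth map is a smooth operation on continuous maps. -/
theorem contDiff_postcomp {K : Type} [TopologicalSpace K] [CompactSpace K]
    {E F : Type} [NormedAddCommGroup E] [NormedSpace ℝ E]
    [NormedAddCommGroup F] [NormedSpace ℝ F] (v : C(E, F)) (hv : ContDiff ℝ ∞ v) :
    ContDiff ℝ ∞ (fun γ : C(K, E) => v.comp γ) :=
  contDiff_infty.2 fun n => contDiff_postcomp_nat n v (contDiff_infty.1 hv n)

/-- The inverse function theorem for a smooth map on an open set. -/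
theorem exists_local_diffeo {E F : Type} [NormedAddCommGroup E] [NormedSpace ℝ E] [CompleteSpace E]
    [NormedAddCommGroup F] [NormedSpace ℝ F] {f : E → F} {s : Set E} (hs : IsOpen s)
    (hf : ContDiffOn ℝ ∞ f s) {a : E} (ha : a ∈ s) {f' : E ≃L[ℝ] F}
    (hf' : HasFDerivAt f (f' : E →L[ℝ] F) a) :
    ∃ φ : OpenPartialHomeomorph E F, a ∈ φ.source ∧ φ.source ⊆ s ∧ (φ : E → F) = f ∧
      ContDiffOn ℝ ∞ φ.symm φ.target := by
  have hfa : ContDiffAt ℝ ∞ f a := hf.contDiffAt (hs.mem_nhds ha)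
  let φ₀ := hfa.toOpenPartialHomeomorph f hf' (by simp)
  have hφ₀ : (φ₀ : E → F) = f := rfl
  have ha₀ : a ∈ φ₀.source := hfa.mem_toOpenPartialHomeomorph_source hf' (by simp)
  -- The inverse is smooth at a point of the target when the derivative is invertible at its
  -- preimage; invertibility is an open condition, so shrinking the source achieves it everywhere.
  have hcont : ContinuousAt (fderiv ℝ f) a := (hfa.fderiv_right (m := 0) (by simp)).continuousAt
  have hinv : ∀ᶠ x in 𝓝 a, fderiv ℝ f x ∈ Set.range ((↑) : (E ≃L[ℝ] F) → E →L[ℝ] F) := by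
    apply hcont.eventually_mem
    rw [hf'.fderiv]
    exact f'.nhds
  obtain ⟨t, ht, hto, hat⟩ := eventually_nhds_iff.1 hinv
  have hso : IsOpen (s ∩ t) := hs.inter hto
  have hsrc : (φ₀.restrOpen (s ∩ t) hso).source = φ₀.source ∩ (s ∩ t) := rfl
  refine ⟨φ₀.restrOpen (s ∩ t) hso, ⟨ha₀, ha, hat⟩, ?_, hφ₀, ?_⟩
  · rw [hsrc]; exact fun x hx => hx.2.1
  · intro y hy
    have hy' := (φ₀.restrOpen (s ∩ t) hso).map_target hy
    rw [hsrc] at hy'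
    obtain ⟨g', hg'⟩ := ht _ hy'.2.2
    refine ((φ₀.restrOpen (s ∩ t) hso).contDiffAt_symm hy (f₀' := g') ?_ ?_).contDiffWithinAt
    · rw [hg']
      exact ((hf.contDiffAt (hs.mem_nhds hy'.2.1)).differentiableAt (by simp)).hasFDerivAt
    · exact hf.contDiffAt (hs.mem_nhds hy'.2.1)

/-- The primitive `τ ↦ ∫₀^τ γ` as an operator on continuous curves on `[-1, 1]`. -/
def primitive (E : Type) [NormedAddCommGroup E] [NormedSpace ℝ E] :
    C(Set.Icc (-1 : ℝ) 1, E) →L[ℝ] C(Set.Icc (-1 : ℝ) 1, E) :=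
  LinearMap.mkContinuous
    { toFun := fun γ => ⟨fun τ => ∫ σ in (0 : ℝ)..τ, γ (Set.projIcc (-1) 1 (by norm_num) σ), by
        have : Continuous fun τ : ℝ => ∫ σ in (0 : ℝ)..τ, γ (Set.projIcc (-1) 1 (by norm_num) σ) :=
          intervalIntegral.continuous_primitive
            (fun a b => (Continuous.intervalIntegrable (by fun_prop) a b)) 0
        exact this.comp continuous_subtype_val⟩
      map_add' := fun γ η => by
        ext τ
        exact intervalIntegral.integral_add (Continuous.intervalIntegrable (by fun_prop) _ _)
          (Continuous.intervalIntegrable (by fun_prop) _ _)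
      map_smul' := fun c γ => by
        ext τ
        exact intervalIntegral.integral_smul _ _ } 1
    (fun γ => by
      rw [one_mul, ContinuousMap.norm_le _ (by positivity)]
      intro τ
      have := intervalIntegral.norm_integral_le_of_norm_le_const (a := (0 : ℝ)) (b := τ)
        (f := fun σ => γ (Set.projIcc (-1) 1 (by norm_num) σ)) (C := ‖γ‖)
        (fun σ _ => γ.norm_coe_le_norm _)
      refine this.trans ?_
      have h1 : |(τ : ℝ) - 0| ≤ 1 := by rw [sub_zero]; exact abs_le.2 τ.2
      nlinarith [norm_nonneg γ])

theorem primitive_apply {E : Type} [NormedAddCommGroup E] [NormedSpace ℝ E]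
    (γ : C(Set.Icc (-1 : ℝ) 1, E)) (τ : Set.Icc (-1 : ℝ) 1) :
    primitive E γ τ = ∫ σ in (0 : ℝ)..τ, γ (Set.projIcc (-1) 1 (by norm_num) σ) := rfl

/-- Constant curves. -/
def constCurve (E : Type) [NormedAddCommGroup E] [NormedSpace ℝ E] :
    E →L[ℝ] C(Set.Icc (-1 : ℝ) 1, E) :=
  LinearMap.mkContinuous
    { toFun := fun x => ContinuousMap.const _ x
      map_add' := fun _ _ => rfl
      map_smul' := fun _ _ => rfl } 1
    (fun x => by
      rw [one_mul, ContinuousMap.norm_le _ (by positivity)]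
      exact fun _ => le_rfl)

theorem constCurve_apply {E : Type} [NormedAddCommGroup E] [NormedSpace ℝ E]
    (x : E) (τ : Set.Icc (-1 : ℝ) 1) : constCurve E x τ = x := rfl

/-- The defect in the integral equation `γ(τ) = x + t ∫₀^τ v(γ)`, together with the parameters. -/
def flowEquation {E : Type} [NormedAddCommGroup E] [NormedSpace ℝ E] (v : C(E, E))
    (p : (ℝ × E) × C(Set.Icc (-1 : ℝ) 1, E)) : (ℝ × E) × C(Set.Icc (-1 : ℝ) 1, E) :=
  (p.1, p.2 - constCurve E p.1.2 - p.1.1 • primitive E (v.comp p.2))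

theorem contDiff_flowEquation {E : Type} [NormedAddCommGroup E] [NormedSpace ℝ E] (v : C(E, E))
    (hv : ContDiff ℝ ∞ v) : ContDiff ℝ ∞ (flowEquation v) := by
  have h1 : ContDiff ℝ ∞ (fun p : (ℝ × E) × C(Set.Icc (-1 : ℝ) 1, E) => v.comp p.2) :=
    (contDiff_postcomp v hv).comp contDiff_snd
  unfold flowEquation
  exact contDiff_fst.prodMk ((contDiff_snd.sub ((constCurve E).contDiff.comp
    (contDiff_snd.comp contDiff_fst))).sub ((contDiff_fst.comp contDiff_fst).smul
      ((primitive E).contDiff.comp h1)))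

/-- At t = 0 the variation of v ∘ γ is multiplied by zero. What is left is the identity plus a map
from the parameters (t, x) to curves, which is triangular and so invertible for every v. -/
theorem hasFDerivAt_flowEquation {E : Type} [NormedAddCommGroup E] [NormedSpace ℝ E] (v : C(E, E))
    (hv : ContDiff ℝ ∞ v) (x₀ : E) :
    ∃ f' : ((ℝ × E) × C(Set.Icc (-1 : ℝ) 1, E)) ≃L[ℝ] ((ℝ × E) × C(Set.Icc (-1 : ℝ) 1, E)),
      HasFDerivAt (flowEquation v) (f' : _ →L[ℝ] _) ((0, x₀), constCurve E x₀) := by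
  set u : (ℝ × E) × C(Set.Icc (-1 : ℝ) 1, E) := ((0, x₀), constCurve E x₀)
  have h1 : DifferentiableAt ℝ (fun p : (ℝ × E) × C(Set.Icc (-1 : ℝ) 1, E) => v.comp p.2) u :=
    (((contDiff_postcomp v hv).comp contDiff_snd).differentiable (by simp)) u
  have h20 : HasFDerivAt (fun p : (ℝ × E) × C(Set.Icc (-1 : ℝ) 1, E) => p.1.1) _ u :=
    ((ContinuousLinearMap.fst ℝ ℝ E).comp
      (ContinuousLinearMap.fst ℝ (ℝ × E) C(Set.Icc (-1 : ℝ) 1, E))).hasFDerivAt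
  have h21 : HasFDerivAt (fun p : (ℝ × E) × C(Set.Icc (-1 : ℝ) 1, E) =>
      primitive E (v.comp p.2)) _ u := (primitive E).hasFDerivAt.comp u h1.hasFDerivAt
  have h2 : HasFDerivAt (fun p : (ℝ × E) × C(Set.Icc (-1 : ℝ) 1, E) =>
      p.1.1 • primitive E (v.comp p.2)) _ u :=
    (h20.fun_smul h21)
  have h3 : HasFDerivAt (fun p : (ℝ × E) × C(Set.Icc (-1 : ℝ) 1, E) =>
      constCurve E p.1.2) _ u := (constCurve E).hasFDerivAt.comp u (hasFDerivAt_fst.snd)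
  have h4 := hasFDerivAt_fst.prodMk ((hasFDerivAt_snd.sub h3).sub h2)
  let L : (ℝ × E) →L[ℝ] C(Set.Icc (-1 : ℝ) 1, E) :=
    -(constCurve E).comp (ContinuousLinearMap.snd ℝ ℝ E) -
      (ContinuousLinearMap.fst ℝ ℝ E).smulRight (primitive E (v.comp (constCurve E x₀)))
  let f' : ((ℝ × E) × C(Set.Icc (-1 : ℝ) 1, E)) ≃L[ℝ] ((ℝ × E) × C(Set.Icc (-1 : ℝ) 1, E)) :=
    (ContinuousLinearEquiv.refl ℝ (ℝ × E)).skewProd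
      (ContinuousLinearEquiv.refl ℝ (C(Set.Icc (-1 : ℝ) 1, E))) L
  refine ⟨f', h4.congr_fderiv ?_⟩
  ext1
  · ext p <;> simp [f', L, u]
  · ext p <;> simp [f', L, u]

/-- Rescaling of a curve on `[-1, 1]` by a factor in `[-1, 1]`. -/
def rescale {E : Type} [TopologicalSpace E] (τ : Set.Icc (-1 : ℝ) 1)
    (γ : C(Set.Icc (-1 : ℝ) 1, E)) : C(Set.Icc (-1 : ℝ) 1, E) :=
  γ.comp ⟨fun σ => ⟨τ * σ, abs_le.1 (by
    rw [abs_mul]; exact mul_le_one₀ (abs_le.2 τ.2) (abs_nonneg _) (abs_le.2 σ.2))⟩, by fun_prop⟩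

/-- Substitution s ↦ τs in the integral. It shows that a solution of the integral equation for the
parameter t, rescaled by τ, solves it for tτ. -/
theorem primitive_rescale {E : Type} [NormedAddCommGroup E] [NormedSpace ℝ E]
    (τ : Set.Icc (-1 : ℝ) 1) (γ : C(Set.Icc (-1 : ℝ) 1, E)) :
    (τ : ℝ) • primitive E (rescale τ γ) = rescale τ (primitive E γ) := by
  ext σ
  have h1 : (τ : ℝ) • primitive E (rescale τ γ) σ =
      (τ : ℝ) • ∫ s in (0 : ℝ)..σ, γ (Set.projIcc (-1) 1 (by norm_num) (τ * s)) := by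
    rw [primitive_apply]
    congr 1
    refine intervalIntegral.integral_congr fun s hs => ?_
    have hs' : s ∈ Set.Icc (-1 : ℝ) 1 :=
      (Set.ordConnected_Icc.uIcc_subset (by norm_num) σ.2) hs
    have hm : (τ : ℝ) * s ∈ Set.Icc (-1 : ℝ) 1 := abs_le.1 (by
      rw [abs_mul]; exact mul_le_one₀ (abs_le.2 τ.2) (abs_nonneg _) (abs_le.2 hs'))
    simp [rescale, Set.projIcc_of_mem _ hs', Set.projIcc_of_mem _ hm]
  have h2 := intervalIntegral.smul_integral_comp_mul_left
    (f := fun s => γ (Set.projIcc (-1) 1 (by norm_num) s)) (a := 0) (b := (σ : ℝ)) (τ : ℝ)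
  rw [mul_zero] at h2
  rw [ContinuousMap.smul_apply, h1, h2]
  rfl

/-- Smooth dependence of the integral curves of `v` on time and initial value. -/
theorem exists_smooth_flow_of_contDiff {E : Type} [NormedAddCommGroup E] [NormedSpace ℝ E]
    [CompleteSpace E] {v : E → E} (hv : ContDiff ℝ ∞ v) (x₀ : E) :
    ∃ (Φ : ℝ × E → E) (δ : ℝ), 0 < δ ∧
      ContDiffOn ℝ ∞ Φ (Set.Ioo (-δ) δ ×ˢ Metric.ball x₀ δ) ∧
      (∀ x ∈ Metric.ball x₀ δ, Φ (0, x) = x) ∧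
      ∀ t ∈ Set.Ioo (-δ) δ, ∀ x ∈ Metric.ball x₀ δ,
        HasDerivAt (fun s => Φ (s, x)) (v (Φ (t, x))) t := by
  let vc : C(E, E) := ⟨v, hv.continuous⟩
  -- Solutions are curves on the fixed interval [-1, 1], with the true time t as a parameter. The
  -- local inverse evaluated at (p, 0) gives the solution for p = (t, x), smoothly in p.
  obtain ⟨f', hf'⟩ := hasFDerivAt_flowEquation vc hv x₀
  obtain ⟨φ, hφ₀, -, hφ, hφs⟩ := exists_local_diffeo isOpen_univ
    (contDiff_flowEquation vc hv).contDiffOn (Set.mem_univ _) hf'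
  set u : (ℝ × E) × C(Set.Icc (-1 : ℝ) 1, E) := ((0, x₀), constCurve E x₀) with hu
  have hu0 : flowEquation vc u = ((0, x₀), 0) := by simp [flowEquation, hu]
  have hφu : φ.symm ((0, x₀), 0) = u := by rw [← hu0, ← hφ]; exact φ.left_inv hφ₀
  have htgt : (((0, x₀), 0) : (ℝ × E) × C(Set.Icc (-1 : ℝ) 1, E)) ∈ φ.target := by
    rw [← hu0, ← hφ]; exact φ.map_source hφ₀
  let ψ : ℝ × E → C(Set.Icc (-1 : ℝ) 1, E) := fun p => (φ.symm (p, 0)).2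
  have hψu : ψ (0, x₀) = constCurve E x₀ := by simp only [ψ, hφu, hu]
  let N : Set (ℝ × E) := {p | (p, (0 : C(Set.Icc (-1 : ℝ) 1, E))) ∈ φ.target}
  have hNo : IsOpen N := φ.open_target.preimage (by fun_prop)
  have hψN : ContDiffOn ℝ ∞ ψ N :=
    contDiff_snd.comp_contDiffOn (hφs.comp (by fun_prop) (fun p hp => hp))
  have hsol : ∀ p ∈ N, (φ.symm (p, 0)).1 = p ∧
      ψ p - constCurve E p.2 - p.1 • primitive E (vc.comp (ψ p)) = 0 := by
    intro p hp
    have h1 := φ.right_inv hp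
    rw [hφ] at h1
    have h2 : (φ.symm (p, 0)).1 = p := congrArg Prod.fst h1
    have h3 := congrArg Prod.snd h1
    simp only [flowEquation, h2] at h3
    exact ⟨h2, h3⟩
  have huniq : ∀ p γ, (p, γ) ∈ φ.source →
      γ - constCurve E p.2 - p.1 • primitive E (vc.comp γ) = 0 → ψ p = γ := by
    intro p γ hs h0
    have h1 : φ (p, γ) = (p, 0) := by rw [hφ]; simp only [flowEquation, h0]
    have h2 := φ.left_inv hs
    rw [h1] at h2
    simp only [ψ, h2]
  obtain ⟨r, hr, hball⟩ := Metric.isOpen_iff.1 φ.open_source u hφ₀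
  have hψc : ContinuousAt ψ (0, x₀) :=
    (hψN.contDiffAt (hNo.mem_nhds htgt)).continuousAt
  have hψb : ∀ᶠ p in 𝓝 ((0 : ℝ), x₀), ψ p ∈ Metric.ball (constCurve E x₀) r := by
    apply hψc.eventually_mem
    rw [hψu]
    exact Metric.ball_mem_nhds _ hr
  obtain ⟨δ', hδ', hsub⟩ := Metric.eventually_nhds_iff.1
    ((hψb.and (hNo.mem_nhds htgt)).and (Metric.ball_mem_nhds ((0 : ℝ), x₀) hr))
  have hbox : ∀ t ∈ Set.Ioo (-δ') δ', ∀ x ∈ Metric.ball x₀ δ', dist (t, x) (0, x₀) < δ' := by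
    intro t ht x hx
    rw [Prod.dist_eq]
    refine max_lt ?_ hx
    rw [Real.dist_eq, sub_zero]
    exact abs_lt.2 ht
  -- The rescaled curve solves the equation for (tτ, x) and stays close to the constant curve, so
  -- local injectivity identifies it with ψ (tτ, x). Hence one function Φ, the value at 1, recovers
  -- the entire solution curve.
  have hscale : ∀ t ∈ Set.Ioo (-δ') δ', ∀ x ∈ Metric.ball x₀ δ', ∀ τ : Set.Icc (-1 : ℝ) 1,
      ψ (t * τ, x) = rescale τ (ψ (t, x)) := by
    intro t ht x hx τ
    obtain ⟨⟨hb, hN⟩, hrr⟩ := hsub (hbox t ht x hx)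
    apply huniq
    · apply hball
      rw [Metric.mem_ball, hu, Prod.dist_eq, Prod.dist_eq]
      rw [Prod.dist_eq] at hrr
      refine max_lt (max_lt ?_ ((le_max_right _ _).trans_lt hrr)) ?_
      · refine lt_of_le_of_lt ?_ ((le_max_left _ _).trans_lt hrr)
        simp only [Real.dist_eq, sub_zero, abs_mul]
        exact mul_le_of_le_one_right (abs_nonneg _) (abs_le.2 τ.2)
      · refine lt_of_le_of_lt ?_ hb
        rw [ContinuousMap.dist_le dist_nonneg]
        intro σ
        exact ContinuousMap.dist_apply_le_dist (f := ψ (t, x)) (g := constCurve E x₀) _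
    · have h1 := (hsol _ hN).2
      have h2 : vc.comp (rescale τ (ψ (t, x))) = rescale τ (vc.comp (ψ (t, x))) := rfl
      rw [mul_smul, h2, primitive_rescale]
      ext σ
      have h3 := congrArg (fun γ => rescale τ γ σ) h1
      exact h3
  let ev : C(Set.Icc (-1 : ℝ) 1, E) →L[ℝ] E :=
    ContinuousMap.evalCLM ℝ (⟨1, by norm_num⟩ : Set.Icc (-1 : ℝ) 1)
  let Φ : ℝ × E → E := fun p => ev (ψ p)
  have hΦ : ∀ t ∈ Set.Ioo (-δ') δ', ∀ x ∈ Metric.ball x₀ δ', ∀ τ : Set.Icc (-1 : ℝ) 1,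
      Φ (t * τ, x) = ψ (t, x) τ := by
    intro t ht x hx τ
    simp only [Φ, hscale t ht x hx τ]
    change ψ (t, x) _ = _
    congr 1
    ext
    simp
  have hint : ∀ t ∈ Set.Ioo (-δ') δ', ∀ x ∈ Metric.ball x₀ δ', ∀ τ : Set.Icc (-1 : ℝ) 1,
      Φ (t * τ, x) = x + t • ∫ σ in (0 : ℝ)..τ,
        v (ψ (t, x) (Set.projIcc (-1) 1 (by norm_num) σ)) := by
    intro t ht x hx τ
    rw [hΦ t ht x hx τ]
    have h1 := (hsol _ (hsub (hbox t ht x hx)).1.2).2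
    have h3 := congrArg (fun γ => γ τ) h1
    simp only [ContinuousMap.sub_apply, ContinuousMap.smul_apply, constCurve_apply,
      primitive_apply, ContinuousMap.zero_apply] at h3
    rw [sub_sub, sub_eq_zero] at h3
    exact h3
  refine ⟨Φ, δ', hδ', ?_, ?_, ?_⟩
  · refine ev.contDiff.comp_contDiffOn (hψN.mono ?_)
    rintro ⟨t, x⟩ ⟨ht, hx⟩
    exact (hsub (hbox t ht x hx)).1.2
  · intro x hx
    have := hint 0 ⟨by linarith, hδ'⟩ x hx ⟨0, by norm_num⟩
    simpa using this
  · intro t ht x hx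
    -- With |t| < t₁ < δ', the values Φ (s, x) for s near t all come from the single curve ψ (t₁, x)
    -- at s / t₁, so the derivative is that of an integral with variable endpoint.
    obtain ⟨t₁, h1, h2⟩ := exists_between (abs_lt.2 ht)
    have ht₁0 : 0 < t₁ := (abs_nonneg t).trans_lt h1
    have ht₁ : t₁ ∈ Set.Ioo (-δ') δ' := ⟨by linarith, h2⟩
    let c : ℝ → E := fun σ => v (ψ (t₁, x) (Set.projIcc (-1) 1 (by norm_num) σ))
    have hc : Continuous c := hv.continuous.comp ((ψ (t₁, x)).continuous.comp continuous_projIcc)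
    have hmem : ∀ s, |s| < t₁ → s / t₁ ∈ Set.Icc (-1 : ℝ) 1 := by
      intro s hs
      apply abs_le.1
      rw [abs_div, abs_of_pos ht₁0, div_le_one ht₁0]
      exact hs.le
    have heq : (fun s => Φ (s, x)) =ᶠ[𝓝 t] fun s => x + t₁ • ∫ σ in (0 : ℝ)..(s / t₁), c σ := by
      have : ∀ᶠ s in 𝓝 t, |s| < t₁ := (continuous_abs.tendsto t).eventually_lt_const h1
      filter_upwards [this] with s hs
      have := hint t₁ ht₁ x hx ⟨s / t₁, hmem s hs⟩
      simpa only [mul_div_cancel₀ _ ht₁0.ne'] using this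
    have hd : HasDerivAt (fun s => x + t₁ • ∫ σ in (0 : ℝ)..(s / t₁), c σ)
        (t₁ • ((1 / t₁) • c (t / t₁))) t := by
      refine HasDerivAt.const_add x (HasDerivAt.const_smul t₁ ?_)
      exact (hc.integral_hasStrictDerivAt 0 (t / t₁)).hasDerivAt.scomp t
        ((hasDerivAt_id t).div_const t₁)
    refine (hd.congr_of_eventuallyEq heq).congr_deriv ?_
    rw [smul_smul, mul_one_div_cancel ht₁0.ne', one_smul]
    have h3 := hΦ t₁ ht₁ x hx ⟨t / t₁, hmem t h1⟩
    simp only [mul_div_cancel₀ _ ht₁0.ne'] at h3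
    simp only [c, Set.projIcc_of_mem _ (hmem t h1), h3]

/-- Local version of the smooth flow, for a vector field on an open set. -/
theorem exists_smooth_flow {E : Type} [NormedAddCommGroup E] [NormedSpace ℝ E]
    [FiniteDimensional ℝ E] {v : E → E} {Ω : Set E} (hΩ : IsOpen Ω) (hv : ContDiffOn ℝ ∞ v Ω)
    {x₀ : E} (hx₀ : x₀ ∈ Ω) :
    ∃ (Φ : ℝ × E → E) (δ : ℝ), 0 < δ ∧
      ContDiffOn ℝ ∞ Φ (Set.Ioo (-δ) δ ×ˢ Metric.ball x₀ δ) ∧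
      (∀ x ∈ Metric.ball x₀ δ, Φ (0, x) = x) ∧
      ∀ t ∈ Set.Ioo (-δ) δ, ∀ x ∈ Metric.ball x₀ δ, Φ (t, x) ∈ Ω ∧
        HasDerivAt (fun s => Φ (s, x)) (v (Φ (t, x))) t := by
  have : CompleteSpace E := FiniteDimensional.complete ℝ E
  obtain ⟨R, hR, hRΩ⟩ := Metric.isOpen_iff.1 hΩ x₀ hx₀
  -- The cutoff makes v globally smooth and equals 1 on the ball of radius R/3; trajectories that
  -- remain in that ball are integral curves of v itself.
  let χ : ContDiffBump x₀ := ⟨R / 3, R / 2, by positivity, by linarith⟩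
  have hw : ContDiff ℝ ∞ (fun x => χ x • v x) := by
    rw [contDiff_iff_contDiffAt]
    intro x
    by_cases hx : x ∈ Ω
    · exact χ.contDiffAt.smul (hv.contDiffAt (hΩ.mem_nhds hx))
    · have hxt : x ∉ tsupport χ := by
        rw [χ.tsupport_eq]
        intro h
        apply hx
        apply hRΩ
        exact Metric.closedBall_subset_ball (by change R / 2 < R; linarith) h
      have : (fun x => χ x • v x) =ᶠ[𝓝 x] fun _ => 0 := by
        filter_upwards [(notMem_tsupport_iff_eventuallyEq.1 hxt)] with y hy
        rw [hy]; simp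
      exact contDiffAt_const.congr_of_eventuallyEq this
  obtain ⟨Φ, δ, hδ, hΦ, hΦ0, hΦd⟩ := exists_smooth_flow_of_contDiff hw x₀
  have h0 : ((0 : ℝ), x₀) ∈ Set.Ioo (-δ) δ ×ˢ Metric.ball x₀ δ :=
    ⟨⟨by linarith, hδ⟩, Metric.mem_ball_self hδ⟩
  have hc : ContinuousAt Φ (0, x₀) :=
    (hΦ.contDiffAt ((isOpen_Ioo.prod Metric.isOpen_ball).mem_nhds h0)).continuousAt
  have hev : ∀ᶠ p in 𝓝 ((0 : ℝ), x₀), Φ p ∈ Metric.ball x₀ (R / 3) := by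
    apply hc.eventually_mem
    rw [hΦ0 x₀ h0.2]
    exact Metric.ball_mem_nhds _ (by positivity)
  obtain ⟨δ₁, hδ₁, hsub⟩ := Metric.eventually_nhds_iff.1 hev
  have h1 : min δ δ₁ ≤ δ := min_le_left _ _
  have h2 : min δ δ₁ ≤ δ₁ := min_le_right _ _
  have hI : Set.Ioo (-min δ δ₁) (min δ δ₁) ⊆ Set.Ioo (-δ) δ :=
    Set.Ioo_subset_Ioo (by linarith) h1
  refine ⟨Φ, min δ δ₁, lt_min hδ hδ₁, hΦ.mono (Set.prod_mono hI (Metric.ball_subset_ball h1)),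
    fun x hx => hΦ0 x (Metric.ball_subset_ball h1 hx), fun t ht x hx => ?_⟩
  have hm : Φ (t, x) ∈ Metric.ball x₀ (R / 3) := by
    apply hsub
    rw [Prod.dist_eq]
    refine max_lt ?_ (lt_of_lt_of_le hx h2)
    rw [Real.dist_eq, sub_zero]
    exact (abs_lt.2 ht).trans_le h2
  refine ⟨hRΩ (Metric.ball_subset_ball (by linarith) hm), ?_⟩
  have := hΦd t (hI ht) x (Metric.ball_subset_ball h1 hx)
  rwa [χ.one_of_mem_closedBall (Metric.ball_subset_closedBall hm), one_smul] at this

end SmoothFlow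

/-! ### Straightening a vector field with a prescribed first coordinate. -/

section FlowBox

theorem hasFDerivAt_left_inverse {E : Type} [NormedAddCommGroup E] [NormedSpace ℝ E]
    (φ : OpenPartialHomeomorph E E) (h₁ : ContDiffOn ℝ ∞ φ φ.source)
    (h₂ : ContDiffOn ℝ ∞ φ.symm φ.target) {y : E} (hy : y ∈ φ.target) (u : E) :
    fderiv ℝ φ.symm y (fderiv ℝ φ (φ.symm y) u) = u := by
  have hz := φ.map_target hy
  have d1 : HasFDerivAt φ (fderiv ℝ φ (φ.symm y)) (φ.symm y) :=
    ((h₁.contDiffAt (φ.open_source.mem_nhds hz)).differentiableAt (by simp)).hasFDerivAt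
  have d2 : HasFDerivAt φ.symm (fderiv ℝ φ.symm y) (φ (φ.symm y)) := by
    rw [φ.right_inv hy]
    exact ((h₂.contDiffAt (φ.open_target.mem_nhds hy)).differentiableAt (by simp)).hasFDerivAt
  have d3 := d2.comp _ d1
  have d4 : HasFDerivAt (φ.symm ∘ φ) (ContinuousLinearMap.id ℝ E) (φ.symm y) := by
    refine (hasFDerivAt_id _).congr_of_eventuallyEq ?_
    filter_upwards [φ.open_source.mem_nhds hz] with z hz
    exact φ.left_inv hz
  exact DFunLike.congr_fun (d3.unique d4) u

/-- Coordinates straightening a vector field `v`, with a prescribed first coordinate `F`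
that is not critical along `v`. -/
theorem exists_flow_box {n : ℕ} {Ω : Set (Eu (n + 1))} (hΩ : IsOpen Ω)
    {v : Eu (n + 1) → Eu (n + 1)} (hv : ContDiffOn ℝ ∞ v Ω)
    {F : Eu (n + 1) → ℝ} (hF : ContDiffOn ℝ ∞ F Ω) {x₀ : Eu (n + 1)} (hx₀ : x₀ ∈ Ω)
    (hne : fderiv ℝ F x₀ (v x₀) ≠ 0) :
    ∃ φ : OpenPartialHomeomorph (Eu (n + 1)) (Eu (n + 1)), x₀ ∈ φ.source ∧ φ.source ⊆ Ω ∧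
      ContDiffOn ℝ ∞ φ φ.source ∧ ContDiffOn ℝ ∞ φ.symm φ.target ∧
      (∀ y ∈ φ.source, φ y 0 = F y) ∧
      ∀ y ∈ φ.source, fderiv ℝ φ y (v y)
        = fderiv ℝ F y (v y) • (EuclideanSpace.single 0 1 : Eu (n + 1)) := by
  obtain ⟨Φ, δ, hδ, hΦ, hΦ0, hΦd⟩ := exists_smooth_flow hΩ hv hx₀
  set e₀ : Eu (n + 1) := EuclideanSpace.single 0 1 with he₀
  have he₀0 : e₀ 0 = 1 := by simp [e₀]
  have he₀ne : e₀ ≠ 0 := fun h => by rw [h] at he₀0; simp at he₀0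
  have hvne : v x₀ ≠ 0 := fun h => hne (by rw [h, map_zero])
  -- A is a linear isomorphism with A e₀ = v(x₀). Flowing for time y₀ from x₀ + A y - y₀ v(x₀), a
  -- point independent of y₀, gives a map T that carries e₀ to v and has derivative A at 0.
  obtain ⟨A, hA⟩ := SeparatingDual.exists_continuousLinearEquiv_apply_eq (R := ℝ) he₀ne hvne
  let pr : Eu (n + 1) →L[ℝ] ℝ := EuclideanSpace.proj 0
  have hpr : ∀ y, pr y = y 0 := fun _ => rfl
  let L : Eu (n + 1) →L[ℝ] Eu (n + 1) := (A : Eu (n + 1) →L[ℝ] Eu (n + 1)) - pr.smulRight (v x₀)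
  have hL : ∀ y, L y = A y - y 0 • v x₀ := fun y => rfl
  let ι : Eu (n + 1) → ℝ × Eu (n + 1) := fun y => (pr y, x₀ + L y)
  have hι : ContDiff ℝ ∞ ι := pr.contDiff.prodMk (contDiff_const.add L.contDiff)
  let T : Eu (n + 1) → Eu (n + 1) := fun y => Φ (ι y)
  let B : Set (ℝ × Eu (n + 1)) := Set.Ioo (-δ) δ ×ˢ Metric.ball x₀ δ
  have hB : IsOpen B := isOpen_Ioo.prod Metric.isOpen_ball
  let D : Set (Eu (n + 1)) := ι ⁻¹' B
  have hD : IsOpen D := hB.preimage hι.continuous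
  have hT : ContDiffOn ℝ ∞ T D := hΦ.comp hι.contDiffOn (fun y hy => hy)
  have hι0 : ι 0 = (0, x₀) := by simp [ι]
  have h0B : ((0 : ℝ), x₀) ∈ B := ⟨⟨by linarith, hδ⟩, Metric.mem_ball_self hδ⟩
  have h0D : (0 : Eu (n + 1)) ∈ D := by change ι 0 ∈ B; rw [hι0]; exact h0B
  have hT0 : T 0 = x₀ := by simp only [T, hι0]; exact hΦ0 x₀ h0B.2
  have hTe : ∀ y ∈ D, fderiv ℝ T y e₀ = v (T y) := by
    intro y hy
    have d1 : HasFDerivAt T (fderiv ℝ T y) y :=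
      ((hT.contDiffAt (hD.mem_nhds hy)).differentiableAt (by simp)).hasFDerivAt
    have d2 : HasDerivAt (fun s : ℝ => y + s • e₀) e₀ 0 := by
      simpa using ((hasDerivAt_id (0 : ℝ)).smul_const e₀).const_add y
    have d3 : HasDerivAt (fun s : ℝ => T (y + s • e₀)) (fderiv ℝ T y e₀) 0 := by
      refine HasFDerivAt.comp_hasDerivAt (l := T) (f := fun s : ℝ => y + s • e₀) 0 ?_ d2
      simpa using d1
    have hLe : L e₀ = 0 := by rw [hL, he₀0, hA]; simp
    have heq : (fun s : ℝ => T (y + s • e₀)) = fun s => Φ (y 0 + s, x₀ + L y) := by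
      funext s
      simp only [T, ι, map_add, map_smul, hLe, hpr]
      simp [he₀0]
    have d4 : HasDerivAt (fun s : ℝ => Φ (y 0 + s, x₀ + L y)) (v (T y)) 0 := by
      have := (hΦd (y 0) hy.1 (x₀ + L y) hy.2).2
      have h5 := HasDerivAt.comp_const_add (y 0) (0 : ℝ) (by simpa using this)
      exact h5
    rw [heq] at d3
    exact d3.unique d4
  have hTA : HasFDerivAt T (A : Eu (n + 1) →L[ℝ] Eu (n + 1)) 0 := by
    have d1 : HasFDerivAt Φ (fderiv ℝ Φ (0, x₀)) (0, x₀) :=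
      ((hΦ.contDiffAt (hB.mem_nhds h0B)).differentiableAt (by simp)).hasFDerivAt
    have d2 : HasFDerivAt ι (pr.prod L) 0 := by
      exact pr.hasFDerivAt.prodMk (L.hasFDerivAt.const_add x₀)
    have d3 : HasFDerivAt T ((fderiv ℝ Φ (0, x₀)).comp (pr.prod L)) 0 := by
      refine HasFDerivAt.comp (g := Φ) 0 ?_ d2
      rw [hι0]; exact d1
    have e1 : fderiv ℝ Φ (0, x₀) (1, 0) = v x₀ := by
      have c1 : HasDerivAt (fun s : ℝ => ((s, x₀) : ℝ × Eu (n + 1))) (1, 0) 0 :=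
        (hasDerivAt_id (0 : ℝ)).prodMk (hasDerivAt_const _ _)
      have c2 := HasFDerivAt.comp_hasDerivAt (l := Φ) 0 d1 c1
      have c3 := (hΦd 0 h0B.1 x₀ h0B.2).2
      rw [hΦ0 x₀ h0B.2] at c3
      exact c2.unique c3
    have e2 : ∀ w, fderiv ℝ Φ (0, x₀) (0, w) = w := by
      intro w
      have c1 : HasFDerivAt (fun x : Eu (n + 1) => ((0 : ℝ), x))
          (ContinuousLinearMap.inr ℝ ℝ (Eu (n + 1))) x₀ := hasFDerivAt_prodMk_right _ _
      have c2 := HasFDerivAt.comp (g := Φ) x₀ d1 c1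
      have c3 : HasFDerivAt (Φ ∘ fun x : Eu (n + 1) => ((0 : ℝ), x))
          (ContinuousLinearMap.id ℝ _) x₀ := by
        refine (hasFDerivAt_id _).congr_of_eventuallyEq ?_
        filter_upwards [Metric.ball_mem_nhds x₀ hδ] with x hx
        exact hΦ0 x hx
      exact DFunLike.congr_fun (c2.unique c3) w
    refine d3.congr_fderiv ?_
    ext1 w
    have hsplit : (pr.prod L) w = w 0 • ((1 : ℝ), (0 : Eu (n + 1))) + ((0 : ℝ), L w) := by
      ext1 <;> simp [hpr]
    rw [ContinuousLinearMap.comp_apply, hsplit, map_add, map_smul, e1, e2, hL]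
    simp
  obtain ⟨χ, hχ0, hχD, hχT, hχs⟩ := exists_local_diffeo hD hT h0D hTA
  have hχ1 : ContDiffOn ℝ ∞ χ χ.source := by rw [hχT]; exact hT.mono hχD
  have hx₀t : x₀ ∈ χ.target := by rw [← hT0, ← hχT]; exact χ.map_source hχ0
  have hBv : ∀ y ∈ χ.target, fderiv ℝ χ.symm y (v y) = e₀ := by
    intro y hy
    have h1 := hasFDerivAt_left_inverse χ hχ1 hχs hy e₀
    have h2 := hTe _ (hχD (χ.map_target hy))
    rw [hχT, h2, ← hχT, χ.right_inv hy] at h1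
    exact h1
  -- In the straightened coordinates the component of index 0 is replaced by F; the other
  -- coordinates remain constant along v.
  let Q : Eu (n + 1) → Eu (n + 1) := fun y => χ.symm y + (F y - pr (χ.symm y)) • e₀
  let S : Set (Eu (n + 1)) := Ω ∩ χ.target
  have hS : IsOpen S := hΩ.inter χ.open_target
  have hx₀S : x₀ ∈ S := ⟨hx₀, hx₀t⟩
  have hχS : ContDiffOn ℝ ∞ χ.symm S := hχs.mono Set.inter_subset_right
  have hQ : ContDiffOn ℝ ∞ Q S :=
    hχS.add (((hF.mono Set.inter_subset_left).sub (pr.contDiff.comp_contDiffOn hχS)).smul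
      contDiffOn_const)
  have hQ' : ∀ y ∈ S, HasFDerivAt Q (fderiv ℝ χ.symm y +
      (fderiv ℝ F y - pr.comp (fderiv ℝ χ.symm y)).smulRight e₀) y := by
    intro y hy
    have d1 : HasFDerivAt χ.symm (fderiv ℝ χ.symm y) y :=
      ((hχS.contDiffAt (hS.mem_nhds hy)).differentiableAt (by simp)).hasFDerivAt
    have d2 : HasFDerivAt F (fderiv ℝ F y) y :=
      ((hF.contDiffAt (hΩ.mem_nhds hy.1)).differentiableAt (by simp)).hasFDerivAt
    exact d1.add ((d2.sub (pr.hasFDerivAt.comp y d1)).smul_const e₀)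
  have hQv : ∀ y ∈ S, fderiv ℝ Q y (v y) = fderiv ℝ F y (v y) • e₀ := by
    intro y hy
    rw [(hQ' y hy).fderiv]
    simp only [_root_.add_apply, ContinuousLinearMap.smulRight_apply,
      _root_.sub_apply, ContinuousLinearMap.comp_apply, hBv y hy.2, hpr, he₀0]
    module
  -- A kernel vector has straightened image proportional to e₀, hence is a multiple of v(x₀); on
  -- v(x₀) the derivative of Q is dF(v) e₀, which is nonzero.
  have hinj : Function.Injective (fderiv ℝ Q x₀) := by
    rw [injective_iff_map_eq_zero]
    intro u hu
    have hu' := hu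
    rw [(hQ' x₀ hx₀S).fderiv] at hu'
    simp only [_root_.add_apply, ContinuousLinearMap.smulRight_apply] at hu'
    set c : ℝ := -((fderiv ℝ F x₀ - pr.comp (fderiv ℝ χ.symm x₀)) u) with hc
    have h1 : fderiv ℝ χ.symm x₀ u = fderiv ℝ χ.symm x₀ (c • v x₀) := by
      rw [map_smul, hBv x₀ hx₀t, hc, neg_smul]
      exact eq_neg_of_add_eq_zero_left hu'
    have h2 : u = c • v x₀ := by
      have hsymm := hasFDerivAt_left_inverse χ.symm hχs (by simpa using hχ1)
        (y := χ.symm x₀) (χ.map_target hx₀t)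
      simp only [OpenPartialHomeomorph.symm_symm, χ.right_inv hx₀t] at hsymm
      rw [← hsymm u, h1, hsymm]
    rw [h2, map_smul, hQv x₀ hx₀S, smul_smul] at hu
    have h3 := (smul_eq_zero.1 hu).resolve_right he₀ne
    have h4 := (mul_eq_zero.1 h3).resolve_right hne
    rw [h2, h4, zero_smul]
  let Q' : Eu (n + 1) ≃L[ℝ] Eu (n + 1) :=
    (LinearEquiv.ofInjectiveEndo (fderiv ℝ Q x₀).toLinearMap hinj).toContinuousLinearEquiv
  have hQeq : HasFDerivAt Q (Q' : Eu (n + 1) →L[ℝ] Eu (n + 1)) x₀ := by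
    refine (hQ' x₀ hx₀S).differentiableAt.hasFDerivAt.congr_fderiv ?_
    ext1 w
    rfl
  obtain ⟨φ, hφ0, hφS, hφQ, hφs⟩ := exists_local_diffeo hS hQ hx₀S hQeq
  refine ⟨φ, hφ0, fun y hy => (hφS hy).1, by rw [hφQ]; exact hQ.mono hφS, hφs, ?_, ?_⟩
  · intro y _
    rw [hφQ]
    simp only [Q, PiLp.add_apply, PiLp.smul_apply, hpr, he₀0, smul_eq_mul, mul_one]
    ring
  · intro y hy
    rw [hφQ]
    exact hQv y (hφS hy)

end FlowBox

/-! ### Tangent vectors and the metric in charts of the maximal atlas. -/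

section Charts

set_option linter.unusedSectionVars false

variable {n : ℕ} {M : Type*} [TopologicalSpace M] [ChartedSpace (Eu n) M]
  [IsManifold (𝓡 n) ∞ M]

theorem mdifferentiableAt_chart {e : OpenPartialHomeomorph M (Eu n)} (he : e ∈ Charts n M) {x : M}
    (hx : x ∈ e.source) : MDifferentiableAt (𝓡 n) (𝓡 n) e x :=
  ((contMDiffOn_of_mem_maximalAtlas he).contMDiffAt (e.open_source.mem_nhds hx)).mdifferentiableAt
    (by simp)

theorem mdifferentiableAt_chart_symm {e : OpenPartialHomeomorph M (Eu n)} (he : e ∈ Charts n M)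
    {y : Eu n} (hy : y ∈ e.target) : MDifferentiableAt (𝓡 n) (𝓡 n) e.symm y :=
  ((contMDiffOn_symm_of_mem_maximalAtlas he).contMDiffAt
    (e.open_target.mem_nhds hy)).mdifferentiableAt (by simp)

/-- The differential of a chart. -/
def chartDeriv (e : OpenPartialHomeomorph M (Eu n)) (y : Eu n) :
    TangentSpace (𝓡 n) (e.symm y) →L[ℝ] Eu n :=
  mfderiv (𝓡 n) (𝓡 n) e (e.symm y)

/-- The differential of the inverse of a chart. -/
def chartSymmDeriv (e : OpenPartialHomeomorph M (Eu n)) (y : Eu n) :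
    Eu n →L[ℝ] TangentSpace (𝓡 n) (e.symm y) :=
  mfderiv (𝓡 n) (𝓡 n) e.symm y

theorem coordField_eq (e : OpenPartialHomeomorph M (Eu n)) (i : Fin n) (y : Eu n) :
    coordField e i y = chartSymmDeriv e y (EuclideanSpace.single i 1) := rfl

theorem comp_eq (e : OpenPartialHomeomorph M (Eu n)) (y : Eu n)
    (v : TangentSpace (𝓡 n) (e.symm y)) (i : Fin n) :
    comp e v i = chartDeriv e y v i := rfl

theorem chartDeriv_chartSymmDeriv {e : OpenPartialHomeomorph M (Eu n)} (he : e ∈ Charts n M)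
    {y : Eu n} (hy : y ∈ e.target) (u : Eu n) :
    chartDeriv e y (chartSymmDeriv e y u) = u := by
  have h1 := mfderiv_comp y (mdifferentiableAt_chart he (e.map_target hy))
    (mdifferentiableAt_chart_symm he hy)
  have h2 : mfderiv (𝓡 n) (𝓡 n) (e ∘ e.symm) y = mfderiv (𝓡 n) (𝓡 n) (id : Eu n → Eu n) y := by
    apply Filter.EventuallyEq.mfderiv_eq
    filter_upwards [e.open_target.mem_nhds hy] with z hz
    exact e.right_inv hz
  rw [h2, mfderiv_id] at h1
  exact (DFunLike.congr_fun h1 u).symm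

theorem chartSymmDeriv_chartDeriv {e : OpenPartialHomeomorph M (Eu n)} (he : e ∈ Charts n M)
    {y : Eu n} (hy : y ∈ e.target) (v : TangentSpace (𝓡 n) (e.symm y)) :
    chartSymmDeriv e y (chartDeriv e y v) = v := by
  let A : Eu n →L[ℝ] Eu n := chartDeriv e y
  -- In equal finite dimensions the one-sided inverse already found is two-sided.
  have hinj : Function.Injective A.toLinearMap := by
    have hsurj : Function.Surjective A.toLinearMap := fun u =>
      ⟨chartSymmDeriv e y u, chartDeriv_chartSymmDeriv he hy u⟩
    exact LinearMap.injective_iff_surjective.2 hsurj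
  exact hinj (chartDeriv_chartSymmDeriv he hy _)

theorem comp_coordField {e : OpenPartialHomeomorph M (Eu n)} (he : e ∈ Charts n M)
    {y : Eu n} (hy : y ∈ e.target) (i j : Fin n) :
    comp e (coordField e i y) j = if j = i then 1 else 0 := by
  rw [comp_eq, coordField_eq, chartDeriv_chartSymmDeriv he hy]
  simp

theorem eq_sum_coordField {e : OpenPartialHomeomorph M (Eu n)} (he : e ∈ Charts n M)
    {y : Eu n} (hy : y ∈ e.target) (v : TangentSpace (𝓡 n) (e.symm y)) :
    v = ∑ i, comp e v i • coordField e i y := by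
  conv_lhs => rw [← chartSymmDeriv_chartDeriv he hy v]
  have : chartDeriv e y v = ∑ i, comp e v i • (EuclideanSpace.single i 1 : Eu n) := by
    ext j
    simp [comp_eq, Pi.single_apply]
  rw [this, map_sum]
  simp only [map_smul, coordField_eq]

theorem mfderiv_coordField {e : OpenPartialHomeomorph M (Eu n)} (he : e ∈ Charts n M)
    {y : Eu n} (hy : y ∈ e.target) {f : M → ℝ} (hf : ContMDiff (𝓡 n) 𝓘(ℝ, ℝ) ∞ f) (i : Fin n) :
    (mfderiv (𝓡 n) 𝓘(ℝ, ℝ) f (e.symm y) (coordField e i y) : ℝ) = pd i (f ∘ e.symm) y := by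
  have h1 := mfderiv_comp y ((hf (e.symm y)).mdifferentiableAt (by simp))
    (mdifferentiableAt_chart_symm he hy)
  rw [pd, ← mfderiv_eq_fderiv, h1]
  rfl

theorem contDiffOn_comp_chart_symm {e : OpenPartialHomeomorph M (Eu n)} (he : e ∈ Charts n M)
    {f : M → ℝ} (hf : ContMDiff (𝓡 n) 𝓘(ℝ, ℝ) ∞ f) : ContDiffOn ℝ ∞ (f ∘ e.symm) e.target :=
  contMDiffOn_iff_contDiffOn.1 (hf.comp_contMDiffOn (contMDiffOn_symm_of_mem_maximalAtlas he))

theorem contMDiffOn_coordField {e : OpenPartialHomeomorph M (Eu n)} (he : e ∈ Charts n M)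
    (i : Fin n) : ContMDiffOn (𝓡 n) (𝓡 n).tangent ∞
      (fun y => (⟨e.symm y, coordField e i y⟩ : TangentBundle (𝓡 n) M)) e.target := by
  have h1 := (contMDiffOn_symm_of_mem_maximalAtlas he).contMDiffOn_tangentMapWithin (m := ∞)
    (by simp) e.open_target.uniqueMDiffOn
  have h2 : ContMDiffOn (𝓡 n) (𝓡 n).tangent ∞
      (fun y => (⟨y, (EuclideanSpace.single i 1 : Eu n)⟩ : TangentBundle (𝓡 n) (Eu n)))
      e.target :=
    contMDiffOn_vectorSpace_iff_contDiffOn.2 contDiffOn_const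
  refine (h1.comp h2 (fun y hy => hy)).congr fun y hy => ?_
  simp only [Function.comp_apply, tangentMapWithin, coordField,
    mfderivWithin_of_isOpen e.open_target hy]

theorem contDiffOn_inChart (g : RMetric n M) {e : OpenPartialHomeomorph M (Eu n)}
    (he : e ∈ Charts n M) (i j : Fin n) :
    ContDiffOn ℝ ∞ (fun y => inChart g e y i j) e.target := by
  have : ContMDiffOn (𝓡 n) ((𝓡 n).prod 𝓘(ℝ)) ∞
      (fun y => Bundle.TotalSpace.mk' ℝ (E := Bundle.Trivial M ℝ) (e.symm y)
        (g.inner (e.symm y) (coordField e i y) (coordField e j y))) e.target := by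
    apply ContMDiffOn.clm_bundle_apply₂ (F₁ := Eu n) (F₂ := Eu n)
    · exact g.contMDiff.comp_contMDiffOn (contMDiffOn_symm_of_mem_maximalAtlas he)
    · exact contMDiffOn_coordField he i
    · exact contMDiffOn_coordField he j
  intro y hy
  have h2 := this y hy
  simp only [Bundle.contMDiffWithinAt_totalSpace] at h2
  exact contMDiffWithinAt_iff_contDiffWithinAt.1 h2.2

theorem inner_sum_coordField (g : RMetric n M) (e : OpenPartialHomeomorph M (Eu n)) (y : Eu n)
    (a b : Fin n → ℝ) :
    g.inner (e.symm y) (∑ i, a i • coordField e i y) (∑ j, b j • coordField e j y)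
      = ∑ i, ∑ j, a i * b j * inChart g e y i j := by
  simp only [map_sum, map_smul, _root_.sum_apply, _root_.smul_apply, smul_eq_mul, inChart,
    Matrix.of_apply, Finset.mul_sum]
  rw [Finset.sum_comm]
  refine Finset.sum_congr rfl fun i _ => Finset.sum_congr rfl fun j _ => ?_
  ring

theorem isMetricOn_inChart (g : RMetric n M) {e : OpenPartialHomeomorph M (Eu n)}
    (he : e ∈ Charts n M) : IsMetricOn (inChart g e) e.target := by
  refine ⟨contDiffOn_inChart g he, fun y hy => ?_⟩
  refine Matrix.PosDef.of_dotProduct_mulVec_pos ?_ fun x hx => ?_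
  · ext i j
    exact g.symm _ _ _
  · have h1 : (∑ i, x i • coordField e i y) ≠ 0 := by
      intro h
      apply hx
      funext j
      have h2 := congrArg (fun v => chartDeriv e y v j) h
      simp only [map_sum, map_smul, coordField_eq, chartDeriv_chartSymmDeriv he hy] at h2
      simpa [Pi.single_apply] using h2
    have h3 := g.pos _ _ h1
    rw [inner_sum_coordField] at h3
    refine h3.trans_eq ?_
    simp only [dotProduct, Matrix.mulVec, Finset.mul_sum]
    refine Finset.sum_congr rfl fun i _ => Finset.sum_congr rfl fun j _ => ?_
    change _ = x i * (inChart g e y i j * x j)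
    ring

/-- This permits every coordinate change used below: smooth local diffeomorphisms of ℝⁿ may be
composed after a chart. -/
theorem trans_mem_charts {e : OpenPartialHomeomorph M (Eu n)} (he : e ∈ Charts n M)
    {φ : OpenPartialHomeomorph (Eu n) (Eu n)} (h₁ : ContDiffOn ℝ ∞ φ φ.source)
    (h₂ : ContDiffOn ℝ ∞ φ.symm φ.target) : e.trans φ ∈ Charts n M := by
  have hφ : φ ∈ contDiffGroupoid ∞ (𝓡 n) := by
    rw [contDiffGroupoid, mem_groupoid_of_pregroupoid]
    constructor <;> change ContDiffOn ℝ ∞ _ _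
    · simpa using h₁
    · simpa using h₂
  intro e' he'
  obtain ⟨ha, hb⟩ := he e' he'
  constructor
  · rw [OpenPartialHomeomorph.trans_symm_eq_symm_trans_symm, OpenPartialHomeomorph.trans_assoc]
    exact StructureGroupoid.trans _ (StructureGroupoid.symm _ hφ) ha
  · rw [← OpenPartialHomeomorph.trans_assoc]
    exact StructureGroupoid.trans _ hb hφ

theorem restr_mem_charts {e : OpenPartialHomeomorph M (Eu n)} (he : e ∈ Charts n M)
    {s : Set M} (hs : IsOpen s) : e.restr s ∈ Charts n M :=
  restr_mem_maximalAtlas _ he hs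

theorem chartSymmDeriv_trans {e : OpenPartialHomeomorph M (Eu n)} (he : e ∈ Charts n M)
    {φ : OpenPartialHomeomorph (Eu n) (Eu n)} (h₂ : ContDiffOn ℝ ∞ φ.symm φ.target) {y : Eu n}
    (hy : y ∈ (e.trans φ).target) (u : Eu n) :
    chartSymmDeriv (e.trans φ) y u = chartSymmDeriv e (φ.symm y) (fderiv ℝ φ.symm y u) := by
  rw [OpenPartialHomeomorph.trans_target] at hy
  have h1 := mfderiv_comp (I := 𝓡 n) (I' := 𝓡 n) (I'' := 𝓡 n) y
    (mdifferentiableAt_chart_symm he hy.2) (f := φ.symm)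
    ((h₂.contDiffAt (φ.open_target.mem_nhds hy.1)).differentiableAt (by simp)).mdifferentiableAt
  rw [mfderiv_eq_fderiv] at h1
  exact DFunLike.congr_fun h1 u

theorem chartDeriv_trans {e : OpenPartialHomeomorph M (Eu n)} (he : e ∈ Charts n M)
    {φ : OpenPartialHomeomorph (Eu n) (Eu n)} (h₁ : ContDiffOn ℝ ∞ φ φ.source) {y : Eu n}
    (hy : y ∈ (e.trans φ).target) (v : TangentSpace (𝓡 n) (e.symm (φ.symm y))) :
    chartDeriv (e.trans φ) y v = fderiv ℝ φ (φ.symm y) (chartDeriv e (φ.symm y) v) := by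
  rw [OpenPartialHomeomorph.trans_target] at hy
  have hx : e.symm (φ.symm y) ∈ e.source := e.map_target hy.2
  have heq : e (e.symm (φ.symm y)) = φ.symm y := e.right_inv hy.2
  have hd : MDifferentiableAt (𝓡 n) (𝓡 n) φ (e (e.symm (φ.symm y))) := by
    rw [heq]
    exact ((h₁.contDiffAt (φ.open_source.mem_nhds (φ.map_target hy.1))).differentiableAt
      (by simp)).mdifferentiableAt
  have h1 := mfderiv_comp (I := 𝓡 n) (I' := 𝓡 n) (I'' := 𝓡 n) (e.symm (φ.symm y)) hd
    (mdifferentiableAt_chart he hx)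
  rw [mfderiv_eq_fderiv, heq] at h1
  exact DFunLike.congr_fun h1 v

end Charts

/-! ### Product domains in coordinates and primitives of functions of one variable. -/

section Boxes

variable {n : ℕ}

/-- The point `(s, x_2, …, x_{n+1})`. -/
def consPt (s : ℝ) (x : Eu n) : Eu (n + 1) := WithLp.toLp 2 (Fin.cons s fun i => x i)

@[simp] theorem consPt_zero (s : ℝ) (x : Eu n) : consPt s x 0 = s := rfl

@[simp] theorem consPt_succ (s : ℝ) (x : Eu n) (i : Fin n) : consPt s x i.succ = x i := rfl

@[simp] theorem tailPt_apply (y : Eu (n + 1)) (i : Fin n) : tailPt y i = y i.succ := rfl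

@[simp] theorem tailPt_consPt (s : ℝ) (x : Eu n) : tailPt (consPt s x) = x := rfl

@[simp] theorem consPt_tailPt (y : Eu (n + 1)) : consPt (y 0) (tailPt y) = y := by
  ext i
  refine Fin.cases rfl (fun j => rfl) i

theorem contDiff_tailPt : ContDiff ℝ ∞ (tailPt : Eu (n + 1) → Eu n) := by
  rw [contDiff_euclidean]
  exact fun i => (EuclideanSpace.proj (𝕜 := ℝ) i.succ).contDiff

theorem contDiff_coord {m : ℕ} (i : Fin m) : ContDiff ℝ ∞ (fun y : Eu m => y i) :=
  (EuclideanSpace.proj (𝕜 := ℝ) i).contDiff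

theorem contDiffOn_consPt {E : Type} [NormedAddCommGroup E] [NormedSpace ℝ E] {S : Set E}
    {a : E → ℝ} {x : E → Eu n} (ha : ContDiffOn ℝ ∞ a S) (hx : ContDiffOn ℝ ∞ x S) :
    ContDiffOn ℝ ∞ (fun p => consPt (a p) (x p)) S := by
  rw [contDiffOn_euclidean]
  intro i
  refine Fin.cases ha (fun j => ?_) i
  exact (contDiff_coord j).comp_contDiffOn hx

theorem contDiff_consPt : ContDiff ℝ ∞ (fun p : ℝ × Eu n => consPt p.1 p.2) :=
  contDiffOn_univ.1 (contDiffOn_consPt contDiff_fst.contDiffOn contDiff_snd.contDiffOn)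

/-- The product of a set of first coordinates with a set of points in the other coordinates. -/
def box (I : Set ℝ) (W : Set (Eu n)) : Set (Eu (n + 1)) := {y | y 0 ∈ I ∧ tailPt y ∈ W}

theorem isOpen_box {I : Set ℝ} {W : Set (Eu n)} (hI : IsOpen I) (hW : IsOpen W) :
    IsOpen (box I W) :=
  (hI.preimage (contDiff_coord 0).continuous).inter (hW.preimage contDiff_tailPt.continuous)

theorem exists_box_subset {O : Set (Eu (n + 1))} (hO : IsOpen O) {y₀ : Eu (n + 1)} (hy₀ : y₀ ∈ O) :
    ∃ ε > 0, box (Set.Ioo (y₀ 0 - ε) (y₀ 0 + ε)) (Metric.ball (tailPt y₀) ε) ⊆ O := by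
  have h1 : IsOpen ((fun p : ℝ × Eu n => consPt p.1 p.2) ⁻¹' O) :=
    hO.preimage contDiff_consPt.continuous
  have h2 : (y₀ 0, tailPt y₀) ∈ (fun p : ℝ × Eu n => consPt p.1 p.2) ⁻¹' O := by
    simpa using hy₀
  obtain ⟨ε, hε, hsub⟩ := Metric.isOpen_iff.1 h1 _ h2
  refine ⟨ε, hε, fun y hy => ?_⟩
  have h3 : (y 0, tailPt y) ∈ Metric.ball (y₀ 0, tailPt y₀) ε := by
    rw [← ball_prod_same]
    exact ⟨by rw [Real.ball_eq_Ioo]; exact hy.1, hy.2⟩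
  simpa using hsub h3

/-- The local diffeomorphism of `ℝ^{n+1}` that applies `φ` to the first coordinate. -/
def liftFirst (n : ℕ) (φ : OpenPartialHomeomorph ℝ ℝ) (h₁ : ContDiffOn ℝ ∞ φ φ.source)
    (h₂ : ContDiffOn ℝ ∞ φ.symm φ.target) : OpenPartialHomeomorph (Eu (n + 1)) (Eu (n + 1)) where
  toFun y := consPt (φ (y 0)) (tailPt y)
  invFun y := consPt (φ.symm (y 0)) (tailPt y)
  source := {y | y 0 ∈ φ.source}
  target := {y | y 0 ∈ φ.target}
  map_source' y hy := φ.map_source hy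
  map_target' y hy := φ.map_target hy
  left_inv' y hy := by
    have : φ.symm (φ (y 0)) = y 0 := φ.left_inv hy
    simp [this]
  right_inv' y hy := by
    have : φ (φ.symm (y 0)) = y 0 := φ.right_inv hy
    simp [this]
  open_source := φ.open_source.preimage (contDiff_coord 0).continuous
  open_target := φ.open_target.preimage (contDiff_coord 0).continuous
  continuousOn_toFun := (contDiffOn_consPt (h₁.comp (contDiff_coord 0).contDiffOn fun _ hy => hy)
    contDiff_tailPt.contDiffOn).continuousOn
  continuousOn_invFun := (contDiffOn_consPt (h₂.comp (contDiff_coord 0).contDiffOn fun _ hy => hy)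
    contDiff_tailPt.contDiffOn).continuousOn

theorem exists_primitive {q : ℝ → ℝ} {a b : ℝ} (hq : ContDiffOn ℝ ∞ q (Set.Ioo a b)) {c : ℝ}
    (hc : c ∈ Set.Ioo a b) :
    ∃ θ : ℝ → ℝ, ContDiffOn ℝ ∞ θ (Set.Ioo a b) ∧ θ c = 0 ∧
      ∀ s ∈ Set.Ioo a b, HasDerivAt θ (q s) s := by
  have hd : ∀ s ∈ Set.Ioo a b, HasDerivAt (fun u => ∫ τ in c..u, q τ) (q s) s := by
    intro s hs
    have hsub : Set.uIcc c s ⊆ Set.Ioo a b := Set.ordConnected_Ioo.uIcc_subset hc hs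
    refine intervalIntegral.integral_hasDerivAt_right
      ((hq.continuousOn.mono hsub).intervalIntegrable) ?_
      (hq.continuousOn.continuousAt (isOpen_Ioo.mem_nhds hs))
    exact hq.continuousOn.stronglyMeasurableAtFilter isOpen_Ioo s hs
  refine ⟨fun u => ∫ τ in c..u, q τ, ?_, by simp, hd⟩
  rw [contDiffOn_infty_iff_deriv_of_isOpen isOpen_Ioo]
  refine ⟨fun s hs => (hd s hs).differentiableAt.differentiableWithinAt, ?_⟩
  exact hq.congr fun s hs => (hd s hs).deriv

end Boxes

/-! ### Charts with product domains and reparametrization of the first coordinate. -/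

section BoxCharts

variable {n : ℕ} {M : Type*} [TopologicalSpace M] [ChartedSpace (Eu (n + 1)) M]
  [IsManifold (𝓡 (n + 1)) ∞ M]

/-- The coordinates do not change, only their domain. A ball as base is convex, which later lets
vanishing base derivatives imply dependence on the first coordinate alone. -/
theorem exists_box_chart (g : RMetric (n + 1) M) {e : OpenPartialHomeomorph M (Eu (n + 1))}
    (he : e ∈ Charts (n + 1) M) {p : M} (hp : p ∈ e.source) {O : Set M} (hO : IsOpen O)
    (hpO : p ∈ O) :
    ∃ e' ∈ Charts (n + 1) M, p ∈ e'.source ∧ e'.source ⊆ e.source ∩ O ∧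
      (∃ ε > 0, e'.target = box (Set.Ioo (e p 0 - ε) (e p 0 + ε))
        (Metric.ball (tailPt (e p)) ε)) ∧ e'.target ⊆ e.target ∧
      ∀ y ∈ e'.target, e'.symm y = e.symm y ∧ inChart g e' y = inChart g e y := by
  have hO' : IsOpen (e.target ∩ e.symm ⁻¹' O) := e.isOpen_inter_preimage_symm hO
  have hpO' : e p ∈ e.target ∩ e.symm ⁻¹' O :=
    ⟨e.map_source hp, by rw [Set.mem_preimage, e.left_inv hp]; exact hpO⟩
  obtain ⟨ε, hε, hsub⟩ := exists_box_subset hO' hpO'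
  set B := box (Set.Ioo (e p 0 - ε) (e p 0 + ε)) (Metric.ball (tailPt (e p)) ε) with hB
  have hBo : IsOpen B := isOpen_box isOpen_Ioo Metric.isOpen_ball
  have hpB : e p ∈ B := ⟨⟨by linarith, by linarith⟩, Metric.mem_ball_self hε⟩
  have htgt : (e.trans (OpenPartialHomeomorph.ofSet B hBo)).target = B := by
    rw [OpenPartialHomeomorph.trans_target]
    exact Set.inter_eq_left.2 fun y hy => (hsub hy).1
  have hsrc : (e.trans (OpenPartialHomeomorph.ofSet B hBo)).source = e.source ∩ e ⁻¹' B := rfl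
  refine ⟨e.trans (OpenPartialHomeomorph.ofSet B hBo),
    trans_mem_charts he contDiffOn_id contDiffOn_id, ?_, ?_, ⟨ε, hε, htgt⟩, ?_, ?_⟩
  · exact ⟨hp, hpB⟩
  · intro x hx
    rw [hsrc] at hx
    refine ⟨hx.1, ?_⟩
    have := (hsub hx.2).2
    rwa [Set.mem_preimage, e.left_inv hx.1] at this
  · rw [htgt]; exact fun y hy => (hsub hy).1
  · exact fun y _ => ⟨rfl, rfl⟩

/-- Change of the first coordinate `y₀` of a chart to `s` with `ds = q(y₀) dy₀`. -/
theorem exists_reparam_chart (g : RMetric (n + 1) M) {e : OpenPartialHomeomorph M (Eu (n + 1))}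
    (he : e ∈ Charts (n + 1) M) {a b : ℝ} {W : Set (Eu n)}
    (htgt : e.target = box (Set.Ioo a b) W) {q : ℝ → ℝ} (hq : ContDiffOn ℝ ∞ q (Set.Ioo a b))
    (hq0 : ∀ s ∈ Set.Ioo a b, 0 < q s) {p : M} (hp : p ∈ e.source) :
    ∃ e' ∈ Charts (n + 1) M, p ∈ e'.source ∧ e'.source ⊆ e.source ∧
      ∃ (a' b' : ℝ) (β : ℝ → ℝ), e'.target = box (Set.Ioo a' b') W ∧
        ContDiffOn ℝ ∞ β (Set.Ioo a' b') ∧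
        (∀ s ∈ Set.Ioo a' b', β s ∈ Set.Ioo a b ∧ HasDerivAt β (q (β s))⁻¹ s) ∧
        ∀ y ∈ e'.target, e'.symm y = e.symm (consPt (β (y 0)) (tailPt y)) ∧
          (inChart g e' y 0 0 =
            (q (β (y 0)))⁻¹ ^ 2 * inChart g e (consPt (β (y 0)) (tailPt y)) 0 0) ∧
          (∀ i : Fin n, inChart g e' y 0 i.succ =
            (q (β (y 0)))⁻¹ * inChart g e (consPt (β (y 0)) (tailPt y)) 0 i.succ) ∧
          ∀ i j : Fin n, inChart g e' y i.succ j.succ =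
            inChart g e (consPt (β (y 0)) (tailPt y)) i.succ j.succ := by
  have hep : e p ∈ box (Set.Ioo a b) W := by rw [← htgt]; exact e.map_source hp
  set c : ℝ := e p 0 with hc
  have hcI : c ∈ Set.Ioo a b := hep.1
  -- The new coordinate is s = θ(y₀) with θ' = q, and β is a local inverse of θ on an interval
  -- around θ(c).
  obtain ⟨θ, hθ, -, hθd⟩ := exists_primitive hq hcI
  let θ' : ℝ ≃L[ℝ] ℝ := ContinuousLinearEquiv.unitsEquivAut ℝ (Units.mk0 (q c) (hq0 c hcI).ne')
  have hθ' : HasFDerivAt θ (θ' : ℝ →L[ℝ] ℝ) c := by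
    refine (hθd c hcI).hasFDerivAt.congr_fderiv ?_
    ext
    simp [θ']
  obtain ⟨φ₀, hcφ, hφI, hφθ, hφs⟩ := exists_local_diffeo isOpen_Ioo hθ hcI hθ'
  obtain ⟨ε, hε, hball⟩ := Metric.isOpen_iff.1 φ₀.open_target (φ₀ c) (φ₀.map_source hcφ)
  rw [Real.ball_eq_Ioo] at hball
  set J : Set ℝ := Set.Ioo (φ₀ c - ε) (φ₀ c + ε) with hJ
  let φ := φ₀.trans (OpenPartialHomeomorph.ofSet J isOpen_Ioo)
  have hφt : φ.target = J := by
    rw [OpenPartialHomeomorph.trans_target]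
    exact Set.inter_eq_left.2 hball
  have hφsrc : φ.source = φ₀.source ∩ φ₀ ⁻¹' J := rfl
  have hcφ' : c ∈ φ.source := ⟨hcφ, by change φ₀ c ∈ J; exact ⟨by linarith, by linarith⟩⟩
  have h₁ : ContDiffOn ℝ ∞ φ φ.source := by
    change ContDiffOn ℝ ∞ φ₀ φ.source
    rw [hφθ]
    exact hθ.mono fun s hs => hφI hs.1
  have h₂ : ContDiffOn ℝ ∞ φ.symm φ.target := by
    change ContDiffOn ℝ ∞ φ₀.symm φ.target
    rw [hφt]
    exact hφs.mono hball
  have hβI : ∀ s ∈ J, φ.symm s ∈ Set.Ioo a b := fun s hs =>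
    hφI (φ₀.map_target (hball hs))
  have hβd : ∀ s ∈ J, HasDerivAt φ.symm (q (φ.symm s))⁻¹ s := by
    intro s hs
    refine φ.hasDerivAt_symm (by rw [hφt]; exact hs) (hq0 _ (hβI s hs)).ne' ?_
    change HasDerivAt φ₀ _ _
    rw [hφθ]
    exact hθd _ (hβI s hs)
  let Φ := liftFirst n φ h₁ h₂
  have hΦ₁ : ContDiffOn ℝ ∞ Φ Φ.source :=
    contDiffOn_consPt (h₁.comp (contDiff_coord 0).contDiffOn fun _ hy => hy)
      contDiff_tailPt.contDiffOn
  have hΦ₂ : ContDiffOn ℝ ∞ Φ.symm Φ.target :=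
    contDiffOn_consPt (h₂.comp (contDiff_coord 0).contDiffOn fun _ hy => hy)
      contDiff_tailPt.contDiffOn
  have htgt' : (e.trans Φ).target = box J W := by
    rw [OpenPartialHomeomorph.trans_target, htgt]
    ext y
    constructor
    · rintro ⟨h1, h2⟩
      exact ⟨by rw [← hφt]; exact h1, h2.2⟩
    · rintro ⟨h1, h2⟩
      exact ⟨by change y 0 ∈ φ.target; rw [hφt]; exact h1, hβI _ h1, h2⟩
  -- The inverse coordinate change scales the direction of index 0 by 1/q and fixes the others,
  -- which gives the transformation of the metric components.
  have hd : ∀ y ∈ box J W, ∀ u : Eu (n + 1), fderiv ℝ Φ.symm y u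
      = consPt ((q (φ.symm (y 0)))⁻¹ * u 0) (tailPt u) := by
    intro y hy u
    have key : HasFDerivAt Φ.symm (fderiv ℝ Φ.symm y) y := by
      refine ((hΦ₂.contDiffAt (Φ.open_target.mem_nhds ?_)).differentiableAt (by simp)).hasFDerivAt
      change y 0 ∈ φ.target
      rw [hφt]; exact hy.1
    have hcoord : ∀ i : Fin (n + 1), HasFDerivAt (fun z => Φ.symm z i)
        ((EuclideanSpace.proj (𝕜 := ℝ) i).comp (fderiv ℝ Φ.symm y)) y := fun i =>
      (EuclideanSpace.proj (𝕜 := ℝ) i).hasFDerivAt.comp y key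
    ext i
    refine Fin.cases ?_ (fun j => ?_) i
    · have h3 : HasFDerivAt (fun z : Eu (n + 1) => φ.symm (z 0)) _ y :=
        (hβd _ hy.1).comp_hasFDerivAt y (EuclideanSpace.proj (𝕜 := ℝ) (0 : Fin (n + 1))).hasFDerivAt
      exact DFunLike.congr_fun ((hcoord 0).unique h3) u
    · have h3 : HasFDerivAt (fun z : Eu (n + 1) => z j.succ) _ y :=
        (EuclideanSpace.proj (𝕜 := ℝ) (j.succ : Fin (n + 1))).hasFDerivAt
      exact DFunLike.congr_fun ((hcoord j.succ).unique h3) u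
  have hd0 : ∀ y ∈ box J W, fderiv ℝ Φ.symm y (EuclideanSpace.single 0 1)
      = (q (φ.symm (y 0)))⁻¹ • EuclideanSpace.single 0 1 := by
    intro y hy
    rw [hd y hy]
    ext i
    refine Fin.cases ?_ (fun j => ?_) i <;> simp
  have hdi : ∀ y ∈ box J W, ∀ i : Fin n, fderiv ℝ Φ.symm y (EuclideanSpace.single i.succ 1)
      = EuclideanSpace.single i.succ 1 := by
    intro y hy i
    rw [hd y hy]
    ext k
    refine Fin.cases ?_ (fun j => ?_) k <;> simp
  refine ⟨e.trans Φ, trans_mem_charts he hΦ₁ hΦ₂, ⟨hp, hcφ'⟩, fun x hx => hx.1, _, _, φ.symm,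
    htgt', by rw [← hJ, ← hφt]; exact h₂, fun s hs => ⟨hβI s hs, hβd s hs⟩, fun y hy => ⟨rfl, ?_⟩⟩
  have hyB : y ∈ box J W := by rw [← htgt']; exact hy
  have hc0 : coordField (e.trans Φ) 0 y = (q (φ.symm (y 0)))⁻¹ • coordField e 0 (Φ.symm y) := by
    rw [coordField_eq, chartSymmDeriv_trans he hΦ₂ hy, hd0 y hyB, map_smul]
    rfl
  have hci : ∀ i : Fin n, coordField (e.trans Φ) i.succ y = coordField e i.succ (Φ.symm y) := by
    intro i
    rw [coordField_eq, chartSymmDeriv_trans he hΦ₂ hy, hdi y hyB]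
    rfl
  have hin : ∀ i j, inChart g (e.trans Φ) y i j = g.inner (e.symm (Φ.symm y))
      (coordField (e.trans Φ) i y) (coordField (e.trans Φ) j y) := fun i j => rfl
  have hin' : ∀ i j, inChart g e (consPt (φ.symm (y 0)) (tailPt y)) i j
      = g.inner (e.symm (Φ.symm y)) (coordField e i (Φ.symm y)) (coordField e j (Φ.symm y)) :=
    fun i j => rfl
  refine ⟨?_, fun i => ?_, fun i j => ?_⟩
  · rw [hin, hin', hc0, map_smul, map_smul, _root_.smul_apply, smul_eq_mul, smul_eq_mul]
    ring
  · rw [hin, hin', hc0, hci, map_smul, _root_.smul_apply, smul_eq_mul]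
  · rw [hin, hin', hci, hci]

end BoxCharts

/-! ### Smoothness of inverse matrices and partial derivatives. -/

section SmoothInverse

theorem contDiffOn_det {n : ℕ} {E : Type} [NormedAddCommGroup E] [NormedSpace ℝ E] {S : Set E}
    {G : E → Matrix (Fin n) (Fin n) ℝ} (hG : ∀ i j, ContDiffOn ℝ ∞ (fun y => G y i j) S) :
    ContDiffOn ℝ ∞ (fun y => (G y).det) S := by
  simp only [Matrix.det_apply]
  refine ContDiffOn.sum fun σ _ => ContDiffOn.const_smul _ ?_
  exact contDiffOn_prod fun i _ => hG _ _

/-- Cramer's rule: the entries are quotients of determinants, and positive definiteness keeps the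
denominator away from zero. -/
theorem contDiffOn_inv {n : ℕ} {E : Type} [NormedAddCommGroup E] [NormedSpace ℝ E] {S : Set E}
    {G : E → Matrix (Fin n) (Fin n) ℝ} (hG : ∀ i j, ContDiffOn ℝ ∞ (fun y => G y i j) S)
    (hpos : ∀ y ∈ S, (G y).PosDef) (i j : Fin n) : ContDiffOn ℝ ∞ (fun y => (G y)⁻¹ i j) S := by
  simp only [Matrix.inv_def, Matrix.smul_apply, Ring.inverse_eq_inv', Matrix.adjugate_apply,
    smul_eq_mul]
  refine ((contDiffOn_det hG).inv fun y hy => (hpos y hy).det_pos.ne').mul (contDiffOn_det ?_)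
  intro k l
  by_cases hk : k = j
  · subst hk
    simp only [Matrix.updateRow_self]
    exact contDiffOn_const
  · simp only [Matrix.updateRow_ne hk]
    exact hG k l

theorem contDiffOn_pd {n : ℕ} {F : Eu n → ℝ} {S : Set (Eu n)} (hS : IsOpen S)
    (hF : ContDiffOn ℝ ∞ F S) (i : Fin n) : ContDiffOn ℝ ∞ (pd i F) S :=
  (hF.fderiv_of_isOpen hS (by simp)).clm_apply contDiffOn_const

end SmoothInverse

/-! ### The gradient and the adapted frame in coordinates. -/

section LevelCharts

set_option linter.unusedSectionVars false

variable {n : ℕ} {M : Type*} [TopologicalSpace M] [ChartedSpace (Eu n) M]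
  [IsManifold (𝓡 n) ∞ M]

theorem inner_grad (g : RMetric n M) (f : M → ℝ) (x : M) (v : TangentSpace (𝓡 n) x) :
    g.inner x (grad g f x) v = (mfderiv (𝓡 n) 𝓘(ℝ, ℝ) f x v : ℝ) :=
  (exists_grad g f x).choose_spec v

theorem gradNorm_sq (g : RMetric n M) (f : M → ℝ) (x : M) :
    gradNorm g f x ^ 2 = g.inner x (grad g f x) (grad g f x) := by
  rw [gradNorm, Real.sq_sqrt]
  by_cases h : grad g f x = 0
  · rw [h]; simp
  · exact (g.pos x _ h).le

theorem gradNorm_pos (g : RMetric n M) (f : M → ℝ) {x : M} (hx : grad g f x ≠ 0) :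
    0 < gradNorm g f x :=
  Real.sqrt_pos.2 (g.pos x _ hx)

theorem pd_eq_sum_inChart (g : RMetric n M) {f : M → ℝ} (hf : ContMDiff (𝓡 n) 𝓘(ℝ, ℝ) ∞ f)
    {e : OpenPartialHomeomorph M (Eu n)} (he : e ∈ Charts n M) {y : Eu n} (hy : y ∈ e.target)
    (j : Fin n) :
    pd j (f ∘ e.symm) y = ∑ i, comp e (grad g f (e.symm y)) i * inChart g e y i j := by
  rw [← mfderiv_coordField he hy hf, ← inner_grad g]
  conv_lhs => rw [eq_sum_coordField he hy (grad g f (e.symm y))]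
  simp only [map_sum, map_smul, _root_.sum_apply, _root_.smul_apply, smul_eq_mul, inChart,
    Matrix.of_apply]

/-- The gradient is chosen pointwise; this formula is what makes it a smooth vector field in
coordinates. -/
theorem comp_grad (g : RMetric n M) {f : M → ℝ} (hf : ContMDiff (𝓡 n) 𝓘(ℝ, ℝ) ∞ f)
    {e : OpenPartialHomeomorph M (Eu n)} (he : e ∈ Charts n M) {y : Eu n} (hy : y ∈ e.target)
    (i : Fin n) :
    comp e (grad g f (e.symm y)) i = ∑ j, pd j (f ∘ e.symm) y * (inChart g e y)⁻¹ j i := by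
  have hG := ((isMetricOn_inChart g he).2 y hy).isUnit
  set v : Fin n → ℝ := fun i => comp e (grad g f (e.symm y)) i with hv
  have h1 : (fun j => pd j (f ∘ e.symm) y) = Matrix.vecMul v (inChart g e y) := by
    funext j
    rw [pd_eq_sum_inChart g hf he hy]
    rfl
  have h2 : Matrix.vecMul (fun j => pd j (f ∘ e.symm) y) (inChart g e y)⁻¹ = v := by
    rw [h1, Matrix.vecMul_vecMul, Matrix.mul_nonsing_inv _ ((Matrix.isUnit_iff_isUnit_det _).1 hG),
      Matrix.vecMul_one]
  exact (congrFun h2 i).symm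

/-- If `∂_a` is tangent to the levels of `f` and the Ricci eigenvalues of an adapted frame in
tangential directions are all equal to `μ`, then `Rc(∂_a, ·) = μ g(∂_a, ·)`. -/
theorem ricci_of_adaptedFrame [NeZero n] (g : RMetric n M) {f : M → ℝ}
    (hf : ContMDiff (𝓡 n) 𝓘(ℝ, ℝ) ∞ f) {U : Set M}
    {E : Fin n → (x : M) → TangentSpace (𝓡 n) x} {ev : Fin n → M → ℝ}
    (hE : IsAdaptedFrame g f U E ev) {e : OpenPartialHomeomorph M (Eu n)} (he : e ∈ Charts n M)
    {y : Eu n} (hy : y ∈ e.target) (hyU : e.symm y ∈ U) {μ : ℝ}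
    (hμ : ∀ i, i ≠ 0 → ev i (e.symm y) = μ) {a : Fin n} (ha : pd a (f ∘ e.symm) y = 0)
    (j : Fin n) : ricci (inChart g e) a j y = μ * inChart g e y a j := by
  set x := e.symm y with hx
  let v : TangentSpace (𝓡 n) x := coordField e a y
  let w : TangentSpace (𝓡 n) x := coordField e j y
  let b : Fin n → Eu n := fun i => E i x
  let B : Eu n →L[ℝ] Eu n →L[ℝ] ℝ := g.inner x
  have hB : ∀ i k, B (b i) (b k) = if i = k then 1 else 0 := hE.orthonormal x hyU
  have hli : LinearIndependent ℝ b := by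
    rw [Fintype.linearIndependent_iff]
    intro c hc i
    have h1 := congrArg (fun u => B u (b i)) hc
    simpa [map_sum, _root_.sum_apply, hB] using h1
  have hspan := hli.span_eq_top_of_card_eq_finrank' (by simp)
  let v' : Eu n := coordField e a y
  have hmem : v' ∈ Submodule.span ℝ (Set.range b) := by rw [hspan]; trivial
  obtain ⟨c, hc⟩ := (Submodule.mem_span_range_iff_exists_fun ℝ).1 hmem
  -- E_0 is proportional to ∇f, and g(∇f, ∂_a) = df(∂_a) = 0, so ∂_a is a combination of tangential
  -- frame vectors only.
  have hc0 : c 0 = 0 := by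
    have h1 := congrArg (fun u => B (b 0) u) hc
    simp only [map_sum, map_smul, hB, smul_eq_mul, mul_ite, mul_one, mul_zero, Finset.sum_ite_eq,
      Finset.mem_univ, if_true] at h1
    rw [h1]
    change g.inner x (E 0 x) v = 0
    have h2 : g.inner x (grad g f x) v = 0 :=
      (inner_grad g f x v).trans ((mfderiv_coordField he hy hf a).trans ha)
    rw [hE.first x hyU, map_smul, _root_.smul_apply, h2, smul_zero]
  have hcompv : ∀ i, comp e v i = ∑ k, c k * comp e (E k x) i := by
    intro i
    have h1 : v = ∑ k, c k • E k x := hc.symm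
    rw [h1, comp_eq, map_sum]
    simp only [map_smul]
    rw [WithLp.ofLp_sum, Finset.sum_apply]
    rfl
  have hxs : x ∈ e.source := e.map_target hy
  have hric : ricciForm g e v w = ∑ k, c k * ricciForm g e (E k x) w := by
    simp only [ricciForm, hcompv, Finset.mul_sum, Finset.sum_mul]
    conv_rhs => rw [Finset.sum_comm]
    refine Finset.sum_congr rfl fun i _ => ?_
    rw [Finset.sum_comm]
    refine Finset.sum_congr rfl fun k _ => Finset.sum_congr rfl fun l _ => ?_
    ring
  have hleft : ricciForm g e v w = ricci (inChart g e) a j y := by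
    have hv : ∀ i, comp e v i = if i = a then 1 else 0 := comp_coordField he hy a
    have hw : ∀ i, comp e w i = if i = j then 1 else 0 := comp_coordField he hy j
    simp [ricciForm, hv, hw, hx, e.right_inv hy]
  rw [← hleft, hric]
  have hterm : ∀ k, c k * ricciForm g e (E k x) w = μ * (c k * g.inner x (E k x) w) := by
    intro k
    by_cases hk : k = 0
    · rw [hk, hc0]; ring
    · rw [hE.ricci_eigen x hyU k e he hxs w, hμ k hk]; ring
  rw [Finset.sum_congr rfl fun k _ => hterm k, ← Finset.mul_sum]
  congr 1
  have h1 : v = ∑ k, c k • E k x := hc.symm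
  change _ = g.inner x v w
  rw [h1]
  simp [map_sum, _root_.sum_apply]

end LevelCharts

/-! ### Coordinates adapted to the potential and its gradient. -/

section GradientChart

variable {n : ℕ} {M : Type*} [TopologicalSpace M] [ChartedSpace (Eu (n + 1)) M]
  [IsManifold (𝓡 (n + 1)) ∞ M]

/-- Coordinates `(f, x_2, …, x_{n+1})` with `x_2, …, x_{n+1}` constant along `∇f`. -/
theorem exists_gradient_chart (g : RMetric (n + 1) M) {f : M → ℝ}
    (hf : ContMDiff (𝓡 (n + 1)) 𝓘(ℝ, ℝ) ∞ f) {U : Set M} (hU : IsOpen U)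
    (hgrad : ∀ x ∈ U, grad g f x ≠ 0) {p : M} (hp : p ∈ U) :
    ∃ e ∈ Charts (n + 1) M, p ∈ e.source ∧ e.source ⊆ U ∧
      (∃ (a b : ℝ) (c : Eu n) (r : ℝ), e.target = box (Set.Ioo a b) (Metric.ball c r)) ∧
      (∀ y ∈ e.target, f (e.symm y) = y 0) ∧
      ∀ y ∈ e.target, inChart g e y 0 0 = (gradNorm g f (e.symm y) ^ 2)⁻¹ ∧
        ∀ i : Fin n, inChart g e y 0 i.succ = 0 := by
  let e₀ := (chartAt (Eu (n + 1)) p).restr U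
  have he₀ : e₀ ∈ Charts (n + 1) M :=
    restr_mem_charts (IsManifold.chart_mem_maximalAtlas p) hU
  have hsrc₀ : e₀.source = (chartAt (Eu (n + 1)) p).source ∩ U :=
    OpenPartialHomeomorph.restr_source' _ _ hU
  have hp₀ : p ∈ e₀.source := by rw [hsrc₀]; exact ⟨mem_chart_source _ p, hp⟩
  have hU₀ : ∀ y ∈ e₀.target, e₀.symm y ∈ U := fun y hy => by
    have := e₀.map_target hy
    rw [hsrc₀] at this
    exact this.2
  set F : Eu (n + 1) → ℝ := f ∘ e₀.symm with hFdef
  have hF : ContDiffOn ℝ ∞ F e₀.target := contDiffOn_comp_chart_symm he₀ hf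
  let V : Eu (n + 1) → Eu (n + 1) := fun y => chartDeriv e₀ y (grad g f (e₀.symm y))
  have hV : ContDiffOn ℝ ∞ V e₀.target := by
    rw [contDiffOn_euclidean]
    intro i
    have : ContDiffOn ℝ ∞ (fun y => ∑ j, pd j F y * (inChart g e₀ y)⁻¹ j i) e₀.target :=
      ContDiffOn.sum fun j _ => (contDiffOn_pd e₀.open_target hF j).mul
        (contDiffOn_inv (isMetricOn_inChart g he₀).1 (isMetricOn_inChart g he₀).2 j i)
    exact this.congr fun y hy => comp_grad g hf he₀ hy i
  have hFV : ∀ y ∈ e₀.target, fderiv ℝ F y (V y) = gradNorm g f (e₀.symm y) ^ 2 := by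
    intro y hy
    have h1 := mfderiv_comp y ((hf (e₀.symm y)).mdifferentiableAt (by simp))
      (mdifferentiableAt_chart_symm he₀ hy)
    rw [mfderiv_eq_fderiv] at h1
    rw [hFdef, h1, gradNorm_sq, inner_grad]
    exact congrArg (mfderiv (𝓡 (n + 1)) 𝓘(ℝ, ℝ) f (e₀.symm y))
      (chartSymmDeriv_chartDeriv he₀ hy (grad g f (e₀.symm y)))
  have hne : ∀ y ∈ e₀.target, gradNorm g f (e₀.symm y) ^ 2 ≠ 0 := fun y hy =>
    (pow_pos (gradNorm_pos g f (hgrad _ (hU₀ y hy))) 2).ne'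
  have hep : e₀ p ∈ e₀.target := e₀.map_source hp₀
  -- The flow box for v = ∇f with first coordinate F = f is available because df(∇f) = |∇f|² ≠ 0.
  obtain ⟨φ, hφp, hφsub, h₁, h₂, hφF, hφV⟩ := exists_flow_box e₀.open_target hV hF hep
    (by rw [hFV _ hep]; exact hne _ hep)
  let e₁ := e₀.trans φ
  have he₁ : e₁ ∈ Charts (n + 1) M := trans_mem_charts he₀ h₁ h₂
  have hp₁ : p ∈ e₁.source := ⟨hp₀, hφp⟩
  have htgt₁ : ∀ y ∈ e₁.target, y ∈ φ.target ∧ φ.symm y ∈ e₀.target := by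
    intro y hy
    rw [OpenPartialHomeomorph.trans_target] at hy
    exact hy
  have hfe₁ : ∀ y ∈ e₁.target, f (e₁.symm y) = y 0 := by
    intro y hy
    have h3 := hφF _ (φ.map_target (htgt₁ y hy).1)
    rw [φ.right_inv (htgt₁ y hy).1] at h3
    exact h3.symm
  have hpde₁ : ∀ y ∈ e₁.target, ∀ i, pd i (f ∘ e₁.symm) y = if i = 0 then 1 else 0 := by
    intro y hy i
    have h3 : (f ∘ e₁.symm) =ᶠ[𝓝 y] fun z => z 0 := by
      filter_upwards [e₁.open_target.mem_nhds hy] with z hz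
      exact hfe₁ z hz
    have h4 : HasFDerivAt (fun z : Eu (n + 1) => z 0) _ y :=
      (EuclideanSpace.proj (𝕜 := ℝ) (0 : Fin (n + 1))).hasFDerivAt
    rw [pd, h3.fderiv_eq, h4.fderiv]
    simp [eq_comm]
  have hgr : ∀ y ∈ e₁.target, grad g f (e₁.symm y)
      = (gradNorm g f (e₁.symm y) ^ 2) • coordField e₁ 0 y := by
    intro y hy
    have h3 : chartDeriv e₁ y (grad g f (e₁.symm y))
        = (gradNorm g f (e₁.symm y) ^ 2) • (EuclideanSpace.single 0 1 : Eu (n + 1)) := by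
      refine (chartDeriv_trans he₀ h₁ hy _).trans ?_
      have h4 := hφV _ (φ.map_target (htgt₁ y hy).1)
      rw [hFV _ (htgt₁ y hy).2] at h4
      exact h4
    rw [coordField_eq, ← map_smul, ← h3, chartSymmDeriv_chartDeriv he₁ hy]
  -- Since ∇f = |∇f|² ∂_0 in this chart, g(∂_0, ∂_i) = df(∂_i)/|∇f|², and df = dy₀.
  have hin₁ : ∀ y ∈ e₁.target, ∀ i, inChart g e₁ y 0 i
      = (gradNorm g f (e₁.symm y) ^ 2)⁻¹ * if i = 0 then 1 else 0 := by
    intro y hy i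
    have h3 := mfderiv_coordField he₁ hy hf i
    rw [← inner_grad g, hgr y hy, hpde₁ y hy, map_smul, _root_.smul_apply, smul_eq_mul] at h3
    rw [← h3, inv_mul_cancel_left₀]
    · rfl
    · exact hne _ (htgt₁ y hy).2
  obtain ⟨e, he, hpe, hsub, ⟨ε, -, htgt⟩, htsub, hsame⟩ := exists_box_chart g he₁ hp₁ hU hp
  refine ⟨e, he, hpe, fun x hx => (hsub hx).2, ⟨_, _, _, _, htgt⟩, fun y hy => ?_, fun y hy => ?_⟩
  · rw [(hsame y hy).1]
    exact hfe₁ y (htsub hy)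
  · rw [(hsame y hy).2, (hsame y hy).1, hin₁ y (htsub hy)]
    refine ⟨by simp, fun i => ?_⟩
    rw [hin₁ y (htsub hy), if_neg (Fin.succ_ne_zero i), mul_zero]

end GradientChart

/-! ### Calculus of partial derivatives on product domains. -/

section PartialDerivatives

variable {n : ℕ}

theorem pd_congr {i : Fin n} {F F' : Eu n → ℝ} {S : Set (Eu n)} (hS : IsOpen S) {y : Eu n}
    (hy : y ∈ S) (h : ∀ z ∈ S, F z = F' z) : pd i F y = pd i F' y := by
  have : F =ᶠ[𝓝 y] F' := by
    filter_upwards [hS.mem_nhds hy] with z hz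
    exact h z hz
  rw [pd, pd, this.fderiv_eq]

theorem pd_const (i : Fin n) (c : ℝ) (y : Eu n) : pd i (fun _ => c) y = 0 := by
  simp [pd]

theorem pd_eq_zero {i : Fin n} {F : Eu n → ℝ} {S : Set (Eu n)} (hS : IsOpen S) {y : Eu n}
    (hy : y ∈ S) {c : ℝ} (h : ∀ z ∈ S, F z = c) : pd i F y = 0 := by
  rw [pd_congr hS hy h, pd_const]

theorem pd_mul {i : Fin n} {F F' : Eu n → ℝ} {y : Eu n} (hF : DifferentiableAt ℝ F y)
    (hF' : DifferentiableAt ℝ F' y) :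
    pd i (fun z => F z * F' z) y = F y * pd i F' y + F' y * pd i F y := by
  rw [pd, fderiv_fun_mul hF hF']
  simp [pd]

theorem pd_neg {i : Fin n} {F : Eu n → ℝ} {y : Eu n} :
    pd i (fun z => -F z) y = -pd i F y := by
  rw [pd, fderiv_fun_neg]
  simp [pd]

theorem pd_add {i : Fin n} {F F' : Eu n → ℝ} {y : Eu n} (hF : DifferentiableAt ℝ F y)
    (hF' : DifferentiableAt ℝ F' y) : pd i (fun z => F z + F' z) y = pd i F y + pd i F' y := by
  rw [pd, fderiv_fun_add hF hF']
  simp [pd]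

theorem pd_sub {i : Fin n} {F F' : Eu n → ℝ} {y : Eu n} (hF : DifferentiableAt ℝ F y)
    (hF' : DifferentiableAt ℝ F' y) : pd i (fun z => F z - F' z) y = pd i F y - pd i F' y := by
  rw [pd, fderiv_fun_sub hF hF']
  simp [pd]

theorem pd_sum {ι : Type} {i : Fin n} {s : Finset ι} {F : ι → Eu n → ℝ} {y : Eu n}
    (hF : ∀ k ∈ s, DifferentiableAt ℝ (F k) y) :
    pd i (fun z => ∑ k ∈ s, F k z) y = ∑ k ∈ s, pd i (F k) y := by
  rw [pd, fderiv_fun_sum hF]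
  simp [pd, _root_.sum_apply]

theorem pd_comp {i : Fin n} {F : Eu n → ℝ} {y : Eu n} {θ : ℝ → ℝ} {θ' : ℝ}
    (hθ : HasDerivAt θ θ' (F y)) (hF : DifferentiableAt ℝ F y) :
    pd i (fun z => θ (F z)) y = θ' * pd i F y := by
  have h1 := (hθ.comp_hasFDerivAt y hF.hasFDerivAt).fderiv
  rw [pd]
  change fderiv ℝ (θ ∘ F) y _ = _
  rw [h1]
  simp [pd]

theorem pd_coord (i j : Fin n) (y : Eu n) : pd i (fun z => z j) y = if i = j then 1 else 0 := by
  have h4 : HasFDerivAt (fun z : Eu n => z j) _ y :=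
    (EuclideanSpace.proj (𝕜 := ℝ) j).hasFDerivAt
  rw [pd, h4.fderiv]
  simp [eq_comm]

theorem pd_succ {F : Eu (n + 1) → ℝ} {y : Eu (n + 1)} (hF : DifferentiableAt ℝ F y) (a : Fin n) :
    pd a.succ F y = pd a (fun x => F (consPt (y 0) x)) (tailPt y) := by
  have hd : HasFDerivAt (fun x : Eu n => consPt (y 0) x)
      (fderiv ℝ (fun x : Eu n => consPt (y 0) x) (tailPt y)) (tailPt y) :=
    ((contDiff_consPt.comp (contDiff_prodMk_right (y 0))).differentiable (by simp)
      (tailPt y)).hasFDerivAt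
  have hv : fderiv ℝ (fun x : Eu n => consPt (y 0) x) (tailPt y) (EuclideanSpace.single a 1)
      = EuclideanSpace.single a.succ 1 := by
    ext i
    have h1 := (EuclideanSpace.proj (𝕜 := ℝ) i).hasFDerivAt.comp (tailPt y) hd
    refine Fin.cases (fun h1 => ?_) (fun j h1 => ?_) i h1
    · have h2 : HasFDerivAt (fun _ : Eu n => y 0) (0 : Eu n →L[ℝ] ℝ) (tailPt y) :=
        hasFDerivAt_const _ _
      have h3 := DFunLike.congr_fun (h1.unique h2) (EuclideanSpace.single a 1)
      simpa using h3
    · have h2 : HasFDerivAt (fun x : Eu n => x j) (EuclideanSpace.proj (𝕜 := ℝ) j) (tailPt y) :=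
        (EuclideanSpace.proj (𝕜 := ℝ) j).hasFDerivAt
      have h3 := DFunLike.congr_fun (h1.unique h2) (EuclideanSpace.single a 1)
      simpa [Pi.single_apply, Fin.succ_inj] using h3
  have hF' : HasFDerivAt F (fderiv ℝ F y) (consPt (y 0) (tailPt y)) := by
    rw [consPt_tailPt]; exact hF.hasFDerivAt
  have h4 := (HasFDerivAt.comp (g := F) (tailPt y) hF' hd).fderiv
  rw [pd, pd]
  change _ = fderiv ℝ (F ∘ fun x : Eu n => consPt (y 0) x) (tailPt y) _
  rw [h4, ContinuousLinearMap.comp_apply, hv]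

/-- A function on a box over a convex base whose derivatives in the base directions vanish
depends only on the first coordinate. -/
theorem eq_of_pd_succ_eq_zero {F : Eu (n + 1) → ℝ} {I : Set ℝ} {W : Set (Eu n)} (hI : IsOpen I)
    (hW : IsOpen W) (hWc : Convex ℝ W) (hF : DifferentiableOn ℝ F (box I W))
    (h0 : ∀ y ∈ box I W, ∀ a : Fin n, pd a.succ F y = 0) {s : ℝ} (hs : s ∈ I) {x x' : Eu n}
    (hx : x ∈ W) (hx' : x' ∈ W) : F (consPt s x) = F (consPt s x') := by
  have hdF : ∀ z ∈ W, DifferentiableAt ℝ F (consPt s z) := fun z hz =>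
    hF.differentiableAt ((isOpen_box hI hW).mem_nhds ⟨hs, hz⟩)
  have hd : DifferentiableOn ℝ (fun z => F (consPt s z)) W := fun z hz =>
    ((hdF z hz).comp z ((contDiff_consPt.comp (contDiff_prodMk_right s)).differentiable
      (by simp) z)).differentiableWithinAt
  refine hWc.is_const_of_fderivWithin_eq_zero (𝕜 := ℝ) hd (fun z hz => ?_) hx hx'
  rw [fderivWithin_of_isOpen hW hz]
  have h1 : ∀ a, fderiv ℝ (fun z => F (consPt s z)) z (EuclideanSpace.single a 1) = 0 := fun a => by
    have h2 := pd_succ (hdF z hz) a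
    rw [h0 (consPt s z) ⟨hs, hz⟩ a] at h2
    exact h2.symm
  apply ContinuousLinearMap.coe_injective
  apply (EuclideanSpace.basisFun (Fin n) ℝ).toBasis.ext
  intro a
  simpa using h1 a

end PartialDerivatives

/-! ### Metrics of block form and the metrics induced on slices. -/

section BlockMetric

variable {n : ℕ}

/-- The block matrix with blocks `c` and `K`. -/
def blockMat (c : ℝ) (K : Matrix (Fin n) (Fin n) ℝ) : Matrix (Fin (n + 1)) (Fin (n + 1)) ℝ :=
  Matrix.of (Fin.cons (Fin.cons c fun _ => 0) fun i => Fin.cons 0 fun j => K i j)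

@[simp] theorem blockMat_zero_zero (c : ℝ) (K : Matrix (Fin n) (Fin n) ℝ) :
    blockMat c K 0 0 = c := rfl

@[simp] theorem blockMat_zero_succ (c : ℝ) (K : Matrix (Fin n) (Fin n) ℝ) (j : Fin n) :
    blockMat c K 0 j.succ = 0 := rfl

@[simp] theorem blockMat_succ_zero (c : ℝ) (K : Matrix (Fin n) (Fin n) ℝ) (i : Fin n) :
    blockMat c K i.succ 0 = 0 := rfl

@[simp] theorem blockMat_succ_succ (c : ℝ) (K : Matrix (Fin n) (Fin n) ℝ) (i j : Fin n) :
    blockMat c K i.succ j.succ = K i j := rfl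

theorem eq_blockMat {G : Matrix (Fin (n + 1)) (Fin (n + 1)) ℝ} (hG : G.PosDef)
    (h0 : ∀ i : Fin n, G 0 i.succ = 0) :
    G = blockMat (G 0 0) (G.submatrix Fin.succ Fin.succ) := by
  ext i j
  refine Fin.cases (Fin.cases rfl (fun j => h0 j) j) (fun i => Fin.cases ?_ (fun j => rfl) j) i
  have := hG.isHermitian.apply 0 i.succ
  rw [star_trivial] at this
  rw [this, h0]
  rfl

theorem blockMat_inv {c : ℝ} (hc : c ≠ 0) {K : Matrix (Fin n) (Fin n) ℝ} (hK : IsUnit K.det) :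
    (blockMat c K)⁻¹ = blockMat c⁻¹ K⁻¹ := by
  apply Matrix.inv_eq_right_inv
  have h1 : ∀ i j, ∑ l, K i l * K⁻¹ l j = (1 : Matrix (Fin n) (Fin n) ℝ) i j := fun i j => by
    rw [← Matrix.mul_nonsing_inv K hK, Matrix.mul_apply]
  ext i j
  rw [Matrix.mul_apply, Fin.sum_univ_succ]
  refine Fin.cases (Fin.cases ?_ (fun j => ?_) j) (fun i => Fin.cases ?_ (fun j => ?_) j) i
  · simp [hc]
  · simp [(Fin.succ_ne_zero j).symm]
  · simp
  · simp only [blockMat_succ_zero, blockMat_succ_succ, zero_mul, zero_add, h1, Matrix.one_apply,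
      Fin.succ_inj]

/-- The metric induced on the slice `{s} × ℝⁿ`. -/
def slice (G : Eu (n + 1) → Matrix (Fin (n + 1)) (Fin (n + 1)) ℝ) (s : ℝ) (x : Eu n) :
    Matrix (Fin n) (Fin n) ℝ :=
  (G (consPt s x)).submatrix Fin.succ Fin.succ

theorem slice_posDef {G : Matrix (Fin (n + 1)) (Fin (n + 1)) ℝ} (hG : G.PosDef) :
    (G.submatrix Fin.succ Fin.succ : Matrix (Fin n) (Fin n) ℝ).PosDef :=
  hG.submatrix (Fin.succ_injective n)

theorem isMetricOn_slice {G : Eu (n + 1) → Matrix (Fin (n + 1)) (Fin (n + 1)) ℝ} {I : Set ℝ}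
    {W : Set (Eu n)} (hG : IsMetricOn G (box I W)) {s : ℝ} (hs : s ∈ I) :
    IsMetricOn (slice G s) W := by
  refine ⟨fun i j => ?_, fun x hx => slice_posDef (hG.2 _ ⟨hs, hx⟩)⟩
  exact (hG.1 i.succ j.succ).comp
    (contDiff_consPt.comp (contDiff_prodMk_right s)).contDiffOn fun x hx => ⟨hs, hx⟩

/-- `Γ^0_{a0}` for a metric `c dy₀² + K`. -/
theorem christoffel_zero_succ_zero {G : Eu (n + 1) → Matrix (Fin (n + 1)) (Fin (n + 1)) ℝ}
    {S : Set (Eu (n + 1))} (hS : IsOpen S) (hG : IsMetricOn G S)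
    (h0 : ∀ y ∈ S, ∀ i : Fin n, G y 0 i.succ = 0) {y : Eu (n + 1)} (hy : y ∈ S) (a : Fin n) :
    christoffel G 0 a.succ 0 y = 1 / 2 * ((G y 0 0)⁻¹ * pd a.succ (fun z => G z 0 0) y) := by
  have hblock := eq_blockMat (hG.2 y hy) (h0 y hy)
  have hpos : 0 < G y 0 0 := (hG.2 y hy).diag_pos
  have hinv : ∀ j : Fin (n + 1), (G y)⁻¹ 0 j = if j = 0 then (G y 0 0)⁻¹ else 0 := by
    intro j
    rw [hblock, blockMat_inv hpos.ne' (slice_posDef (hG.2 y hy)).det_pos.ne'.isUnit]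
    refine Fin.cases ?_ (fun j => ?_) j
    · simp
    · simp
  have h1 : pd 0 (fun z => G z 0 a.succ) y = 0 := pd_eq_zero hS hy fun z hz => h0 z hz a
  have h2 : pd 0 (fun z => G z a.succ 0) y = 0 := pd_eq_zero hS hy fun z hz => by
    rw [eq_blockMat (hG.2 z hz) (h0 z hz)]; rfl
  rw [christoffel]
  simp only [hinv, ite_mul, zero_mul, Finset.sum_ite_eq', Finset.mem_univ, if_true]
  rw [h1, h2]
  ring

end BlockMetric

/-! ### Curvature of ds² + g_s with totally umbilic slices: Gauss and Codazzi equations. -/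

section Umbilic

variable {n : ℕ}

theorem IsMetricOn.symm {G : Eu n → Matrix (Fin n) (Fin n) ℝ} {S : Set (Eu n)}
    (hG : IsMetricOn G S) {y : Eu n} (hy : y ∈ S) (i j : Fin n) : G y i j = G y j i := by
  have := (hG.2 y hy).isHermitian.apply i j
  rwa [star_trivial, eq_comm] at this

theorem contDiffOn_christoffel {G : Eu n → Matrix (Fin n) (Fin n) ℝ} {S : Set (Eu n)}
    (hS : IsOpen S) (hG : IsMetricOn G S) (k i j : Fin n) :
    ContDiffOn ℝ ∞ (christoffel G k i j) S := by
  unfold christoffel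
  refine contDiffOn_const.mul (ContDiffOn.sum fun l _ => (contDiffOn_inv hG.1 hG.2 k l).mul ?_)
  exact ((contDiffOn_pd hS (hG.1 l j) i).add (contDiffOn_pd hS (hG.1 l i) j)).sub
    (contDiffOn_pd hS (hG.1 i j) l)

/-- The metric `G` on a box is of the form `ds² + g_s`, and the slices `s = const` are totally
umbilic with principal curvature `ζ`: `∂_s g_s = 2 ζ g_s`. -/
structure IsUmbilic (G : Eu (n + 1) → Matrix (Fin (n + 1)) (Fin (n + 1)) ℝ) (I : Set ℝ)
    (W : Set (Eu n)) (ζ : Eu (n + 1) → ℝ) : Prop where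
  isOpen_fst : IsOpen I
  isOpen_snd : IsOpen W
  metric : IsMetricOn G (box I W)
  zero_zero : ∀ y ∈ box I W, G y 0 0 = 1
  zero_succ : ∀ y ∈ box I W, ∀ i : Fin n, G y 0 i.succ = 0
  contDiffOn : ContDiffOn ℝ ∞ ζ (box I W)
  pd_zero : ∀ y ∈ box I W, ∀ a b : Fin n,
    pd 0 (fun z => G z a.succ b.succ) y = 2 * ζ y * G y a.succ b.succ

namespace IsUmbilic

variable {G : Eu (n + 1) → Matrix (Fin (n + 1)) (Fin (n + 1)) ℝ} {I : Set ℝ}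
    {W : Set (Eu n)} {ζ : Eu (n + 1) → ℝ} {y : Eu (n + 1)}

theorem isOpen (h : IsUmbilic G I W ζ) : IsOpen (box I W) := isOpen_box h.isOpen_fst h.isOpen_snd

theorem inv_eq (h : IsUmbilic G I W ζ) (hy : y ∈ box I W) :
    (G y)⁻¹ = blockMat 1 ((G y).submatrix Fin.succ Fin.succ)⁻¹ := by
  conv_lhs => rw [eq_blockMat (h.metric.2 y hy) (h.zero_succ y hy), h.zero_zero y hy]
  rw [blockMat_inv one_ne_zero (slice_posDef (h.metric.2 y hy)).det_pos.ne'.isUnit, inv_one]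

theorem pd_zero_left (h : IsUmbilic G I W ζ) (hy : y ∈ box I W) (i j : Fin (n + 1)) :
    pd i (fun z => G z 0 j) y = 0 := by
  refine Fin.cases ?_ (fun j => ?_) j
  · exact pd_eq_zero h.isOpen hy fun z hz => h.zero_zero z hz
  · exact pd_eq_zero h.isOpen hy fun z hz => h.zero_succ z hz j

theorem pd_zero_right (h : IsUmbilic G I W ζ) (hy : y ∈ box I W) (i j : Fin (n + 1)) :
    pd i (fun z => G z j 0) y = 0 := by
  rw [← h.pd_zero_left hy i j]
  exact pd_congr h.isOpen hy fun z hz => h.metric.symm hz j 0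

/-- Raising the index 0 does nothing, and all derivatives of the constant components g_0i vanish, so
only the term -∂_0 g_ij survives. -/
theorem christoffel_zero (h : IsUmbilic G I W ζ) (hy : y ∈ box I W) (i j : Fin (n + 1)) :
    christoffel G 0 i j y = -(1 / 2) * pd 0 (fun z => G z i j) y := by
  rw [christoffel, h.inv_eq hy, Fin.sum_univ_succ]
  simp only [blockMat_zero_zero, blockMat_zero_succ, h.pd_zero_left hy]
  simp

theorem christoffel_zero_zero_left (h : IsUmbilic G I W ζ) (hy : y ∈ box I W) (j : Fin (n + 1)) :
    christoffel G 0 0 j y = 0 := by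
  rw [h.christoffel_zero hy, h.pd_zero_left hy, mul_zero]

theorem christoffel_zero_zero_right (h : IsUmbilic G I W ζ) (hy : y ∈ box I W) (j : Fin (n + 1)) :
    christoffel G 0 j 0 y = 0 := by
  rw [h.christoffel_zero hy, h.pd_zero_right hy, mul_zero]

theorem christoffel_zero_succ_succ (h : IsUmbilic G I W ζ) (hy : y ∈ box I W) (a b : Fin n) :
    christoffel G 0 a.succ b.succ y = -(ζ y * G y a.succ b.succ) := by
  rw [h.christoffel_zero hy, h.pd_zero y hy]
  ring

theorem sum_inv_mul (h : IsUmbilic G I W ζ) (hy : y ∈ box I W) (c b : Fin n) :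
    ∑ l : Fin n, ((G y).submatrix Fin.succ Fin.succ)⁻¹ c l * G y l.succ b.succ
      = if c = b then 1 else 0 := by
  have := Matrix.nonsing_inv_mul ((G y).submatrix Fin.succ Fin.succ)
    (slice_posDef (h.metric.2 y hy)).det_pos.ne'.isUnit
  have h2 := congrFun (congrFun this c) b
  rw [Matrix.mul_apply, Matrix.one_apply] at h2
  exact h2

theorem christoffel_succ_zero_zero (h : IsUmbilic G I W ζ) (hy : y ∈ box I W) (c : Fin n) :
    christoffel G c.succ 0 0 y = 0 := by
  rw [christoffel, h.inv_eq hy, Fin.sum_univ_succ]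
  simp only [h.pd_zero_left hy, h.pd_zero_right hy]
  simp

theorem christoffel_succ_zero_succ (h : IsUmbilic G I W ζ) (hy : y ∈ box I W) (c b : Fin n) :
    christoffel G c.succ 0 b.succ y = if c = b then ζ y else 0 := by
  rw [christoffel, h.inv_eq hy, Fin.sum_univ_succ]
  simp only [h.pd_zero_left hy, h.pd_zero_right hy, h.pd_zero y hy, blockMat_succ_zero,
    blockMat_succ_succ]
  have h1 := h.sum_inv_mul hy c b
  have h2 : ∑ l : Fin n, ((G y).submatrix Fin.succ Fin.succ)⁻¹ c l *
      (2 * ζ y * G y l.succ b.succ + 0 - 0) = 2 * ζ y * if c = b then 1 else 0 := by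
    rw [← h1, Finset.mul_sum]
    exact Finset.sum_congr rfl fun l _ => by ring
  rw [h2]
  split_ifs <;> ring

theorem christoffel_succ_succ_zero (h : IsUmbilic G I W ζ) (hy : y ∈ box I W) (c b : Fin n) :
    christoffel G c.succ b.succ 0 y = if c = b then ζ y else 0 := by
  rw [← h.christoffel_succ_zero_succ hy, christoffel, christoffel]
  congr 1
  refine Finset.sum_congr rfl fun l _ => ?_
  rw [show pd l (fun z => G z b.succ 0) y = pd l (fun z => G z 0 b.succ) y from
    pd_congr h.isOpen hy fun z hz => h.metric.symm hz _ _]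
  ring

theorem differentiableAt (h : IsUmbilic G I W ζ) (hy : y ∈ box I W) (i j : Fin (n + 1)) :
    DifferentiableAt ℝ (fun z => G z i j) y :=
  ((h.metric.1 i j).contDiffAt (h.isOpen.mem_nhds hy)).differentiableAt (by simp)

theorem christoffel_succ_succ_succ (h : IsUmbilic G I W ζ) (hy : y ∈ box I W) (c a b : Fin n) :
    christoffel G c.succ a.succ b.succ y = christoffel (slice G (y 0)) c a b (tailPt y) := by
  rw [christoffel, christoffel, h.inv_eq hy, Fin.sum_univ_succ]
  simp only [blockMat_succ_zero, blockMat_succ_succ, zero_mul, zero_add]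
  have hsl : slice G (y 0) (tailPt y) = (G y).submatrix Fin.succ Fin.succ := by
    rw [slice, consPt_tailPt]
  rw [hsl]
  congr 1
  refine Finset.sum_congr rfl fun l _ => ?_
  rw [pd_succ (h.differentiableAt hy _ _), pd_succ (h.differentiableAt hy _ _),
    pd_succ (h.differentiableAt hy _ _)]
  rfl

theorem differentiableAt_christoffel (h : IsUmbilic G I W ζ) (hy : y ∈ box I W)
    (k i j : Fin (n + 1)) :
    DifferentiableAt ℝ (christoffel G k i j) y :=
  ((contDiffOn_christoffel h.isOpen h.metric k i j).contDiffAt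
    (h.isOpen.mem_nhds hy)).differentiableAt (by simp)

theorem pd_christoffel_succ (h : IsUmbilic G I W ζ) (hy : y ∈ box I W) (d c a b : Fin n) :
    pd d.succ (christoffel G c.succ a.succ b.succ) y
      = pd d (christoffel (slice G (y 0)) c a b) (tailPt y) := by
  rw [pd_succ (h.differentiableAt_christoffel hy _ _ _)]
  refine pd_congr h.isOpen_snd hy.2 fun x hx => ?_
  have hx' : consPt (y 0) x ∈ box I W := ⟨hy.1, hx⟩
  rw [h.christoffel_succ_succ_succ hx']
  rfl

/-- The Gauss equation for the shape operator ζ · id: the curvature of the slice is corrected by the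
terms quadratic in ζ, which come from sums passing through the index 0. -/
theorem riemannUp_succ (h : IsUmbilic G I W ζ) (hy : y ∈ box I W) (a b c d : Fin n) :
    riemannUp G a.succ b.succ c.succ d.succ y
      = riemannUp (slice G (y 0)) a b c d (tailPt y)
        + ζ y ^ 2 * ((if d = b then G y a.succ c.succ else 0)
          - if d = a then G y b.succ c.succ else 0) := by
  rw [riemannUp, riemannUp, h.pd_christoffel_succ hy, h.pd_christoffel_succ hy, Fin.sum_univ_succ]
  simp only [h.christoffel_succ_succ_succ hy, h.christoffel_succ_succ_zero hy,
    h.christoffel_zero_succ_succ hy]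
  split_ifs <;> ring

/-- The Codazzi equation of the slices. -/
theorem ricci_succ_zero (h : IsUmbilic G I W ζ) (hy : y ∈ box I W) (a : Fin n) :
    ricci G a.succ 0 y = (1 - n) * pd a.succ ζ y := by
  have hterm0 : riemannUp G 0 a.succ 0 0 y = 0 := by
    rw [riemannUp, Fin.sum_univ_succ]
    simp only [h.christoffel_zero_zero_left hy, h.christoffel_zero_zero_right hy,
      h.christoffel_succ_zero_zero hy]
    rw [pd_eq_zero h.isOpen hy fun z hz => h.christoffel_zero_zero_right hz _,
      pd_eq_zero h.isOpen hy fun z hz => h.christoffel_zero_zero_left hz _]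
    simp
  -- Γ^i_{a0} = ζ δ^i_a, so the derivatives of Christoffel symbols give derivatives of ζ, and the
  -- quadratic terms cancel by the symmetry of Γ in its lower indices. Summing over i gives the
  -- factor 1 - n.
  have hterm : ∀ i : Fin n, riemannUp G i.succ a.succ 0 i.succ y
      = (if i = a then pd a.succ ζ y else 0) - pd a.succ ζ y := by
    intro i
    rw [riemannUp, Fin.sum_univ_succ]
    simp only [h.christoffel_zero_zero_right hy, h.christoffel_succ_succ_zero hy]
    have e1 : pd i.succ (christoffel G i.succ a.succ 0) y = if i = a then pd a.succ ζ y else 0 := by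
      split_ifs with hi
      · subst hi
        exact pd_congr h.isOpen hy fun z hz => by rw [h.christoffel_succ_succ_zero hz, if_pos rfl]
      · exact pd_eq_zero h.isOpen hy fun z hz => by
          rw [h.christoffel_succ_succ_zero hz, if_neg hi]
    have e2 : pd a.succ (christoffel G i.succ i.succ 0) y = pd a.succ ζ y :=
      pd_congr h.isOpen hy fun z hz => by rw [h.christoffel_succ_succ_zero hz, if_pos rfl]
    rw [e1, e2, Finset.sum_sub_distrib]
    simp only [ite_mul, zero_mul, Finset.sum_ite_eq', Finset.mem_univ, if_true]
    have e3 : christoffel G i.succ i.succ a.succ y = christoffel G i.succ a.succ i.succ y := by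
      rw [christoffel, christoffel]
      congr 1
      refine Finset.sum_congr rfl fun l _ => ?_
      rw [show pd l (fun z => G z i.succ a.succ) y = pd l (fun z => G z a.succ i.succ) y from
        pd_congr h.isOpen hy fun z hz => h.metric.symm hz _ _]
      ring
    rw [e3]
    ring
  rw [ricci, Fin.sum_univ_succ, hterm0, Finset.sum_congr rfl fun i _ => hterm i,
    Finset.sum_sub_distrib]
  simp
  ring

/-- The traced Gauss equation together with the radial curvature: the normal direction contributes
-(ζ' + ζ²), and the trace over the slice contributes -(n - 1) ζ². -/
theorem ricci_succ_succ (h : IsUmbilic G I W ζ) (hy : y ∈ box I W) (a b : Fin n) :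
    ricci G a.succ b.succ y = ricci (slice G (y 0)) a b (tailPt y)
      - (pd 0 ζ y + n * ζ y ^ 2) * G y a.succ b.succ := by
  have hζ : DifferentiableAt ℝ ζ y :=
    (h.contDiffOn.contDiffAt (h.isOpen.mem_nhds hy)).differentiableAt (by simp)
  have hterm0 : riemannUp G 0 a.succ b.succ 0 y
      = -(pd 0 ζ y + ζ y ^ 2) * G y a.succ b.succ := by
    rw [riemannUp, Fin.sum_univ_succ]
    simp only [h.christoffel_zero_zero_left hy, h.christoffel_zero_zero_right hy,
      h.christoffel_succ_zero_succ hy, h.christoffel_zero_succ_succ hy]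
    rw [pd_eq_zero h.isOpen hy fun z hz => h.christoffel_zero_zero_left hz _,
      pd_congr h.isOpen hy fun z hz => h.christoffel_zero_succ_succ hz a b, pd_neg,
      pd_mul hζ (h.differentiableAt hy _ _), h.pd_zero y hy]
    simp only [mul_zero, zero_sub, ite_mul, zero_mul, sub_self, Finset.sum_neg_distrib,
      Finset.sum_ite_eq', Finset.mem_univ, if_true]
    ring
  rw [ricci, Fin.sum_univ_succ, hterm0, Finset.sum_congr rfl fun i _ => h.riemannUp_succ hy i a b i,
    Finset.sum_add_distrib, ricci, ← Finset.mul_sum, Finset.sum_sub_distrib]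
  simp
  ring

end IsUmbilic

end Umbilic

/-! ### Symmetries of the curvature tensor in coordinates. -/

section RiemannSymmetry

variable {n : ℕ}

theorem pd_comm {F : Eu n → ℝ} {S : Set (Eu n)} (hS : IsOpen S) (hF : ContDiffOn ℝ ∞ F S)
    {y : Eu n} (hy : y ∈ S) (i j : Fin n) : pd i (pd j F) y = pd j (pd i F) y := by
  have hFy := hF.contDiffAt (hS.mem_nhds hy)
  have hsymm : IsSymmSndFDerivAt ℝ F y := hFy.isSymmSndFDerivAt (by
    rw [minSmoothness_of_isRCLikeNormedField]; exact ENat.LEInfty.out)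
  have hd : DifferentiableAt ℝ (fderiv ℝ F) y :=
    (hFy.fderiv_right (m := 1) (by norm_cast)).differentiableAt (by simp)
  have h1 : ∀ a b : Fin n, pd a (pd b F) y
      = fderiv ℝ (fderiv ℝ F) y (EuclideanSpace.single a 1) (EuclideanSpace.single b 1) := by
    intro a b
    have h2 : HasFDerivAt (fun z => fderiv ℝ F z (EuclideanSpace.single b 1)) _ y :=
      hd.hasFDerivAt.clm_apply (hasFDerivAt_const _ _)
    change fderiv ℝ (fun z => fderiv ℝ F z (EuclideanSpace.single b 1)) y _ = _
    rw [h2.fderiv]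
    simp
  rw [h1, h1, hsymm.eq]

namespace IsMetricOn

variable {G : Eu n → Matrix (Fin n) (Fin n) ℝ} {S : Set (Eu n)} {y : Eu n}

theorem isUnit_det (hG : IsMetricOn G S) (hy : y ∈ S) : IsUnit (G y).det :=
  (hG.2 y hy).det_pos.ne'.isUnit

theorem sum_mul_inv (hG : IsMetricOn G S) (hy : y ∈ S) (i j : Fin n) :
    ∑ l, G y i l * (G y)⁻¹ l j = if i = j then 1 else 0 := by
  rw [← Matrix.mul_apply, Matrix.mul_nonsing_inv _ (hG.isUnit_det hy), Matrix.one_apply]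

theorem sum_inv_mul (hG : IsMetricOn G S) (hy : y ∈ S) (i j : Fin n) :
    ∑ l, (G y)⁻¹ i l * G y l j = if i = j then 1 else 0 := by
  rw [← Matrix.mul_apply, Matrix.nonsing_inv_mul _ (hG.isUnit_det hy), Matrix.one_apply]

theorem inv_symm (hG : IsMetricOn G S) (hy : y ∈ S) (i j : Fin n) :
    (G y)⁻¹ i j = (G y)⁻¹ j i := by
  have := (hG.2 y hy).isHermitian.inv.apply i j
  rwa [star_trivial, eq_comm] at this

theorem differentiableAt (hG : IsMetricOn G S) (hS : IsOpen S) (hy : y ∈ S) (i j : Fin n) :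
    DifferentiableAt ℝ (fun z => G z i j) y :=
  ((hG.1 i j).contDiffAt (hS.mem_nhds hy)).differentiableAt (by simp)

theorem differentiableAt_pd (hG : IsMetricOn G S) (hS : IsOpen S) (hy : y ∈ S) (k i j : Fin n) :
    DifferentiableAt ℝ (pd k fun z => G z i j) y :=
  ((contDiffOn_pd hS (hG.1 i j) k).contDiffAt (hS.mem_nhds hy)).differentiableAt (by simp)

theorem differentiableAt_christoffel (hG : IsMetricOn G S) (hS : IsOpen S) (hy : y ∈ S)
    (k i j : Fin n) : DifferentiableAt ℝ (christoffel G k i j) y :=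
  ((contDiffOn_christoffel hS hG k i j).contDiffAt (hS.mem_nhds hy)).differentiableAt (by simp)

theorem pd_symm (hG : IsMetricOn G S) (hS : IsOpen S) (hy : y ∈ S) (k i j : Fin n) :
    pd k (fun z => G z i j) y = pd k (fun z => G z j i) y :=
  pd_congr hS hy fun _ hz => hG.symm hz i j

theorem christoffel_symm (hG : IsMetricOn G S) (hS : IsOpen S) (hy : y ∈ S) (k i j : Fin n) :
    christoffel G k i j y = christoffel G k j i y := by
  rw [christoffel, christoffel]
  congr 1
  refine Finset.sum_congr rfl fun l _ => ?_
  rw [hG.pd_symm hS hy l i j]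
  ring

/-- The Christoffel symbols of the first kind. -/
theorem sum_mul_christoffel (hG : IsMetricOn G S) (hy : y ∈ S) (l i j : Fin n) :
    ∑ m, G y l m * christoffel G m i j y = 1 / 2 * (pd i (fun z => G z l j) y
      + pd j (fun z => G z l i) y - pd l (fun z => G z i j) y) := by
  simp only [christoffel, Finset.mul_sum]
  rw [Finset.sum_comm]
  have : ∀ k, ∑ m, G y l m * (1 / 2 * ((G y)⁻¹ m k * (pd i (fun z => G z k j) y
      + pd j (fun z => G z k i) y - pd k (fun z => G z i j) y)))
      = (if l = k then 1 else 0) * (1 / 2 * (pd i (fun z => G z k j) y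
      + pd j (fun z => G z k i) y - pd k (fun z => G z i j) y)) := by
    intro k
    rw [← hG.sum_mul_inv hy, Finset.sum_mul]
    exact Finset.sum_congr rfl fun m _ => by ring
  simp only [this]
  simp

/-- Metric compatibility of the connection. -/
theorem pd_eq (hG : IsMetricOn G S) (hS : IsOpen S) (hy : y ∈ S) (k i j : Fin n) :
    pd k (fun z => G z i j) y = ∑ m, G y i m * christoffel G m k j y
      + ∑ m, G y j m * christoffel G m k i y := by
  rw [hG.sum_mul_christoffel hy, hG.sum_mul_christoffel hy, hG.pd_symm hS hy k j i,
    hG.pd_symm hS hy j i k, hG.pd_symm hS hy i j k]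
  rw [hG.pd_symm hS hy i k j]
  ring

/-- Moving the metric inside the derivatives of Γ turns them into second derivatives of the metric,
at the cost of ∂g · Γ terms, which metric compatibility expresses by products of Christoffel
symbols. In this form the antisymmetry in k and l becomes visible. -/
theorem riemann_eq (hG : IsMetricOn G S) (hS : IsOpen S) (hy : y ∈ S) (i j k l : Fin n) :
    riemann G i j k l y
      = 1 / 2 * (pd i (pd j fun z => G z l k) y + pd i (pd k fun z => G z l j) y
          - pd i (pd l fun z => G z j k) y)
        - 1 / 2 * (pd j (pd i fun z => G z l k) y + pd j (pd k fun z => G z l i) y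
          - pd j (pd l fun z => G z i k) y)
        - ∑ m, ∑ p, G y m p * christoffel G p i l y * christoffel G m j k y
        + ∑ m, ∑ p, G y m p * christoffel G p j l y * christoffel G m i k y := by
  have first : ∀ a b c : Fin n, ∑ m, G y l m * pd a (christoffel G m b c) y
      = 1 / 2 * (pd a (pd b fun z => G z l c) y + pd a (pd c fun z => G z l b) y
          - pd a (pd l fun z => G z b c) y)
        - ∑ m, pd a (fun z => G z l m) y * christoffel G m b c y := by
    intro a b c
    have h1 : pd a (fun z => ∑ m, G z l m * christoffel G m b c z) y
        = pd a (fun z => 1 / 2 * (pd b (fun w => G w l c) z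
          + pd c (fun w => G w l b) z - pd l (fun w => G w b c) z)) y :=
      pd_congr hS hy fun z hz => hG.sum_mul_christoffel hz l b c
    have d1 := hG.differentiableAt_pd hS hy b l c
    have d2 := hG.differentiableAt_pd hS hy c l b
    have d3 := hG.differentiableAt_pd hS hy l b c
    rw [pd_sum fun m _ => (hG.differentiableAt hS hy l m).fun_mul
      (hG.differentiableAt_christoffel hS hy m b c),
      pd_mul (differentiableAt_const _) ((d1.fun_add d2).fun_sub d3), pd_const,
      pd_sub (d1.fun_add d2) d3,
      pd_add d1 d2] at h1
    rw [Finset.sum_congr rfl fun m _ => pd_mul (hG.differentiableAt hS hy l m)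
      (hG.differentiableAt_christoffel hS hy m b c), Finset.sum_add_distrib] at h1
    rw [eq_sub_iff_add_eq]
    rw [mul_zero, add_zero] at h1
    rw [← h1]
    congr 1
    exact Finset.sum_congr rfl fun m _ => by ring
  have second : ∀ a b c : Fin n, ∑ m, pd a (fun z => G z l m) y * christoffel G m b c y
      = ∑ p, ∑ m, G y l p * christoffel G p a m y * christoffel G m b c y
        + ∑ m, ∑ p, G y m p * christoffel G p a l y * christoffel G m b c y := by
    intro a b c
    rw [Finset.sum_comm (f := fun p m => G y l p * christoffel G p a m y * christoffel G m b c y),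
      ← Finset.sum_add_distrib]
    refine Finset.sum_congr rfl fun m _ => ?_
    rw [hG.pd_eq hS hy, add_mul, Finset.sum_mul, Finset.sum_mul]
  have expand : riemann G i j k l y
      = ∑ m, G y l m * pd i (christoffel G m j k) y - ∑ m, G y l m * pd j (christoffel G m i k) y
        + (∑ p, ∑ m, G y l p * christoffel G p i m y * christoffel G m j k y
          - ∑ p, ∑ m, G y l p * christoffel G p j m y * christoffel G m i k y) := by
    rw [riemann, ← Finset.sum_sub_distrib, ← Finset.sum_sub_distrib, ← Finset.sum_add_distrib]
    refine Finset.sum_congr rfl fun m _ => ?_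
    rw [riemannUp, hG.symm hy m l, ← Finset.sum_sub_distrib, add_mul, Finset.sum_mul]
    congr 1
    · ring
    · exact Finset.sum_congr rfl fun p _ => by ring
  rw [expand, first, first, second, second]
  ring

theorem riemann_antisymm_left (i j k l : Fin n) :
    riemann G i j k l y = -riemann G j i k l y := by
  simp only [riemann, riemannUp, ← Finset.sum_neg_distrib, Finset.sum_sub_distrib]
  exact Finset.sum_congr rfl fun m _ => by ring

/-- In `riemann_eq` the second derivatives match after commuting partial derivatives and transposing
the metric, and the quadratic sums are symmetric under exchanging their two Christoffel factors. -/
theorem riemann_antisymm_right (hG : IsMetricOn G S) (hS : IsOpen S) (hy : y ∈ S)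
    (i j k l : Fin n) : riemann G i j k l y = -riemann G i j l k y := by
  have hpd : ∀ a b c d : Fin n, pd a (pd b fun z => G z c d) y = pd a (pd b fun z => G z d c) y :=
    fun a b c d => pd_congr hS hy fun z hz => hG.pd_symm hS hz b c d
  have hq : ∀ a b c d : Fin n, ∑ m, ∑ p, G y m p * christoffel G p a b y * christoffel G m c d y
      = ∑ m, ∑ p, G y m p * christoffel G p c d y * christoffel G m a b y := by
    intro a b c d
    rw [Finset.sum_comm]
    refine Finset.sum_congr rfl fun m _ => Finset.sum_congr rfl fun p _ => ?_
    rw [hG.symm hy p m]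
    ring
  rw [hG.riemann_eq hS hy, hG.riemann_eq hS hy, hpd i j l k, hpd j i l k,
    pd_comm hS (hG.1 k l) hy i j, hq i l j k, hq j l i k,
    hpd i k l j, hpd i l j k, hpd j k l i, hpd j l i k, hpd i l k j, hpd i k j l, hpd j l k i,
    hpd j k i l]
  rw [hpd i l j k, hpd i k l j, hpd j l i k, hpd j k l i]
  ring

end IsMetricOn

end RiemannSymmetry

/-! ### Einstein metrics in dimension three have constant curvature. -/

section DimensionThree

/-- In dimension three each antisymmetric pair is dual to a single index, so T is a 3 × 3 matrix
indexed by p, q. That matrix is recovered from the Ricci contraction: up to det A it is the Einstein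
tensor with raised indices. Only the two pair antisymmetries of T are needed. -/
theorem eq_zero_of_trace_eq_zero (A : Matrix (Fin 3) (Fin 3) ℝ) (hA : ∀ i j, A i j = A j i)
    (hdet : A.det ≠ 0) (T : Fin 3 → Fin 3 → Fin 3 → Fin 3 → ℝ)
    (h₁ : ∀ i j k l, T i j k l = -T j i k l) (h₂ : ∀ i j k l, T i j k l = -T i j l k)
    (htr : ∀ j k, ∑ i, ∑ l, A i l * T i j k l = 0) (i j k l : Fin 3) : T i j k l = 0 := by
  have d1 : ∀ i k l, T i i k l = 0 := fun i k l => by linarith [h₁ i i k l]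
  have d2 : ∀ i j k, T i j k k = 0 := fun i j k => by linarith [h₂ i j k k]
  have a10 : ∀ k l, T 1 0 k l = -T 0 1 k l := fun k l => h₁ 1 0 k l
  have a20 : ∀ k l, T 2 0 k l = -T 0 2 k l := fun k l => h₁ 2 0 k l
  have a21 : ∀ k l, T 2 1 k l = -T 1 2 k l := fun k l => h₁ 2 1 k l
  have b10 : ∀ i j, T i j 1 0 = -T i j 0 1 := fun i j => h₂ i j 1 0
  have b20 : ∀ i j, T i j 2 0 = -T i j 0 2 := fun i j => h₂ i j 2 0
  have b21 : ∀ i j, T i j 2 1 = -T i j 1 2 := fun i j => h₂ i j 2 1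
  -- With A as inverse metric this is Ric^{pq} - ½ (tr Ric) A^{pq}, which vanishes because the
  -- contraction does.
  have key : ∀ p q : Fin 3, ∑ j, ∑ k, (A p k * A q j - 1 / 2 * A p q * A j k)
      * ∑ i, ∑ l, A i l * T i j k l = 0 := fun p q => by simp only [htr]; simp
  -- Addition in Fin 3 is cyclic, so (p + 1, p + 2) is the oriented pair complementary to p.
  have val : ∀ p q : Fin 3, A.det * T (p + 1) (p + 2) (q + 1) (q + 2) = 0 := by
    intro p q
    rw [← key p q, Matrix.det_fin_three]
    simp only [Fin.sum_univ_three, d1, d2, a10, a20, a21, b10, b20, b21, hA 1 0, hA 2 0, hA 2 1]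
    fin_cases p <;> fin_cases q <;>
      simp only [Fin.zero_eta, Fin.mk_one, Fin.reduceFinMk, Fin.reduceAdd, a20, b20, hA 1 0, hA 2 0,
        hA 2 1] <;> ring
  have val' : ∀ p q : Fin 3, T (p + 1) (p + 2) (q + 1) (q + 2) = 0 := fun p q =>
    (mul_eq_zero.1 (val p q)).resolve_left hdet
  have v00 : T 1 2 1 2 = 0 := val' 0 0
  have v01 : T 1 2 2 0 = 0 := val' 0 1
  have v02 : T 1 2 0 1 = 0 := val' 0 2
  have v10 : T 2 0 1 2 = 0 := val' 1 0
  have v11 : T 2 0 2 0 = 0 := val' 1 1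
  have v12 : T 2 0 0 1 = 0 := val' 1 2
  have v20 : T 0 1 1 2 = 0 := val' 2 0
  have v21 : T 0 1 2 0 = 0 := val' 2 1
  have v22 : T 0 1 0 1 = 0 := val' 2 2
  -- Up to transposition and the diagonal, the only index pairs are (0, 1), (2, 0) and (1, 2).
  have cases3 : ∀ P : Fin 3 → Fin 3 → Prop, (∀ i, P i i) → (∀ i j, P i j → P j i) →
      P 0 1 → P 2 0 → P 1 2 → ∀ i j, P i j := by
    intro P hd hs h01 h20 h12 i j
    fin_cases i <;> fin_cases j
    exacts [hd _, h01, hs _ _ h20, hs _ _ h01, hd _, h12, h20, hs _ _ h12, hd _]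
  refine cases3 (fun i j => T i j k l = 0) (fun i => d1 i k l)
    (fun i j h => by rw [h₁, h, neg_zero]) ?_ ?_ ?_ i j
  · exact cases3 (fun k l => T 0 1 k l = 0) (fun k => d2 _ _ k)
      (fun k l h => by rw [h₂, h, neg_zero]) v22 v21 v20 k l
  · exact cases3 (fun k l => T 2 0 k l = 0) (fun k => d2 _ _ k)
      (fun k l h => by rw [h₂, h, neg_zero]) v12 v11 v10 k l
  · exact cases3 (fun k l => T 1 2 k l = 0) (fun k => d2 _ _ k)
      (fun k l h => by rw [h₂, h, neg_zero]) v02 v01 v00 k l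

/-- The curvature tensor is that of a space of constant curvature `κ`. -/
def IsSpaceForm {n : ℕ} (G : Eu n → Matrix (Fin n) (Fin n) ℝ) (S : Set (Eu n)) (κ : ℝ) : Prop :=
  ∀ y ∈ S, ∀ i j k l, riemannUp G i j k l y
    = κ * ((if i = l then G y j k else 0) - if j = l then G y i k else 0)

/-- A three-dimensional Einstein metric has constant curvature. -/
theorem isSpaceForm_of_einstein {G : Eu 3 → Matrix (Fin 3) (Fin 3) ℝ} {S : Set (Eu 3)}
    (hS : IsOpen S) (hG : IsMetricOn G S) {κ : ℝ}
    (hric : ∀ y ∈ S, ∀ j k, ricci G j k y = 2 * κ * G y j k) : IsSpaceForm G S κ := by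
  intro y hy
  -- T is the deviation from the model of curvature κ, whose Ricci tensor in dimension three is 2κ
  -- g; hence T has vanishing contraction.
  let T : Fin 3 → Fin 3 → Fin 3 → Fin 3 → ℝ := fun i j k l =>
    riemann G i j k l y - κ * (G y j k * G y i l - G y i k * G y j l)
  have hT := eq_zero_of_trace_eq_zero (G y)⁻¹ (hG.inv_symm hy)
    (Matrix.isUnit_nonsing_inv_det _ (hG.isUnit_det hy)).ne_zero T
    (fun i j k l => by simp only [T, IsMetricOn.riemann_antisymm_left i j k l]; ring)
    (fun i j k l => by simp only [T, hG.riemann_antisymm_right hS hy i j k l]; ring) ?_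
  · intro i j k l
    set u : Fin 3 → ℝ := fun m => riemannUp G i j k m y
      - κ * ((if i = m then G y j k else 0) - if j = m then G y i k else 0) with hu
    -- The vanishing of T is the statement with its last index lowered by g; invertibility of g
    -- raises it again.
    have hu0 : Matrix.vecMul u (G y) = 0 := by
      funext q
      have := hT i j k q
      simp only [T, riemann] at this
      simp only [Matrix.vecMul, dotProduct, hu, sub_mul, Finset.sum_sub_distrib, mul_assoc,
        ← Finset.mul_sum, ite_mul, zero_mul, Finset.sum_ite_eq, Finset.mem_univ, if_true]
      exact this
    have h3 : u = 0 := by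
      have := congrArg (fun w => Matrix.vecMul w (G y)⁻¹) hu0
      simpa [Matrix.vecMul_vecMul, Matrix.mul_nonsing_inv _ (hG.isUnit_det hy)] using this
    have := congrFun h3 l
    simp only [hu, Pi.zero_apply] at this
    linarith
  · intro j k
    have e1 : ∑ i, ∑ l, (G y)⁻¹ i l * riemann G i j k l y = ricci G j k y := by
      simp only [riemann, Finset.mul_sum, ricci]
      refine Finset.sum_congr rfl fun i _ => ?_
      rw [Finset.sum_comm]
      have : ∀ m, ∑ l, (G y)⁻¹ i l * (riemannUp G i j k m y * G y m l)
          = (if m = i then 1 else 0) * riemannUp G i j k m y := by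
        intro m
        rw [← hG.sum_mul_inv hy, Finset.sum_mul]
        exact Finset.sum_congr rfl fun l _ => by rw [hG.inv_symm hy i l]; ring
      simp [this]
    have e2 : ∑ i, ∑ l, (G y)⁻¹ i l * (G y j k * G y i l) = 3 * G y j k := by
      have : ∀ i, ∑ l, (G y)⁻¹ i l * (G y j k * G y i l) = G y j k := by
        intro i
        have h5 := hG.sum_inv_mul hy i i
        rw [if_pos rfl] at h5
        calc _ = (∑ l, (G y)⁻¹ i l * G y l i) * G y j k := by
              rw [Finset.sum_mul]
              exact Finset.sum_congr rfl fun l _ => by rw [hG.symm hy i l]; ring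
          _ = _ := by rw [h5, one_mul]
      simp [this]
    have e3 : ∑ i, ∑ l, (G y)⁻¹ i l * (G y i k * G y j l) = G y j k := by
      have : ∀ i, ∑ l, (G y)⁻¹ i l * (G y i k * G y j l) = (if i = j then 1 else 0) * G y i k := by
        intro i
        rw [← hG.sum_inv_mul hy, Finset.sum_mul]
        exact Finset.sum_congr rfl fun l _ => by rw [hG.symm hy j l]; ring
      simp [this]
    have : ∑ i, ∑ l, (G y)⁻¹ i l * T i j k l
        = ∑ i, ∑ l, (G y)⁻¹ i l * riemann G i j k l y
          - κ * (∑ i, ∑ l, (G y)⁻¹ i l * (G y j k * G y i l)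
            - ∑ i, ∑ l, (G y)⁻¹ i l * (G y i k * G y j l)) := by
      simp only [mul_sub, Finset.mul_sum, ← Finset.sum_sub_distrib, T]
      exact Finset.sum_congr rfl fun i _ => Finset.sum_congr rfl fun l _ => by ring
    rw [this, e1, e2, e3, hric y hy]
    ring

theorem IsSpaceForm.hasConstantCurvatureOn {n : ℕ} {G : Eu n → Matrix (Fin n) (Fin n) ℝ}
    {S : Set (Eu n)} {κ : ℝ} (hG : IsMetricOn G S) (h : IsSpaceForm G S κ) :
    HasConstantCurvatureOn G S κ := by
  intro y hy X Y
  have hR : ∀ i j k l, riemann G i j k l y = κ * (G y j k * G y i l - G y i k * G y j l) := by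
    intro i j k l
    simp only [riemann, h y hy, mul_assoc, ← Finset.mul_sum, sub_mul, Finset.sum_sub_distrib,
      ite_mul, zero_mul, Finset.sum_ite_eq, Finset.mem_univ, if_true]
  have e1 : (∑ i, ∑ j, G y i j * X i * X j) * (∑ i, ∑ j, G y i j * Y i * Y j)
      = ∑ i, ∑ j, ∑ k, ∑ l, G y j k * G y i l * X i * Y j * Y k * X l := by
    rw [Finset.sum_mul]
    refine Finset.sum_congr rfl fun i _ => ?_
    rw [Finset.sum_mul_sum, Finset.sum_comm]
    refine Finset.sum_congr rfl fun j _ => ?_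
    simp only [Finset.mul_sum]
    rw [Finset.sum_comm]
    refine Finset.sum_congr rfl fun k _ => Finset.sum_congr rfl fun l _ => ?_
    ring
  have e2 : (∑ i, ∑ j, G y i j * X i * Y j) ^ 2
      = ∑ i, ∑ j, ∑ k, ∑ l, G y i k * G y j l * X i * Y j * Y k * X l := by
    rw [sq, Finset.sum_mul]
    refine Finset.sum_congr rfl fun i _ => ?_
    have : ∑ i, ∑ j, G y i j * X i * Y j = ∑ j, ∑ l, G y j l * Y j * X l := by
      rw [Finset.sum_comm]
      exact Finset.sum_congr rfl fun a _ => Finset.sum_congr rfl fun b _ => by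
        rw [hG.symm hy a b]; ring
    rw [this, Finset.sum_mul_sum, Finset.sum_comm]
    refine Finset.sum_congr rfl fun j _ => Finset.sum_congr rfl fun k _ => ?_
    rw [Finset.mul_sum]
    exact Finset.sum_congr rfl fun l _ => by ring
  rw [e1, e2]
  simp only [← Finset.sum_sub_distrib, Finset.mul_sum, hR]
  refine Finset.sum_congr rfl fun i _ => Finset.sum_congr rfl fun j _ =>
    Finset.sum_congr rfl fun k _ => Finset.sum_congr rfl fun l _ => ?_
  ring

end DimensionThree

/-! ### Integrable linear total differential systems, solved along rays. -/

section Frobenius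

variable {X V : Type} [NormedAddCommGroup X] [NormedSpace ℝ X] [FiniteDimensional ℝ X]
  [NormedAddCommGroup V] [NormedSpace ℝ V] [FiniteDimensional ℝ V]

/-- Solutions of `∂_w Y = A(y) w Y` along rays from `x₀`, depending smoothly on the ray. -/
theorem exists_ray_solution {A : X → X →L[ℝ] V →L[ℝ] V} {S : Set X} (hS : IsOpen S)
    (hA : ContDiffOn ℝ ∞ A S) {x₀ : X} (hx₀ : x₀ ∈ S) (Y₀ : V) :
    ∃ (Y : ℝ × X → V) (δ : ℝ), 0 < δ ∧
      ContDiffOn ℝ ∞ Y (Set.Ioo (-δ) δ ×ˢ Metric.ball 0 δ) ∧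
      (∀ w ∈ Metric.ball (0 : X) δ, Y (0, w) = Y₀) ∧
      ∀ t ∈ Set.Ioo (-δ) δ, ∀ w ∈ Metric.ball (0 : X) δ, x₀ + t • w ∈ S ∧
        HasDerivAt (fun s => Y (s, w)) (A (x₀ + t • w) w (Y (t, w))) t := by
  -- The direction w is made a stationary component of the state, so smooth dependence on the
  -- initial value contains smooth dependence on the ray.
  let vf : X × X × V → X × X × V := fun p => (p.2.1, 0, A p.1 p.2.1 p.2.2)
  have hΩ : IsOpen (S ×ˢ (Set.univ : Set (X × V))) := hS.prod isOpen_univ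
  have hvf : ContDiffOn ℝ ∞ vf (S ×ˢ (Set.univ : Set (X × V))) := by
    have h1 : ContDiffOn ℝ ∞ (fun p : X × X × V => A p.1) (S ×ˢ (Set.univ : Set (X × V))) :=
      hA.comp contDiff_fst.contDiffOn fun p hp => hp.1
    have h2 : ContDiff ℝ ∞ (fun p : X × X × V => p.2.1) := contDiff_fst.comp contDiff_snd
    have h3 : ContDiff ℝ ∞ (fun p : X × X × V => p.2.2) := contDiff_snd.comp contDiff_snd
    exact h2.contDiffOn.prodMk (contDiffOn_const.prodMk
      ((h1.clm_apply h2.contDiffOn).clm_apply h3.contDiffOn))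
  obtain ⟨Φ, δ, hδ, hΦ, hΦ0, hΦd⟩ := exists_smooth_flow hΩ hvf
    (x₀ := (x₀, 0, Y₀)) ⟨hx₀, trivial⟩
  let ι : ℝ × X → ℝ × X × X × V := fun p => (p.1, x₀, p.2, Y₀)
  have hι : ContDiff ℝ ∞ ι :=
    contDiff_fst.prodMk (contDiff_const.prodMk (contDiff_snd.prodMk contDiff_const))
  have hball : ∀ w ∈ Metric.ball (0 : X) δ, (x₀, w, Y₀) ∈ Metric.ball (x₀, (0 : X), Y₀) δ := by
    intro w hw
    rw [Metric.mem_ball, Prod.dist_eq, Prod.dist_eq]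
    exact max_lt (by simpa using hδ) (max_lt hw (by simpa using hδ))
  have h0I : (0 : ℝ) ∈ Set.Ioo (-δ) δ := ⟨by linarith, hδ⟩
  have hw2 : ∀ w ∈ Metric.ball (0 : X) δ, ∀ t ∈ Set.Ioo (-δ) δ, (Φ (t, x₀, w, Y₀)).2.1 = w := by
    intro w hw t ht
    have hd : ∀ s ∈ Set.Ioo (-δ) δ, HasDerivAt (fun s => (Φ (s, x₀, w, Y₀)).2.1) 0 s :=
      fun s hs => ((ContinuousLinearMap.fst ℝ X V).comp
        (ContinuousLinearMap.snd ℝ X (X × V))).hasFDerivAt.comp_hasDerivAt s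
          (hΦd s hs _ (hball w hw)).2
    have := (convex_Ioo (-δ) δ).is_const_of_fderivWithin_eq_zero (𝕜 := ℝ)
      (f := fun s => (Φ (s, x₀, w, Y₀)).2.1)
      (fun s hs => (hd s hs).differentiableAt.differentiableWithinAt)
      (fun s hs => by
        rw [fderivWithin_of_isOpen isOpen_Ioo hs, (hd s hs).hasFDerivAt.fderiv]; ext; simp)
      ht h0I
    simpa [hΦ0 _ (hball w hw)] using this
  have hw1 : ∀ w ∈ Metric.ball (0 : X) δ, ∀ t ∈ Set.Ioo (-δ) δ,
      (Φ (t, x₀, w, Y₀)).1 = x₀ + t • w := by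
    intro w hw t ht
    have hd : ∀ s ∈ Set.Ioo (-δ) δ, HasDerivAt (fun s => (Φ (s, x₀, w, Y₀)).1 - s • w) 0 s := by
      intro s hs
      have h1 : HasDerivAt (fun s => (Φ (s, x₀, w, Y₀)).1) (Φ (s, x₀, w, Y₀)).2.1 s :=
        (ContinuousLinearMap.fst ℝ X (X × V)).hasFDerivAt.comp_hasDerivAt s
          (hΦd s hs _ (hball w hw)).2
      rw [hw2 w hw s hs] at h1
      refine (h1.fun_sub ((hasDerivAt_id s).smul_const w)).congr_deriv ?_
      rw [one_smul, sub_self]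
    have := (convex_Ioo (-δ) δ).is_const_of_fderivWithin_eq_zero (𝕜 := ℝ)
      (f := fun s => (Φ (s, x₀, w, Y₀)).1 - s • w)
      (fun s hs => (hd s hs).differentiableAt.differentiableWithinAt)
      (fun s hs => by
        rw [fderivWithin_of_isOpen isOpen_Ioo hs, (hd s hs).hasFDerivAt.fderiv]; ext; simp)
      ht h0I
    simp only [hΦ0 _ (hball w hw), zero_smul, sub_zero] at this
    rwa [sub_eq_iff_eq_add] at this
  refine ⟨fun p => (Φ (ι p)).2.2, δ, hδ, ?_, ?_, ?_⟩
  · refine (contDiff_snd.comp contDiff_snd).comp_contDiffOn (hΦ.comp hι.contDiffOn ?_)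
    exact fun p hp => ⟨hp.1, hball _ hp.2⟩
  · intro w hw
    simp only [ι, hΦ0 _ (hball w hw)]
  · intro t ht w hw
    obtain ⟨h1, h2⟩ := hΦd t ht _ (hball w hw)
    refine ⟨?_, ?_⟩
    · rw [← hw1 w hw t ht]; exact h1.1
    · have h3 : HasDerivAt (fun s => (Φ (s, x₀, w, Y₀)).2.2)
          (A (Φ (t, x₀, w, Y₀)).1 (Φ (t, x₀, w, Y₀)).2.1 (Φ (t, x₀, w, Y₀)).2.2) t :=
        ((ContinuousLinearMap.snd ℝ X V).comp
          (ContinuousLinearMap.snd ℝ X (X × V))).hasFDerivAt.comp_hasDerivAt t h2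
      rw [hw1 w hw t ht, hw2 w hw t ht] at h3
      exact h3

theorem hasDerivAt_clm_apply_const {P Q : Type} [NormedAddCommGroup P] [NormedSpace ℝ P]
    [NormedAddCommGroup Q] [NormedSpace ℝ Q] {c : ℝ → P →L[ℝ] Q} {c' : P →L[ℝ] Q} {t : ℝ}
    (hc : HasDerivAt c c' t) (z : P) : HasDerivAt (fun s => c s z) (c' z) t :=
  (ContinuousLinearMap.apply ℝ Q z).hasFDerivAt.comp_hasDerivAt t hc

theorem hasDerivAt_comp_curve {P Q : Type} [NormedAddCommGroup P] [NormedSpace ℝ P]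
    [NormedAddCommGroup Q] [NormedSpace ℝ Q] {B : P → Q} {B' : P →L[ℝ] Q} {γ : ℝ → P} {γ' y : P}
    {t : ℝ} (hB : HasFDerivAt B B' y) (hγ : HasDerivAt γ γ' t) (hy : γ t = y) :
    HasDerivAt (fun s => B (γ s)) (B' γ') t := by
  subst hy
  exact hB.comp_hasDerivAt t hγ

section Rays

variable {X V Q : Type} [NormedAddCommGroup X] [NormedSpace ℝ X]
  [NormedAddCommGroup V] [NormedSpace ℝ V] [NormedAddCommGroup Q] [NormedSpace ℝ Q]

theorem hasDerivAt_clm_apply₂ (b : Q →L[ℝ] X →L[ℝ] V) {c : ℝ → Q} {c' : Q} {v : ℝ → X} {v' : X}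
    {t : ℝ} (hc : HasDerivAt c c' t) (hv : HasDerivAt v v' t) :
    HasDerivAt (fun s => b (c s) (v s)) (b c' (v t) + b (c t) v') t :=
  (hasDerivAt_comp_curve b.hasFDerivAt hc rfl).clm_apply hv

/-- The derivative of `c t (v t) (Y t)` along curves. -/
theorem hasDerivAt_clm_apply_apply (ev : Q →L[ℝ] X →L[ℝ] V →L[ℝ] V)
    {c : ℝ → Q} {c' : Q} {v : ℝ → X} {v' : X} {Y : ℝ → V} {Y' : V} {t : ℝ}
    (hc : HasDerivAt c c' t) (hv : HasDerivAt v v' t) (hY : HasDerivAt Y Y' t) :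
    HasDerivAt (fun s => ev (c s) (v s) (Y s))
      (ev c' (v t) (Y t) + ev (c t) v' (Y t) + ev (c t) (v t) Y') t :=
  (hasDerivAt_clm_apply₂ ev hc hv).clm_apply hY

/-- The mixed derivative of a family of solutions along rays. -/
theorem fderiv_fderiv_ray (ev : Q →L[ℝ] X →L[ℝ] V →L[ℝ] V) {A : X → Q} {A' : X →L[ℝ] Q}
    {x₀ : X} {Y : ℝ × X → V} {O : Set (ℝ × X)} (hO : IsOpen O) {t : ℝ} {w : X} (hp : (t, w) ∈ O)
    (hY : ContDiffAt ℝ ∞ Y (t, w)) (hA : HasFDerivAt A A' (x₀ + t • w))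
    (htime : ∀ p ∈ O, fderiv ℝ Y p (1, 0) = ev (A (x₀ + p.1 • p.2)) p.2 (Y p)) (z : X) :
    fderiv ℝ (fderiv ℝ Y) (t, w) (0, z) (1, 0)
      = t • ev (A' z) w (Y (t, w)) + ev (A (x₀ + t • w)) z (Y (t, w))
        + ev (A (x₀ + t • w)) w (fderiv ℝ Y (t, w) (0, z)) := by
  have hYf : HasFDerivAt Y (fderiv ℝ Y (t, w)) (t, w) :=
    (hY.differentiableAt (by simp)).hasFDerivAt
  have hYff : HasFDerivAt (fderiv ℝ Y) (fderiv ℝ (fderiv ℝ Y) (t, w)) (t, w) :=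
    ((hY.fderiv_right (m := 1) (by norm_cast)).differentiableAt (by simp)).hasFDerivAt
  have hw0 : w + (0 : ℝ) • z = w := by rw [zero_smul, add_zero]
  have c2 : HasDerivAt (fun ε : ℝ => w + ε • z) z 0 := by
    simpa using ((hasDerivAt_id (0 : ℝ)).smul_const z).const_add w
  have c3 : HasDerivAt (fun ε : ℝ => (t, w + ε • z)) ((0 : ℝ), z) 0 :=
    (hasDerivAt_const _ _).prodMk c2
  have c4 : HasDerivAt (fun ε : ℝ => x₀ + t • (w + ε • z)) (t • z) 0 :=
    (c2.const_smul t).const_add x₀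
  have e1 : HasDerivAt (fun ε : ℝ => fderiv ℝ Y (t, w + ε • z) (1, 0))
      (fderiv ℝ (fderiv ℝ Y) (t, w) (0, z) (1, 0)) 0 :=
    hasDerivAt_clm_apply_const (hasDerivAt_comp_curve hYff c3 (by rw [hw0])) _
  have hAc : HasDerivAt (fun ε : ℝ => A (x₀ + t • (w + ε • z))) (A' (t • z)) 0 :=
    hasDerivAt_comp_curve hA c4 (by rw [hw0])
  have hYc : HasDerivAt (fun ε : ℝ => Y (t, w + ε • z)) (fderiv ℝ Y (t, w) (0, z)) 0 :=
    hasDerivAt_comp_curve hYf c3 (by rw [hw0])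
  have e2 := hasDerivAt_clm_apply_apply ev hAc c2 hYc
  rw [hw0] at e2
  have e3 : (fun ε : ℝ => fderiv ℝ Y (t, w + ε • z) (1, 0)) =ᶠ[𝓝 0]
      fun ε : ℝ => ev (A (x₀ + t • (w + ε • z))) (w + ε • z) (Y (t, w + ε • z)) := by
    have : ∀ᶠ ε : ℝ in 𝓝 0, (t, w + ε • z) ∈ O := by
      apply c3.continuousAt.eventually_mem
      rw [hw0]
      exact hO.mem_nhds hp
    filter_upwards [this] with ε hε
    exact htime _ hε
  have e4 := e1.unique (e2.congr_of_eventuallyEq e3)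
  rw [e4, map_smul, map_smul]
  rfl

/-- Along a ray, the failure of `∂_z Y = A z Y` satisfies the linear equation itself. -/
theorem hasDerivAt_ray_defect (ev : Q →L[ℝ] X →L[ℝ] V →L[ℝ] V) {A : X → Q} {A' : X →L[ℝ] Q}
    {x₀ : X} {Y : ℝ × X → V} {O : Set (ℝ × X)} (hO : IsOpen O) {t : ℝ} {w : X} (hp : (t, w) ∈ O)
    (hY : ContDiffAt ℝ ∞ Y (t, w)) (hA : HasFDerivAt A A' (x₀ + t • w))
    (htime : ∀ p ∈ O, fderiv ℝ Y p (1, 0) = ev (A (x₀ + p.1 • p.2)) p.2 (Y p)) (z : X)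
    (hint : ev (A' w) z (Y (t, w)) + ev (A (x₀ + t • w)) z (ev (A (x₀ + t • w)) w (Y (t, w)))
      = ev (A' z) w (Y (t, w)) + ev (A (x₀ + t • w)) w (ev (A (x₀ + t • w)) z (Y (t, w)))) :
    HasDerivAt (fun s => fderiv ℝ Y (s, w) (0, z) - s • ev (A (x₀ + s • w)) z (Y (s, w)))
      (ev (A (x₀ + t • w)) w
        (fderiv ℝ Y (t, w) (0, z) - t • ev (A (x₀ + t • w)) z (Y (t, w)))) t := by
  have hYf : HasFDerivAt Y (fderiv ℝ Y (t, w)) (t, w) :=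
    (hY.differentiableAt (by simp)).hasFDerivAt
  have hYff : HasFDerivAt (fderiv ℝ Y) (fderiv ℝ (fderiv ℝ Y) (t, w)) (t, w) :=
    ((hY.fderiv_right (m := 1) (by norm_cast)).differentiableAt (by simp)).hasFDerivAt
  -- Commuting the derivatives in t and z lets the ray equation, differentiated in z, give the time
  -- derivative of ∂_z Y; `hint` then turns the remaining terms into the same linear equation for
  -- the defect.
  have hsymm : fderiv ℝ (fderiv ℝ Y) (t, w) (1, 0) (0, z)
      = fderiv ℝ (fderiv ℝ Y) (t, w) (0, z) (1, 0) :=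
    hY.isSymmSndFDerivAt (by
      rw [minSmoothness_of_isRCLikeNormedField]; exact ENat.LEInfty.out) _ _
  have c1 : HasDerivAt (fun s : ℝ => (s, w)) ((1 : ℝ), (0 : X)) t :=
    (hasDerivAt_id t).prodMk (hasDerivAt_const _ _)
  have d0 : HasDerivAt (fun s : ℝ => Y (s, w)) (ev (A (x₀ + t • w)) w (Y (t, w))) t := by
    rw [← htime _ hp]
    exact hasDerivAt_comp_curve hYf c1 rfl
  have d1 : HasDerivAt (fun s => fderiv ℝ Y (s, w) (0, z))
      (fderiv ℝ (fderiv ℝ Y) (t, w) (1, 0) (0, z)) t :=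
    hasDerivAt_clm_apply_const (hasDerivAt_comp_curve hYff c1 rfl) _
  have cray : HasDerivAt (fun s : ℝ => x₀ + s • w) w t := by
    simpa using ((hasDerivAt_id t).smul_const w).const_add x₀
  have dA : HasDerivAt (fun s => A (x₀ + s • w)) (A' w) t := hasDerivAt_comp_curve hA cray rfl
  have d3 := hasDerivAt_clm_apply_apply ev dA (hasDerivAt_const t z) d0
  have d2 := (hasDerivAt_id t).fun_smul d3
  refine (d1.fun_sub d2).congr_deriv ?_
  rw [hsymm, fderiv_fderiv_ray ev hO hp hY hA htime, map_zero, map_sub, map_smul,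
    eq_sub_of_add_eq hint.symm, _root_.zero_apply, id]
  module

end Rays

/-- Local solvability of an integrable linear total differential system `dY = A Y`. -/
theorem exists_total_solution {A : X → X →L[ℝ] V →L[ℝ] V} {S : Set X} (hS : IsOpen S)
    (hA : ContDiffOn ℝ ∞ A S)
    (hint : ∀ y ∈ S, ∀ w z : X, ∀ Y : V, fderiv ℝ A y w z Y + A y z (A y w Y)
      = fderiv ℝ A y z w Y + A y w (A y z Y)) {x₀ : X} (hx₀ : x₀ ∈ S) (Y₀ : V) :
    ∃ (Y : X → V) (r : ℝ), 0 < r ∧ Metric.ball x₀ r ⊆ S ∧ ContDiffOn ℝ ∞ Y (Metric.ball x₀ r) ∧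
      Y x₀ = Y₀ ∧ ∀ y ∈ Metric.ball x₀ r, ∀ z, fderiv ℝ Y y z = A y z (Y y) := by
  obtain ⟨Y, δ, hδ, hY, hY0, hYd⟩ := exists_ray_solution hS hA hx₀ Y₀
  set O : Set (ℝ × X) := Set.Ioo (-δ) δ ×ˢ Metric.ball 0 δ with hO
  have hOo : IsOpen O := isOpen_Ioo.prod Metric.isOpen_ball
  have hYat : ∀ p ∈ O, ContDiffAt ℝ ∞ Y p := fun p hp => hY.contDiffAt (hOo.mem_nhds hp)
  have hYf : ∀ p ∈ O, HasFDerivAt Y (fderiv ℝ Y p) p := fun p hp =>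
    ((hYat p hp).differentiableAt (by simp)).hasFDerivAt
  have hAf : ∀ y ∈ S, HasFDerivAt A (fderiv ℝ A y) y := fun y hy =>
    ((hA.contDiffAt (hS.mem_nhds hy)).differentiableAt (by simp)).hasFDerivAt
  have htime : ∀ p ∈ O, fderiv ℝ Y p (1, 0) = A (x₀ + p.1 • p.2) p.2 (Y p) := by
    rintro ⟨t, w⟩ hp
    have c1 : HasDerivAt (fun s : ℝ => (s, w)) ((1 : ℝ), (0 : X)) t :=
      (hasDerivAt_id t).prodMk (hasDerivAt_const _ _)
    exact ((hYf _ hp).comp_hasDerivAt t c1).unique (hYd t hp.1 w hp.2).2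
  have hspace : ∀ t ∈ Set.Ico 0 δ, ∀ w ∈ Metric.ball (0 : X) δ, ∀ z,
      fderiv ℝ Y (t, w) (0, z) = t • A (x₀ + t • w) z (Y (t, w)) := by
    intro t₁ ht₁ w hw z
    have hI : ∀ t ∈ Set.Icc 0 t₁, t ∈ Set.Ioo (-δ) δ := fun t ht =>
      ⟨by linarith [ht.1], ht.2.trans_lt ht₁.2⟩
    -- The desired identity ∂_z Y = t A z Y is the vanishing of D, which satisfies D' = A w D.
    let D : ℝ → V := fun t => fderiv ℝ Y (t, w) (0, z) - t • A (x₀ + t • w) z (Y (t, w))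
    have hD : ∀ t ∈ Set.Icc 0 t₁, HasDerivAt D (A (x₀ + t • w) w (D t)) t := by
      intro t ht
      have hmem := (hYd t (hI t ht) w hw).1
      exact hasDerivAt_ray_defect (Q := X →L[ℝ] V →L[ℝ] V) (A := A)
        (A' := fderiv ℝ A (x₀ + t • w)) (ContinuousLinearMap.id ℝ (X →L[ℝ] V →L[ℝ] V)) hOo
        ⟨hI t ht, hw⟩ (hYat _ ⟨hI t ht, hw⟩) (hAf _ hmem) htime z (hint _ hmem w z (Y (t, w)))
    have hcont : ContinuousOn (fun t : ℝ => A (x₀ + t • w) w) (Set.Icc 0 t₁) := by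
      intro t ht
      have h5 : ContinuousAt A (x₀ + t • w) := (hAf _ (hYd t (hI t ht) w hw).1).continuousAt
      have h6 : ContinuousAt (fun t : ℝ => x₀ + t • w) t := by fun_prop
      have h7 : ContinuousAt (fun t : ℝ => A (x₀ + t • w)) t :=
        ContinuousAt.comp (f := fun t : ℝ => x₀ + t • w) h5 h6
      exact (h7.clm_apply continuousAt_const).continuousWithinAt
    obtain ⟨K, hK⟩ := isCompact_Icc.exists_bound_of_continuousOn hcont
    -- Grönwall: D starts at 0, because Y(0, ·) is constant, and |D'| ≤ K |D| on the compact
    -- interval.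
    have hzero := eq_zero_of_abs_deriv_le_mul_abs_self_of_eq_zero_right (f := D)
      (f' := fun t => A (x₀ + t • w) w (D t)) (K := K) (a := 0) (b := t₁)
      (fun t ht => (hD t ht).continuousAt.continuousWithinAt)
      (fun t ht => (hD t ⟨ht.1, ht.2.le⟩).hasDerivWithinAt)
      (by
        have h0 : ((0 : ℝ), w) ∈ O := ⟨⟨by linarith, hδ⟩, hw⟩
        have c1 : HasFDerivAt (fun w : X => ((0 : ℝ), w)) (ContinuousLinearMap.inr ℝ ℝ X) w :=
          hasFDerivAt_prodMk_right _ _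
        have c2 := (hYf _ h0).comp w c1
        have c3 : HasFDerivAt (Y ∘ fun w : X => ((0 : ℝ), w)) (0 : X →L[ℝ] V) w := by
          refine (hasFDerivAt_const Y₀ w).congr_of_eventuallyEq ?_
          filter_upwards [Metric.isOpen_ball.mem_nhds hw] with w' hw'
          exact hY0 w' hw'
        have := DFunLike.congr_fun (c2.unique c3) z
        simpa [D] using this)
      (fun t ht => (A (x₀ + t • w) w).le_of_opNorm_le (hK t ⟨ht.1, ht.2.le⟩) _)
      t₁ ⟨ht₁.1, le_rfl⟩
    exact sub_eq_zero.1 hzero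
  -- The point y is reached at the fixed time δ/2 along the ray of direction (y - x₀)/(δ/2); any
  -- positive time below δ would serve.
  have ht : δ / 2 ∈ Set.Ico 0 δ := ⟨by positivity, by linarith⟩
  have htI : δ / 2 ∈ Set.Ioo (-δ) δ := ⟨by linarith, by linarith⟩
  have ht0 : δ / 2 ≠ 0 := by positivity
  have hmap : ∀ y ∈ Metric.ball x₀ (δ / 2 * δ), (δ / 2)⁻¹ • (y - x₀) ∈ Metric.ball (0 : X) δ := by
    intro y hy
    rw [mem_ball_zero_iff, norm_smul, norm_inv, Real.norm_of_nonneg ht.1]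
    rw [mem_ball_iff_norm] at hy
    rw [inv_mul_lt_iff₀ (by positivity)]
    exact hy
  have hback : ∀ y : X, x₀ + (δ / 2) • (δ / 2)⁻¹ • (y - x₀) = y := fun y => by
    rw [smul_inv_smul₀ ht0]; abel
  have hinner : ContDiff ℝ ∞ (fun y : X => (δ / 2, (δ / 2)⁻¹ • (y - x₀))) := by fun_prop
  refine ⟨fun y => Y (δ / 2, (δ / 2)⁻¹ • (y - x₀)), δ / 2 * δ, by positivity, ?_, ?_, ?_, ?_⟩
  · intro y hy
    have := (hYd _ htI _ (hmap y hy)).1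
    rwa [hback] at this
  · exact hY.comp hinner.contDiffOn fun y hy => ⟨htI, hmap y hy⟩
  · have h0 : (0 : X) ∈ Metric.ball (0 : X) δ := Metric.mem_ball_self hδ
    have hd : ∀ s ∈ Set.Ioo (-δ) δ, HasDerivAt (fun s => Y (s, 0)) 0 s := fun s hs => by
      simpa using (hYd s hs 0 h0).2
    have := (convex_Ioo (-δ) δ).is_const_of_fderivWithin_eq_zero (𝕜 := ℝ)
      (f := fun s => Y (s, 0))
      (fun s hs => (hd s hs).differentiableAt.differentiableWithinAt)
      (fun s hs => by
        rw [fderivWithin_of_isOpen isOpen_Ioo hs, (hd s hs).hasFDerivAt.fderiv]; ext; simp)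
      htI (show (0 : ℝ) ∈ Set.Ioo (-δ) δ from ⟨by linarith, hδ⟩)
    simp only [sub_self, smul_zero]
    rw [this, hY0 0 h0]
  · intro y hy z
    have hp : (δ / 2, (δ / 2)⁻¹ • (y - x₀)) ∈ O := ⟨htI, hmap y hy⟩
    have c1 : HasFDerivAt (fun y : X => (δ / 2, (δ / 2)⁻¹ • (y - x₀)))
        ((0 : X →L[ℝ] ℝ).prod ((δ / 2)⁻¹ • ContinuousLinearMap.id ℝ X)) y :=
      (hasFDerivAt_const _ _).prodMk (((hasFDerivAt_id y).sub_const x₀).const_smul _)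
    have c2 := ((hYf _ hp).comp y c1).fderiv
    change fderiv ℝ (Y ∘ fun y : X => (δ / 2, (δ / 2)⁻¹ • (y - x₀))) y z = _
    rw [c2]
    have := hspace _ ht _ (hmap y hy) ((δ / 2)⁻¹ • z)
    rw [hback, map_smul, _root_.smul_apply, smul_inv_smul₀ ht0] at this
    rw [← this]
    rfl

end Frobenius

/-! ### Total differential systems in coordinates. -/

section LinearSystem

variable {n : ℕ}

theorem Eu.sum_smul_single (w : Eu n) : ∑ i, w i • EuclideanSpace.single i (1 : ℝ) = w := by
  ext j
  simp [Pi.single_apply]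

theorem contDiffOn_clm_comp {X P Q : Type} [NormedAddCommGroup X] [NormedSpace ℝ X]
    [NormedAddCommGroup P] [NormedSpace ℝ P] [NormedAddCommGroup Q] [NormedSpace ℝ Q]
    (T : P →L[ℝ] Q) {F : X → P} {S : Set X} (hF : ContDiffOn ℝ ∞ F S) :
    ContDiffOn ℝ ∞ (fun y => T (F y)) S :=
  T.contDiff.comp_contDiffOn hF

theorem hasFDerivAt_clm_comp {X P Q : Type} [NormedAddCommGroup X] [NormedSpace ℝ X]
    [NormedAddCommGroup P] [NormedSpace ℝ P] [NormedAddCommGroup Q] [NormedSpace ℝ Q]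
    (T : P →L[ℝ] Q) {F : X → P} {F' : X →L[ℝ] P} {y : X} (hF : HasFDerivAt F F' y) :
    HasFDerivAt (fun y => T (F y)) (T.comp F') y :=
  T.hasFDerivAt.comp y hF

/-- Local solvability of the integrable linear system `∂_i Y = B_i Y`. -/
theorem exists_linear_system_solution {V : Type} [NormedAddCommGroup V] [NormedSpace ℝ V]
    [FiniteDimensional ℝ V] {B : Fin n → Eu n → V →L[ℝ] V} {S : Set (Eu n)} (hS : IsOpen S)
    (hB : ∀ i, ContDiffOn ℝ ∞ (B i) S)
    (hint : ∀ y ∈ S, ∀ i j : Fin n, ∀ Y : V,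
      fderiv ℝ (B j) y (EuclideanSpace.single i 1) Y + B j y (B i y Y)
        = fderiv ℝ (B i) y (EuclideanSpace.single j 1) Y + B i y (B j y Y))
    {x₀ : Eu n} (hx₀ : x₀ ∈ S) (Y₀ : V) :
    ∃ (Y : Eu n → V) (r : ℝ), 0 < r ∧ Metric.ball x₀ r ⊆ S ∧ ContDiffOn ℝ ∞ Y (Metric.ball x₀ r) ∧
      Y x₀ = Y₀ ∧ ∀ y ∈ Metric.ball x₀ r, ∀ i,
        fderiv ℝ Y y (EuclideanSpace.single i 1) = B i y (Y y) := by
  -- T i sends an operator b to w ↦ w_i b, so the coefficient operators B_i assemble into one form A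
  -- = ∑ B_i dx_i.
  let T : Fin n → (V →L[ℝ] V) →L[ℝ] (Eu n →L[ℝ] V →L[ℝ] V) := fun i =>
    ContinuousLinearMap.smulRightL ℝ (Eu n) (V →L[ℝ] V) (EuclideanSpace.proj i)
  have hT : ∀ i b w Y, T i b w Y = w i • b Y := fun _ _ _ _ => rfl
  let A : Eu n → Eu n →L[ℝ] V →L[ℝ] V := fun y => ∑ i, T i (B i y)
  have hAapp : ∀ y w Y, A y w Y = ∑ i, w i • B i y Y := by
    intro y w Y
    simp only [A, _root_.sum_apply, hT]
  have hA : ContDiffOn ℝ ∞ A S :=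
    ContDiffOn.sum fun i _ => contDiffOn_clm_comp (P := V →L[ℝ] V) (Q := Eu n →L[ℝ] V →L[ℝ] V)
      (T i) (hB i)
  have hA' : ∀ y ∈ S, ∀ w z Y, fderiv ℝ A y w z Y
      = ∑ j, ∑ i, w i • z j • fderiv ℝ (B j) y (EuclideanSpace.single i 1) Y := by
    intro y hy w z Y
    have hBd : ∀ i, HasFDerivAt (B i) (fderiv ℝ (B i) y) y := fun i =>
      (((hB i).contDiffAt (hS.mem_nhds hy)).differentiableAt (by simp)).hasFDerivAt
    have h1 : HasFDerivAt A (∑ i, (T i).comp (fderiv ℝ (B i) y)) y :=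
      HasFDerivAt.fun_sum fun i _ => hasFDerivAt_clm_comp (P := V →L[ℝ] V)
        (Q := Eu n →L[ℝ] V →L[ℝ] V) (T i) (hBd i)
    rw [h1.fderiv]
    simp only [_root_.sum_apply, ContinuousLinearMap.comp_apply, hT]
    refine Finset.sum_congr rfl fun j _ => ?_
    conv_lhs => rw [← Eu.sum_smul_single w]
    simp only [map_sum, map_smul, _root_.sum_apply, _root_.smul_apply,
      Finset.smul_sum]
    exact Finset.sum_congr rfl fun i _ => smul_comm _ _ _
  have hAA : ∀ y w z Y, A y z (A y w Y) = ∑ j, ∑ i, w i • z j • B j y (B i y Y) := by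
    intro y w z Y
    rw [hAapp, hAapp]
    simp only [map_sum, map_smul, Finset.smul_sum]
    exact Finset.sum_congr rfl fun j _ => Finset.sum_congr rfl fun i _ => smul_comm _ _ _
  obtain ⟨Y, r, hr, hrS, hY, hY0, hYd⟩ := exists_total_solution hS hA (by
    intro y hy w z Y
    rw [hA' y hy, hA' y hy, hAA, hAA, ← Finset.sum_add_distrib]
    conv_rhs => rw [Finset.sum_comm, Finset.sum_comm (f := fun j i => z i • w j • B j y (B i y Y)),
      ← Finset.sum_add_distrib]
    refine Finset.sum_congr rfl fun j _ => ?_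
    rw [← Finset.sum_add_distrib, ← Finset.sum_add_distrib]
    refine Finset.sum_congr rfl fun i _ => ?_
    rw [← smul_add, ← smul_add, hint y hy i j, smul_comm, smul_add, smul_add])
    hx₀ Y₀
  refine ⟨Y, r, hr, hrS, hY, hY0, fun y hy i => ?_⟩
  rw [hYd y hy, hAapp]
  simp [PiLp.single_apply]

/-- Local solvability of the integrable linear system `∂_i Y_α = ∑ c_iαβ Y_β`. -/
theorem exists_linear_system_solution_coord {ι : Type} [Fintype ι] [DecidableEq ι]
    {c : Fin n → ι → ι → Eu n → ℝ} {S : Set (Eu n)} (hS : IsOpen S)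
    (hc : ∀ i α β, ContDiffOn ℝ ∞ (c i α β) S)
    (hint : ∀ y ∈ S, ∀ i j α β, pd i (c j α β) y + ∑ γ, c j α γ y * c i γ β y
      = pd j (c i α β) y + ∑ γ, c i α γ y * c j γ β y)
    {x₀ : Eu n} (hx₀ : x₀ ∈ S) (Y₀ : ι → ℝ) :
    ∃ (Y : ι → Eu n → ℝ) (r : ℝ), 0 < r ∧ Metric.ball x₀ r ⊆ S ∧
      (∀ α, ContDiffOn ℝ ∞ (Y α) (Metric.ball x₀ r)) ∧ (∀ α, Y α x₀ = Y₀ α) ∧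
      ∀ y ∈ Metric.ball x₀ r, ∀ i α, pd i (Y α) y = ∑ β, c i α β y * Y β y := by
  -- The matrix units, used to assemble the scalar coefficients into operators.
  let T : ι → ι → EuclideanSpace ℝ ι →L[ℝ] EuclideanSpace ℝ ι := fun α β =>
    (EuclideanSpace.proj β : EuclideanSpace ℝ ι →L[ℝ] ℝ).smulRight (EuclideanSpace.single α (1 : ℝ))
  have hT : ∀ (d : ι → ι → ℝ) (Y : EuclideanSpace ℝ ι) (α : ι),
      (∑ α, ∑ β, d α β • T α β) Y α = ∑ β, d α β * Y β := by
    intro d Y α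
    have h1 : ∀ α β, (d α β • T α β) Y = (d α β * Y β) • EuclideanSpace.single α (1 : ℝ) :=
      fun α β => by rw [mul_smul]; rfl
    simp only [_root_.sum_apply, h1, ← Finset.sum_smul]
    simp [Pi.single_apply]
  let B : Fin n → Eu n → EuclideanSpace ℝ ι →L[ℝ] EuclideanSpace ℝ ι := fun i y =>
    ∑ α, ∑ β, c i α β y • T α β
  have hB : ∀ i, ContDiffOn ℝ ∞ (B i) S := fun i =>
    ContDiffOn.sum fun α _ => ContDiffOn.sum fun β _ => (hc i α β).smul contDiffOn_const
  have hB' : ∀ y ∈ S, ∀ i j, fderiv ℝ (B j) y (EuclideanSpace.single i 1)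
      = ∑ α, ∑ β, pd i (c j α β) y • T α β := by
    intro y hy i j
    have h1 : HasFDerivAt (B j) (∑ α, ∑ β, (fderiv ℝ (c j α β) y).smulRight (T α β)) y :=
      HasFDerivAt.fun_sum fun α _ => HasFDerivAt.fun_sum fun β _ =>
        HasFDerivAt.smul_const (F := EuclideanSpace ℝ ι →L[ℝ] EuclideanSpace ℝ ι)
          (((hc j α β).contDiffAt (hS.mem_nhds hy)).differentiableAt (by simp)).hasFDerivAt
          (T α β)
    rw [h1.fderiv]
    simp only [_root_.sum_apply, ContinuousLinearMap.smulRight_apply]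
    rfl
  obtain ⟨Y, r, hr, hrS, hY, hY0, hYd⟩ := exists_linear_system_solution hS hB (by
    intro y hy i j Y
    ext α
    have h2 : ∀ i j, B j y (B i y Y) α = ∑ β, (∑ γ, c j α γ y * c i γ β y) * Y β := by
      intro i j
      rw [hT]
      simp only [B, hT, Finset.mul_sum, Finset.sum_mul]
      rw [Finset.sum_comm]
      exact Finset.sum_congr rfl fun _ _ => Finset.sum_congr rfl fun _ _ => by ring
    rw [PiLp.add_apply, PiLp.add_apply, h2, h2, hB' y hy, hB' y hy, hT, hT,
      ← Finset.sum_add_distrib, ← Finset.sum_add_distrib]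
    refine Finset.sum_congr rfl fun β _ => ?_
    rw [← add_mul, ← add_mul, hint y hy]) hx₀ (WithLp.toLp 2 Y₀)
  refine ⟨fun α y => Y y α, r, hr, hrS, fun α => ?_, fun α => by simp only [hY0],
    fun y hy i α => ?_⟩
  · exact (EuclideanSpace.proj α : EuclideanSpace ℝ ι →L[ℝ] ℝ).contDiff.comp_contDiffOn hY
  · have h1 : HasFDerivAt Y (fderiv ℝ Y y) y :=
      ((hY.contDiffAt (Metric.isOpen_ball.mem_nhds hy)).differentiableAt (by simp)).hasFDerivAt
    have h2 := ((EuclideanSpace.proj α : EuclideanSpace ℝ ι →L[ℝ] ℝ).hasFDerivAt.comp y h1).fderiv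
    change fderiv ℝ ((EuclideanSpace.proj α : EuclideanSpace ℝ ι →L[ℝ] ℝ) ∘ Y) y _ = _
    rw [h2, ContinuousLinearMap.comp_apply, hYd y hy]
    exact hT _ _ _

end LinearSystem

/-! ### The equation Hess u = -κ u g on a space form. -/

section Gradient

variable {n : ℕ}

/-- The component `∇^l F` of the gradient in coordinates. -/
def gradVec (G : Eu n → Matrix (Fin n) (Fin n) ℝ) (F : Eu n → ℝ) (l : Fin n) (y : Eu n) : ℝ :=
  ∑ m, (G y)⁻¹ l m * pd m F y

/-- The mixed components of the Hessian. -/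
def hessianUp (G : Eu n → Matrix (Fin n) (Fin n) ℝ) (F : Eu n → ℝ) (i l : Fin n) (y : Eu n) : ℝ :=
  ∑ m, (G y)⁻¹ l m * hessian G F i m y

/-- `|dF|²` in coordinates. -/
def gradSq (G : Eu n → Matrix (Fin n) (Fin n) ℝ) (F : Eu n → ℝ) (y : Eu n) : ℝ :=
  ∑ m, gradVec G F m y * pd m F y

namespace IsMetricOn

variable {G : Eu n → Matrix (Fin n) (Fin n) ℝ} {S : Set (Eu n)} {y : Eu n} {F : Eu n → ℝ}

theorem contDiffOn_gradVec (hG : IsMetricOn G S) (hS : IsOpen S) (hF : ContDiffOn ℝ ∞ F S)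
    (l : Fin n) : ContDiffOn ℝ ∞ (gradVec G F l) S :=
  ContDiffOn.sum fun m _ => (contDiffOn_inv hG.1 hG.2 l m).mul (contDiffOn_pd hS hF m)

theorem sum_mul_gradVec (hG : IsMetricOn G S) (hy : y ∈ S) (i : Fin n) :
    ∑ l, G y i l * gradVec G F l y = pd i F y := by
  simp only [gradVec, Finset.mul_sum, ← mul_assoc]
  rw [Finset.sum_comm]
  simp only [← Finset.sum_mul, hG.sum_mul_inv hy]
  simp

theorem eq_sum_inv_mul (hG : IsMetricOn G S) (hy : y ∈ S) {a b : Fin n → ℝ}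
    (h : ∀ i, ∑ l, G y i l * a l = b i) (l : Fin n) : a l = ∑ m, (G y)⁻¹ l m * b m := by
  simp only [← h, Finset.mul_sum, ← mul_assoc]
  rw [Finset.sum_comm]
  simp only [← Finset.sum_mul, hG.sum_inv_mul hy]
  simp

/-- The covariant derivative of the gradient is the Hessian. -/
theorem pd_gradVec (hG : IsMetricOn G S) (hS : IsOpen S) (hF : ContDiffOn ℝ ∞ F S) (hy : y ∈ S)
    (i l : Fin n) : pd i (gradVec G F l) y
      = hessianUp G F i l y - ∑ m, christoffel G l i m y * gradVec G F m y := by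
  rw [eq_sub_iff_add_eq, hessianUp]
  refine hG.eq_sum_inv_mul hy (a := fun l => pd i (gradVec G F l) y
    + ∑ m, christoffel G l i m y * gradVec G F m y) (fun a => ?_) l
  have dv : ∀ l, DifferentiableAt ℝ (gradVec G F l) y := fun l =>
    ((hG.contDiffOn_gradVec hS hF l).contDiffAt (hS.mem_nhds hy)).differentiableAt (by simp)
  have h1 : pd i (fun z => ∑ l, G z a l * gradVec G F l z) y = pd i (pd a F) y :=
    pd_congr hS hy fun z hz => hG.sum_mul_gradVec hz a
  rw [pd_sum fun l _ => (hG.differentiableAt hS hy a l).fun_mul (dv l),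
    Finset.sum_congr rfl fun l _ => pd_mul (hG.differentiableAt hS hy a l) (dv l),
    Finset.sum_add_distrib] at h1
  have h2 : ∑ l, gradVec G F l y * pd i (fun z => G z a l) y
      = ∑ l, G y a l * ∑ m, christoffel G l i m y * gradVec G F m y
        + ∑ m, christoffel G m i a y * pd m F y := by
    simp only [hG.pd_eq hS hy, mul_add, Finset.sum_add_distrib, Finset.mul_sum]
    congr 1
    · rw [Finset.sum_comm]
      exact Finset.sum_congr rfl fun _ _ => Finset.sum_congr rfl fun _ _ => by ring
    · rw [Finset.sum_comm]
      refine Finset.sum_congr rfl fun m _ => ?_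
      rw [← hG.sum_mul_gradVec hy m, Finset.mul_sum]
      exact Finset.sum_congr rfl fun l _ => by rw [hG.symm hy l m]; ring
  simp only [mul_add, Finset.sum_add_distrib]
  rw [hessian, ← h1, h2]
  ring

/-- Differentiating |dF|² produces Hessian terms twice; the Christoffel terms from the gradient and
from dF cancel. It provides the first integral used for the horospherical functions. -/
theorem pd_gradSq (hG : IsMetricOn G S) (hS : IsOpen S) (hF : ContDiffOn ℝ ∞ F S) (hy : y ∈ S)
    (k : Fin n) : pd k (gradSq G F) y = 2 * ∑ m, hessian G F k m y * gradVec G F m y := by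
  have dv : ∀ l, DifferentiableAt ℝ (gradVec G F l) y := fun l =>
    ((hG.contDiffOn_gradVec hS hF l).contDiffAt (hS.mem_nhds hy)).differentiableAt (by simp)
  have dp : ∀ l, DifferentiableAt ℝ (pd l F) y := fun l =>
    ((contDiffOn_pd hS hF l).contDiffAt (hS.mem_nhds hy)).differentiableAt (by simp)
  have h1 : ∑ m, pd m F y * hessianUp G F k m y = ∑ m, hessian G F k m y * gradVec G F m y := by
    simp only [hessianUp, gradVec, Finset.mul_sum]
    rw [Finset.sum_comm]
    exact Finset.sum_congr rfl fun a _ => Finset.sum_congr rfl fun b _ => by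
      rw [hG.inv_symm hy a b]; ring
  have h2 : ∀ m, pd k (pd m F) y = hessian G F k m y + ∑ a, christoffel G a k m y * pd a F y :=
    fun m => by rw [hessian, sub_add_cancel]
  unfold gradSq
  rw [pd_sum fun m _ => (dv m).fun_mul (dp m),
    Finset.sum_congr rfl fun m _ => pd_mul (dv m) (dp m), two_mul]
  nth_rewrite 2 [← h1]
  simp only [hG.pd_gradVec hS hF hy, h2, mul_add, mul_sub, Finset.sum_add_distrib,
    Finset.sum_sub_distrib, Finset.mul_sum]
  have h3 : ∑ a, ∑ b, gradVec G F a y * (christoffel G b k a y * pd b F y)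
      = ∑ a, ∑ b, pd a F y * (christoffel G a k b y * gradVec G F b y) := by
    rw [Finset.sum_comm]
    exact Finset.sum_congr rfl fun a _ => Finset.sum_congr rfl fun b _ => by ring
  have h4 : ∑ m, gradVec G F m y * hessian G F k m y = ∑ m, hessian G F k m y * gradVec G F m y :=
    Finset.sum_congr rfl fun m _ => mul_comm _ _
  rw [h3, h4]
  ring

end IsMetricOn

/-- A space form carries, locally, the solutions of `Hess u = -κ u g` with arbitrary initial
data. -/
theorem IsSpaceForm.exists_hessian_eq {G : Eu n → Matrix (Fin n) (Fin n) ℝ} {S : Set (Eu n)}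
    {κ : ℝ} (h : IsSpaceForm G S κ) (hS : IsOpen S) (hG : IsMetricOn G S) {x₀ : Eu n}
    (hx₀ : x₀ ∈ S) (u₀ : ℝ) (p₀ : Fin n → ℝ) :
    ∃ (u : Eu n → ℝ) (r : ℝ), 0 < r ∧ Metric.ball x₀ r ⊆ S ∧
      ContDiffOn ℝ ∞ u (Metric.ball x₀ r) ∧ u x₀ = u₀ ∧ (∀ i, pd i u x₀ = p₀ i) ∧
      ∀ y ∈ Metric.ball x₀ r, ∀ i j, hessian G u i j y = -κ * u y * G y i j := by
  -- The unknowns are u (index `none`) and its partial derivatives p_j (index `some j`), with ∂_i u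
  -- = p_i and ∂_i p_j = -κ g_ij u + Γ^k_ij p_k.
  let c : Fin n → Option (Fin n) → Option (Fin n) → Eu n → ℝ := fun i α β =>
    match α, β with
    | none, none => fun _ => 0
    | none, some k => fun _ => if i = k then 1 else 0
    | some j, none => fun y => -κ * G y i j
    | some j, some k => christoffel G k i j
  obtain ⟨Y, r, hr, hrS, hY, hY0, hYd⟩ := exists_linear_system_solution_coord (c := c) hS (by
    rintro i (_ | j) (_ | k)
    · exact contDiffOn_const
    · exact contDiffOn_const
    · exact contDiffOn_const.mul (hG.1 i j)
    · exact contDiffOn_christoffel hS hG k i j) (by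
    -- The four blocks of the integrability condition are the symmetry of g, the symmetry of Γ,
    -- metric compatibility, and the space form identity.
    rintro y hy i j (_ | a) (_ | k)
    · simp only [c, pd_const, Fintype.sum_option]
      simp [hG.symm hy i j]
    · simp only [c, pd_const, Fintype.sum_option]
      simp [hG.christoffel_symm hS hy k i j]
    · have h1 : ∀ i j, pd i (fun z => -κ * G z j a) y = -κ * pd i (fun z => G z j a) y := by
        intro i j
        rw [pd_mul (differentiableAt_const _) (hG.differentiableAt hS hy j a), pd_const]
        ring
      have h2 : ∀ i j, ∑ m, christoffel G m j a y * (-κ * G y i m)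
          = -κ * ∑ m, G y i m * christoffel G m j a y := by
        intro i j
        rw [Finset.mul_sum]
        exact Finset.sum_congr rfl fun m _ => by ring
      simp only [c, Fintype.sum_option, h1, mul_zero, zero_add, h2, hG.pd_eq hS hy]
      rw [Finset.sum_congr rfl fun m _ =>
        congrArg (G y a m * ·) (hG.christoffel_symm hS hy m i j)]
      ring
    · have h3 := h y hy i j a k
      simp only [riemannUp, Finset.sum_sub_distrib] at h3
      have h4 : ∀ i j : Fin n, (-κ * G y j a) * (if i = k then (1 : ℝ) else 0)
          = -κ * if i = k then G y j a else 0 := fun i j => by split_ifs <;> simp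
      simp only [c, Fintype.sum_option, h4]
      linarith) hx₀ (fun α => α.elim u₀ p₀)
  have hp : ∀ y ∈ Metric.ball x₀ r, ∀ i, pd i (Y none) y = Y (some i) y := by
    intro y hy i
    rw [hYd y hy i none, Fintype.sum_option]
    simp [c]
  refine ⟨Y none, r, hr, hrS, hY none, hY0 none, fun i => ?_, fun y hy i j => ?_⟩
  · rw [hp x₀ (Metric.mem_ball_self hr), hY0]
    rfl
  · rw [hessian, pd_congr Metric.isOpen_ball hy fun z hz => hp z hz j, hYd y hy i (some j),
      Fintype.sum_option]
    simp only [c, hp y hy]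
    ring

/-- A space form of nonpositive curvature carries, locally, a positive function with
`Hess u = -κ u g` and `|du|² = -κ u²`. -/
theorem IsSpaceForm.exists_horospherical {G : Eu (n + 1) → Matrix (Fin (n + 1)) (Fin (n + 1)) ℝ}
    {S : Set (Eu (n + 1))} {κ : ℝ} (h : IsSpaceForm G S κ) (hS : IsOpen S) (hG : IsMetricOn G S)
    (hκ : κ ≤ 0) {x₀ : Eu (n + 1)} (hx₀ : x₀ ∈ S) :
    ∃ (u : Eu (n + 1) → ℝ) (r : ℝ), 0 < r ∧ Metric.ball x₀ r ⊆ S ∧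
      ContDiffOn ℝ ∞ u (Metric.ball x₀ r) ∧ ∀ y ∈ Metric.ball x₀ r, 0 < u y ∧
        (∀ i j, hessian G u i j y = -κ * u y * G y i j) ∧ gradSq G u y = -κ * u y ^ 2 := by
  have hpos : 0 < (G x₀)⁻¹ 0 0 := (hG.2 x₀ hx₀).inv.diag_pos
  -- The initial data are u = 1 and du along one coordinate, with length chosen so that |du|² = -κ
  -- at x₀; this is where κ ≤ 0 is needed.
  obtain ⟨u, r, hr, hrS, hu, hu0, hp0, hH⟩ := h.exists_hessian_eq hS hG hx₀ 1
    (fun i => if i = 0 then √(-κ / (G x₀)⁻¹ 0 0) else 0)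
  have hGr : IsMetricOn G (Metric.ball x₀ r) :=
    ⟨fun i j => (hG.1 i j).mono hrS, fun y hy => hG.2 y (hrS hy)⟩
  have hud : ∀ y ∈ Metric.ball x₀ r, DifferentiableAt ℝ u y := fun y hy =>
    (hu.contDiffAt (Metric.isOpen_ball.mem_nhds hy)).differentiableAt (by simp)
  have hsq : ContDiffOn ℝ ∞ (gradSq G u) (Metric.ball x₀ r) := ContDiffOn.sum fun m _ =>
    (hGr.contDiffOn_gradVec Metric.isOpen_ball hu m).mul (contDiffOn_pd Metric.isOpen_ball hu m)
  have hN : ContDiffOn ℝ ∞ (fun y => gradSq G u y + κ * (u y * u y)) (Metric.ball x₀ r) :=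
    hsq.add (contDiffOn_const.mul (hu.mul hu))
  -- |du|² + κ u² is a first integral: by the Hessian equation its derivative is -2κ u du + 2κ u du
  -- = 0.
  have hconst : ∀ y ∈ Metric.ball x₀ r, gradSq G u y + κ * (u y * u y) = 0 := by
    intro y hy
    have h0 : gradSq G u x₀ + κ * (u x₀ * u x₀) = 0 := by
      simp only [gradSq, gradVec, hp0, hu0]
      simp only [mul_ite, mul_zero, Finset.sum_ite_eq', Finset.mem_univ, if_true]
      rw [mul_assoc, Real.mul_self_sqrt (div_nonneg (by linarith) hpos.le)]
      field_simp
      ring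
    rw [← h0]
    refine (convex_ball x₀ r).is_const_of_fderivWithin_eq_zero (𝕜 := ℝ)
      (hN.differentiableOn (by simp)) (fun z hz => ?_) hy (Metric.mem_ball_self hr)
    rw [fderivWithin_of_isOpen Metric.isOpen_ball hz]
    have hk : ∀ k, pd k (fun y => gradSq G u y + κ * (u y * u y)) z = 0 := by
      intro k
      rw [pd_add ((hsq.contDiffAt (Metric.isOpen_ball.mem_nhds hz)).differentiableAt (by simp))
        ((differentiableAt_const _).fun_mul ((hud z hz).fun_mul (hud z hz))),
        pd_mul (differentiableAt_const _) ((hud z hz).fun_mul (hud z hz)), pd_const,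
        pd_mul (hud z hz) (hud z hz), hGr.pd_gradSq Metric.isOpen_ball hu hz]
      simp only [hH z hz, mul_assoc, ← Finset.mul_sum]
      rw [hGr.sum_mul_gradVec hz]
      ring
    ext w
    rw [← Eu.sum_smul_single w]
    simp only [map_sum, map_smul]
    simp only [pd] at hk
    simp [hk]
  have hupos : ∀ᶠ y in 𝓝 x₀, 0 < u y :=
    (hud x₀ (Metric.mem_ball_self hr)).continuousAt.eventually (lt_mem_nhds (by rw [hu0]; norm_num))
  obtain ⟨ε, hε, hεu⟩ := Metric.eventually_nhds_iff_ball.1 hupos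
  have hsub : Metric.ball x₀ (min r ε) ⊆ Metric.ball x₀ r :=
    Metric.ball_subset_ball (min_le_left _ _)
  refine ⟨u, min r ε, lt_min hr hε, hsub.trans hrS, hu.mono hsub, fun y hy => ⟨?_, ?_, ?_⟩⟩
  · exact hεu y (Metric.ball_subset_ball (min_le_right _ _) hy)
  · exact hH y (hsub hy)
  · linarith [hconst y (hsub hy), sq (u y)]

end Gradient

/-! ### Curvature under a conformal change of metric. -/

section Conformal

variable {n : ℕ} {G : Eu n → Matrix (Fin n) (Fin n) ℝ} {S : Set (Eu n)} {y : Eu n}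
  {φ : Eu n → ℝ}

theorem riemannUp_congr {G' : Eu n → Matrix (Fin n) (Fin n) ℝ} (hS : IsOpen S) (hy : y ∈ S)
    (h : ∀ z ∈ S, ∀ k i j, christoffel G' k i j z = christoffel G k i j z) (i j k l : Fin n) :
    riemannUp G' i j k l y = riemannUp G i j k l y := by
  simp only [riemannUp, h y hy, pd_congr hS hy fun z hz => h z hz l j k,
    pd_congr hS hy fun z hz => h z hz l i k]

theorem christoffel_congr {G' : Eu n → Matrix (Fin n) (Fin n) ℝ} (hS : IsOpen S) (hy : y ∈ S)
    (h : ∀ z ∈ S, G' z = G z) (k i j : Fin n) :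
    christoffel G' k i j y = christoffel G k i j y := by
  have : ∀ a b c, pd a (fun z => G' z b c) y = pd a (fun z => G z b c) y := fun a b c =>
    pd_congr hS hy fun z hz => by rw [h z hz]
  simp only [christoffel, this, h y hy]

theorem IsFlatOn.congr {G' : Eu n → Matrix (Fin n) (Fin n) ℝ} (hS : IsOpen S)
    (h : ∀ z ∈ S, G' z = G z) (hG : IsFlatOn G S) : IsFlatOn G' S := by
  intro y hy i j k l
  rw [← hG y hy i j k l]
  simp only [riemann, h y hy, riemannUp_congr hS hy fun z hz => christoffel_congr hS hz h]

theorem hessian_symm (hS : IsOpen S) (hG : IsMetricOn G S) (hφ : ContDiffOn ℝ ∞ φ S)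
    (hy : y ∈ S) (i j : Fin n) : hessian G φ i j y = hessian G φ j i y := by
  rw [hessian, hessian, pd_comm hS hφ hy,
    Finset.sum_congr rfl fun k _ => by rw [hG.christoffel_symm hS hy k i j]]

/-- The difference of the Levi-Civita connections of `e^{2φ} g` and `g`. -/
def conformalDiff (G : Eu n → Matrix (Fin n) (Fin n) ℝ) (φ : Eu n → ℝ) (l i j : Fin n)
    (y : Eu n) : ℝ :=
  (if l = i then pd j φ y else 0) + (if l = j then pd i φ y else 0) - G y i j * gradVec G φ l y

namespace IsMetricOn

/-- The exponential factors of the metric and its inverse cancel, leaving the terms in which the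
derivative falls on the factor. -/
theorem christoffel_conformal (hG : IsMetricOn G S) (hS : IsOpen S) (hφ : ContDiffOn ℝ ∞ φ S)
    (hy : y ∈ S) (l i j : Fin n) :
    christoffel (fun z => Real.exp (2 * φ z) • G z) l i j y
      = christoffel G l i j y + conformalDiff G φ l i j y := by
  have dφ : DifferentiableAt ℝ φ y :=
    (hφ.contDiffAt (hS.mem_nhds hy)).differentiableAt (by simp)
  have hexp : ∀ z, HasDerivAt (fun t => Real.exp (2 * t)) (Real.exp (2 * z) * (2 * 1)) z := fun z =>
    ((hasDerivAt_id z).const_mul 2).exp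
  have dexp : DifferentiableAt ℝ (fun z => Real.exp (2 * φ z)) y := (dφ.const_mul 2).exp
  have hpd : ∀ a b c, pd a (fun z => (Real.exp (2 * φ z) • G z) b c) y
      = Real.exp (2 * φ y) * (pd a (fun z => G z b c) y + 2 * pd a φ y * G y b c) := by
    intro a b c
    simp only [Matrix.smul_apply, smul_eq_mul]
    rw [pd_mul dexp (hG.differentiableAt hS hy b c),
      pd_comp (θ := fun t => Real.exp (2 * t)) (hexp _) dφ]
    ring
  have hinv : (Real.exp (2 * φ y) • G y)⁻¹ = (Real.exp (2 * φ y))⁻¹ • (G y)⁻¹ := by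
    refine Matrix.inv_eq_left_inv ?_
    rw [smul_mul_smul_comm, inv_mul_cancel₀ (Real.exp_ne_zero _),
      Matrix.nonsing_inv_mul _ (hG.isUnit_det hy), one_smul]
  have hE := Real.exp_ne_zero (2 * φ y)
  have hsplit : ∀ m, (Real.exp (2 * φ y))⁻¹ * (G y)⁻¹ l m
      * (Real.exp (2 * φ y) * (pd i (fun z => G z m j) y + 2 * pd i φ y * G y m j)
        + Real.exp (2 * φ y) * (pd j (fun z => G z m i) y + 2 * pd j φ y * G y m i)
        - Real.exp (2 * φ y) * (pd m (fun z => G z i j) y + 2 * pd m φ y * G y i j))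
      = (G y)⁻¹ l m * (pd i (fun z => G z m j) y + pd j (fun z => G z m i) y
          - pd m (fun z => G z i j) y)
        + 2 * pd i φ y * ((G y)⁻¹ l m * G y m j) + 2 * pd j φ y * ((G y)⁻¹ l m * G y m i)
        - 2 * G y i j * ((G y)⁻¹ l m * pd m φ y) := by
    intro m
    field_simp
    ring
  simp only [christoffel, hpd, hinv]
  simp only [Matrix.smul_apply, smul_eq_mul, hsplit, Finset.sum_add_distrib,
    Finset.sum_sub_distrib, ← Finset.mul_sum, hG.sum_inv_mul hy]
  rw [conformalDiff, gradVec]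
  split_ifs <;> ring

/-- The metric is parallel, so the covariant derivative of the difference tensor is the same
expression with dφ replaced by Hess φ; here it is solved for the partial derivative. -/
theorem pd_conformalDiff (hG : IsMetricOn G S) (hS : IsOpen S) (hφ : ContDiffOn ℝ ∞ φ S)
    (hy : y ∈ S) (i l j k : Fin n) :
    pd i (conformalDiff G φ l j k) y
      = (if l = j then hessian G φ i k y else 0) + (if l = k then hessian G φ i j y else 0)
        - G y j k * hessianUp G φ i l y
        - ∑ m, christoffel G l i m y * conformalDiff G φ m j k y
        + ∑ m, christoffel G m i j y * conformalDiff G φ l m k y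
        + ∑ m, christoffel G m i k y * conformalDiff G φ l j m y := by
  have dv : ∀ l, DifferentiableAt ℝ (gradVec G φ l) y := fun l =>
    ((hG.contDiffOn_gradVec hS hφ l).contDiffAt (hS.mem_nhds hy)).differentiableAt (by simp)
  have dp : ∀ l, DifferentiableAt ℝ (pd l φ) y := fun l =>
    ((contDiffOn_pd hS hφ l).contDiffAt (hS.mem_nhds hy)).differentiableAt (by simp)
  have dite : ∀ (p : Prop) [Decidable p] (a : Fin n),
      DifferentiableAt ℝ (fun z => if p then pd a φ z else 0) y := by
    intro p _ a
    split_ifs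
    · exact dp a
    · exact differentiableAt_const _
  have pite : ∀ (p : Prop) [Decidable p] (a : Fin n),
      pd i (fun z => if p then pd a φ z else 0) y = if p then pd i (pd a φ) y else 0 := by
    intro p _ a
    split_ifs
    · rfl
    · exact pd_const _ _ _
  have h2 : ∀ a b, pd a (pd b φ) y = hessian G φ a b y + ∑ m, christoffel G m a b y * pd m φ y :=
    fun a b => by rw [hessian, sub_add_cancel]
  have s1 : ∑ m, christoffel G l i m y * conformalDiff G φ m j k y
      = christoffel G l i j y * pd k φ y + christoffel G l i k y * pd j φ y
        - G y j k * ∑ m, christoffel G l i m y * gradVec G φ m y := by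
    simp only [conformalDiff, mul_add, mul_sub, Finset.sum_add_distrib, Finset.sum_sub_distrib,
      mul_ite, mul_zero, Finset.sum_ite_eq', Finset.mem_univ, if_true, Finset.mul_sum]
    congr 1
    exact Finset.sum_congr rfl fun m _ => by ring
  have s2 : ∀ j k, ∑ m, christoffel G m i j y * conformalDiff G φ l m k y
      = christoffel G l i j y * pd k φ y
        + (if l = k then ∑ m, christoffel G m i j y * pd m φ y else 0)
        - (∑ m, G y k m * christoffel G m i j y) * gradVec G φ l y := by
    intro j k
    simp only [conformalDiff, mul_add, mul_sub, Finset.sum_add_distrib, Finset.sum_sub_distrib,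
      mul_ite, mul_zero, Finset.sum_ite_eq, Finset.mem_univ, if_true, Finset.sum_mul]
    congr 1
    · split_ifs <;> simp
    · exact Finset.sum_congr rfl fun m _ => by rw [hG.symm hy k m]; ring
  have hc : ∀ l j m, conformalDiff G φ l j m y = conformalDiff G φ l m j y := by
    intro l j m
    simp only [conformalDiff, hG.symm hy j m]
    ring
  rw [s1, s2 j k, Finset.sum_congr rfl fun m _ => congrArg (christoffel G m i k y * ·) (hc l j m),
    s2 k j]
  unfold conformalDiff
  rw [pd_sub ((dite _ _).fun_add (dite _ _)) ((hG.differentiableAt hS hy j k).fun_mul (dv l)),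
    pd_add (dite _ _) (dite _ _), pite, pite, pd_mul (hG.differentiableAt hS hy j k) (dv l),
    hG.pd_gradVec hS hφ hy, h2, h2, hG.pd_eq hS hy]
  split_ifs <;> ring

/-- This is the part of the new curvature quadratic in the difference tensor. -/
theorem sum_conformalDiff_mul (hG : IsMetricOn G S) (hy : y ∈ S) (i j k l : Fin n) :
    ∑ m, conformalDiff G φ m j k y * conformalDiff G φ l i m y
      = pd k φ y * conformalDiff G φ l i j y + pd j φ y * conformalDiff G φ l i k y
        - G y j k * (if l = i then gradSq G φ y else 0) := by
  have e : ∀ m, conformalDiff G φ m j k y * conformalDiff G φ l i m y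
      = (if m = j then pd k φ y * conformalDiff G φ l i m y else 0)
        + (if m = k then pd j φ y * conformalDiff G φ l i m y else 0)
        - G y j k * ((if l = i then gradVec G φ m y * pd m φ y else 0)
          + (if l = m then gradVec G φ m y * pd i φ y else 0)
          - (G y i m * gradVec G φ m y) * gradVec G φ l y) := by
    intro m
    rw [conformalDiff]
    have : ∀ x, x * conformalDiff G φ l i m y = x * ((if l = i then pd m φ y else 0)
      + (if l = m then pd i φ y else 0) - G y i m * gradVec G φ l y) := fun _ => rfl
    simp only [this]
    split_ifs <;> ring
  simp only [e, Finset.sum_add_distrib, Finset.sum_sub_distrib, ← Finset.mul_sum, ← Finset.sum_mul,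
    Finset.sum_ite_eq, Finset.sum_ite_eq', Finset.mem_univ, if_true, hG.sum_mul_gradVec hy]
  split_ifs <;> simp only [gradSq, Finset.sum_const_zero] <;> ring

/-- The curvature of the conformal metric `e^{2φ} g`. -/
theorem riemannUp_conformal (hG : IsMetricOn G S) (hS : IsOpen S) (hφ : ContDiffOn ℝ ∞ φ S)
    (hy : y ∈ S) {T Tup : Fin n → Fin n → ℝ}
    (hT : ∀ i j, T i j = hessian G φ i j y - pd i φ y * pd j φ y + 1 / 2 * gradSq G φ y * G y i j)
    (hTup : ∀ i l, Tup i l = ∑ m, (G y)⁻¹ l m * T i m) (i j k l : Fin n) :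
    riemannUp (fun z => Real.exp (2 * φ z) • G z) i j k l y
      = riemannUp G i j k l y - ((if l = i then T j k else 0) - (if l = j then T i k else 0)
        + G y j k * Tup i l - G y i k * Tup j l) := by
  have hup : ∀ i l, Tup i l = hessianUp G φ i l y - pd i φ y * gradVec G φ l y
      + 1 / 2 * gradSq G φ y * if l = i then 1 else 0 := by
    intro i l
    rw [hTup, hessianUp, gradVec, ← hG.sum_inv_mul hy l i]
    simp only [hT, Finset.mul_sum, ← Finset.sum_sub_distrib, ← Finset.sum_add_distrib]
    exact Finset.sum_congr rfl fun m _ => by rw [hG.symm hy i m]; ring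
  have dC : ∀ l j k, DifferentiableAt ℝ (conformalDiff G φ l j k) y := by
    intro l j k
    have h1 : ContDiffOn ℝ ∞ (conformalDiff G φ l j k) S := by
      unfold conformalDiff
      refine ContDiffOn.sub (ContDiffOn.add ?_ ?_) ((hG.1 j k).mul (hG.contDiffOn_gradVec hS hφ l))
      · split_ifs
        exacts [contDiffOn_pd hS hφ _, contDiffOn_const]
      · split_ifs
        exacts [contDiffOn_pd hS hφ _, contDiffOn_const]
    exact (h1.contDiffAt (hS.mem_nhds hy)).differentiableAt (by simp)
  have hpd : ∀ i l j k, pd i (christoffel (fun z => Real.exp (2 * φ z) • G z) l j k) y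
      = pd i (christoffel G l j k) y + pd i (conformalDiff G φ l j k) y := by
    intro i l j k
    rw [pd_congr hS hy fun z hz => hG.christoffel_conformal hS hφ hz l j k,
      pd_add (hG.differentiableAt_christoffel hS hy l j k) (dC l j k)]
  have s : ∀ i j, ∑ m, (christoffel G m j k y + conformalDiff G φ m j k y)
        * (christoffel G l i m y + conformalDiff G φ l i m y)
      = ∑ m, christoffel G m j k y * christoffel G l i m y
        + ∑ m, christoffel G m j k y * conformalDiff G φ l i m y
        + ∑ m, christoffel G l i m y * conformalDiff G φ m j k y
        + ∑ m, conformalDiff G φ m j k y * conformalDiff G φ l i m y := by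
    intro i j
    simp only [← Finset.sum_add_distrib]
    exact Finset.sum_congr rfl fun m _ => by ring
  have hsym : ∑ m, christoffel G m i j y * conformalDiff G φ l m k y
      = ∑ m, christoffel G m j i y * conformalDiff G φ l m k y :=
    Finset.sum_congr rfl fun m _ => by rw [hG.christoffel_symm hS hy m i j]
  simp only [riemannUp, hG.christoffel_conformal hS hφ hy, hpd, Finset.sum_sub_distrib, s,
    hG.pd_conformalDiff hS hφ hy, hG.sum_conformalDiff_mul hy, hsym, hT, hup,
    hessian_symm hS hG hφ hy j i]
  -- The sums pairing Γ with the difference tensor cancel among themselves, so they can be treated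
  -- as independent symbols.
  generalize ∑ m, christoffel G m j i y * conformalDiff G φ l m k y = A₁
  generalize ∑ m, christoffel G m j k y * conformalDiff G φ l i m y = A₂
  generalize ∑ m, christoffel G m i k y * conformalDiff G φ l j m y = A₃
  generalize ∑ m, christoffel G l i m y * conformalDiff G φ m j k y = A₄
  generalize ∑ m, christoffel G l j m y * conformalDiff G φ m i k y = A₅
  simp only [conformalDiff, hG.symm hy j i]
  split_ifs <;> ring

end IsMetricOn

end Conformal

/-! ### Products of a line with a space form. -/

section Product

variable {n : ℕ}

theorem pd_zero_comp_tailPt {F : Eu n → ℝ} {y : Eu (n + 1)}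
    (hF : DifferentiableAt ℝ F (tailPt y)) : pd 0 (fun z => F (tailPt z)) y = 0 := by
  have hd : DifferentiableAt ℝ (fun z => F (tailPt z)) y :=
    DifferentiableAt.comp (g := F) y hF (contDiff_tailPt.differentiable (by simp) y)
  rw [pd, ← hd.lineDeriv_eq_fderiv, lineDeriv]
  have : ∀ t : ℝ, tailPt (y + t • EuclideanSpace.single (0 : Fin (n + 1)) (1 : ℝ)) = tailPt y := by
    intro t
    ext i
    simp
  simp [this]

theorem pd_succ_comp_tailPt {F : Eu n → ℝ} {y : Eu (n + 1)}
    (hF : DifferentiableAt ℝ F (tailPt y)) (a : Fin n) :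
    pd a.succ (fun z => F (tailPt z)) y = pd a F (tailPt y) :=
  pd_succ (DifferentiableAt.comp (g := F) y hF (contDiff_tailPt.differentiable (by simp) y)) a

theorem blockMat_posDef {K : Matrix (Fin n) (Fin n) ℝ} (hK : K.PosDef) : (blockMat 1 K).PosDef := by
  refine Matrix.PosDef.of_dotProduct_mulVec_pos ?_ fun x hx => ?_
  · ext i j
    rw [Matrix.conjTranspose_apply, star_trivial]
    refine Fin.cases (Fin.cases rfl (fun j => rfl) j) (fun i => Fin.cases rfl (fun j => ?_) j) i
    exact hK.isHermitian.apply i j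
  · have h1 : star x ⬝ᵥ (blockMat 1 K).mulVec x
        = x 0 ^ 2 + star (fun i : Fin n => x i.succ) ⬝ᵥ K.mulVec (fun i => x i.succ) := by
      simp [dotProduct, Matrix.mulVec, Fin.sum_univ_succ, sq]
    rw [h1]
    by_cases h : (fun i : Fin n => x i.succ) = 0
    · have h0 : x 0 ≠ 0 := by
        intro h0
        apply hx
        funext i
        exact Fin.cases h0 (fun j => congrFun h j) i
      rw [h]
      simp only [Matrix.mulVec_zero, dotProduct_zero, add_zero]
      positivity
    · have := hK.dotProduct_mulVec_pos h
      positivity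

/-- The product metric `dt² + g̃`. -/
def prodMetric (gt : Eu n → Matrix (Fin n) (Fin n) ℝ) (y : Eu (n + 1)) :
    Matrix (Fin (n + 1)) (Fin (n + 1)) ℝ := blockMat 1 (gt (tailPt y))

variable {gt : Eu n → Matrix (Fin n) (Fin n) ℝ} {I : Set ℝ} {W : Set (Eu n)} {y : Eu (n + 1)}

/-- The slices of a product are totally geodesic, the case ζ = 0, so the Christoffel and Gauss
formulas for umbilic slices apply. -/
theorem isUmbilic_prodMetric (hI : IsOpen I) (hW : IsOpen W) (hgt : IsMetricOn gt W) :
    IsUmbilic (prodMetric gt) I W (fun _ => 0) where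
  isOpen_fst := hI
  isOpen_snd := hW
  metric := by
    refine ⟨fun i j => ?_, fun y hy => blockMat_posDef (hgt.2 _ hy.2)⟩
    refine Fin.cases (Fin.cases contDiffOn_const (fun j => contDiffOn_const) j)
      (fun i => Fin.cases contDiffOn_const (fun j => ?_) j) i
    exact (hgt.1 i j).comp contDiff_tailPt.contDiffOn fun y hy => hy.2
  zero_zero _ _ := rfl
  zero_succ _ _ _ := rfl
  contDiffOn := contDiffOn_const
  pd_zero y hy a b := by
    rw [mul_zero, zero_mul]
    exact pd_zero_comp_tailPt (F := fun x => gt x a b) (hgt.differentiableAt hW hy.2 a b)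

theorem slice_prodMetric (s : ℝ) : slice (prodMetric gt) s = gt := rfl

theorem christoffel_prodMetric_zero_left (hI : IsOpen I) (hW : IsOpen W) (hgt : IsMetricOn gt W)
    (hy : y ∈ box I W) (k j : Fin (n + 1)) : christoffel (prodMetric gt) k 0 j y = 0 := by
  have h := isUmbilic_prodMetric hI hW hgt
  refine Fin.cases (h.christoffel_zero_zero_left hy j) (fun k => ?_) k
  refine Fin.cases (h.christoffel_succ_zero_zero hy k) (fun j => ?_) j
  rw [h.christoffel_succ_zero_succ hy, ite_self]

theorem christoffel_prodMetric_zero_right (hI : IsOpen I) (hW : IsOpen W) (hgt : IsMetricOn gt W)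
    (hy : y ∈ box I W) (k j : Fin (n + 1)) : christoffel (prodMetric gt) k j 0 y = 0 := by
  have h := isUmbilic_prodMetric hI hW hgt
  rw [h.metric.christoffel_symm h.isOpen hy, christoffel_prodMetric_zero_left hI hW hgt hy]

theorem christoffel_prodMetric_zero_up (hI : IsOpen I) (hW : IsOpen W) (hgt : IsMetricOn gt W)
    (hy : y ∈ box I W) (i j : Fin (n + 1)) : christoffel (prodMetric gt) 0 i j y = 0 := by
  have h := isUmbilic_prodMetric hI hW hgt
  refine Fin.cases (h.christoffel_zero_zero_left hy j) (fun i => ?_) i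
  refine Fin.cases (h.christoffel_zero_zero_right hy _) (fun j => ?_) j
  rw [h.christoffel_zero_succ_succ hy, zero_mul, neg_zero]

theorem christoffel_prodMetric_succ (hI : IsOpen I) (hW : IsOpen W) (hgt : IsMetricOn gt W)
    (hy : y ∈ box I W) (c a b : Fin n) :
    christoffel (prodMetric gt) c.succ a.succ b.succ y = christoffel gt c a b (tailPt y) := by
  rw [(isUmbilic_prodMetric hI hW hgt).christoffel_succ_succ_succ hy, slice_prodMetric]

theorem pd_zero_christoffel_prodMetric (hI : IsOpen I) (hW : IsOpen W) (hgt : IsMetricOn gt W)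
    (hy : y ∈ box I W) (k i j : Fin (n + 1)) : pd 0 (christoffel (prodMetric gt) k i j) y = 0 := by
  have hS := isOpen_box hI hW
  refine Fin.cases ?_ (fun k => ?_) k
  · exact pd_eq_zero hS hy fun z hz => christoffel_prodMetric_zero_up hI hW hgt hz _ _
  refine Fin.cases ?_ (fun i => ?_) i
  · exact pd_eq_zero hS hy fun z hz => christoffel_prodMetric_zero_left hI hW hgt hz _ _
  refine Fin.cases ?_ (fun j => ?_) j
  · exact pd_eq_zero hS hy fun z hz => christoffel_prodMetric_zero_right hI hW hgt hz _ _
  rw [pd_congr hS hy fun z hz => christoffel_prodMetric_succ hI hW hgt hz k i j]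
  exact pd_zero_comp_tailPt (hgt.differentiableAt_christoffel hW hy.2 k i j)

/-- The curvature of the product of a line with a space form. -/
theorem riemannUp_prodMetric (hI : IsOpen I) (hW : IsOpen W) (hgt : IsMetricOn gt W) {κ : ℝ}
    (hκ : IsSpaceForm gt W κ) (hy : y ∈ box I W) (i j k l : Fin (n + 1)) :
    riemannUp (prodMetric gt) i j k l y = if i = 0 ∨ j = 0 ∨ k = 0 ∨ l = 0 then 0 else
      κ * ((if l = i then prodMetric gt y j k else 0)
        - if l = j then prodMetric gt y i k else 0) := by
  have hS := isOpen_box hI hW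
  have hl := fun k j => christoffel_prodMetric_zero_left hI hW hgt hy k j
  have hr := fun k j => christoffel_prodMetric_zero_right hI hW hgt hy k j
  have hu := fun i j => christoffel_prodMetric_zero_up hI hW hgt hy i j
  have h0 := fun k i j => pd_zero_christoffel_prodMetric hI hW hgt hy k i j
  have hl' : ∀ i k j, pd i (christoffel (prodMetric gt) k 0 j) y = 0 := fun i k j =>
    pd_eq_zero hS hy fun z hz => christoffel_prodMetric_zero_left hI hW hgt hz _ _
  have hr' : ∀ i k j, pd i (christoffel (prodMetric gt) k j 0) y = 0 := fun i k j =>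
    pd_eq_zero hS hy fun z hz => christoffel_prodMetric_zero_right hI hW hgt hz _ _
  have hu' : ∀ a i j, pd a (christoffel (prodMetric gt) 0 i j) y = 0 := fun a i j =>
    pd_eq_zero hS hy fun z hz => christoffel_prodMetric_zero_up hI hW hgt hz _ _
  refine Fin.cases ?_ (fun i => ?_) i
  · simp [riemannUp, hl, h0, hl']
  refine Fin.cases ?_ (fun j => ?_) j
  · simp [riemannUp, hl, h0, hl']
  refine Fin.cases ?_ (fun k => ?_) k
  · simp [riemannUp, hr, hr']
  refine Fin.cases ?_ (fun l => ?_) l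
  · simp [riemannUp, hu, hu']
  rw [(isUmbilic_prodMetric hI hW hgt).riemannUp_succ hy, slice_prodMetric, hκ _ hy.2]
  simp [prodMetric, eq_comm]

/-- The product of a line with a space form is made flat by the conformal factor `w⁻²` when the
Hessian of `w` compensates the Schouten tensor. -/
theorem isFlatOn_conformal_prodMetric (hI : IsOpen I) (hW : IsOpen W) (hgt : IsMetricOn gt W)
    {κ : ℝ} (hκ : IsSpaceForm gt W κ) {w : Eu (n + 1) → ℝ} (hw : ContDiffOn ℝ ∞ w (box I W))
    (hpos : ∀ y ∈ box I W, 0 < w y)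
    (hH : ∀ y ∈ box I W, ∀ i j, hessian (prodMetric gt) w i j y * w y
      - 1 / 2 * gradSq (prodMetric gt) w y * prodMetric gt y i j
      = -(w y ^ 2 * (κ / 2 * (prodMetric gt y i j - if i = 0 ∧ j = 0 then 2 else 0)))) :
    IsFlatOn (fun y => Real.exp (2 * -Real.log (w y)) • prodMetric gt y) (box I W) := by
  have hS := isOpen_box hI hW
  have hG := (isUmbilic_prodMetric hI hW hgt).metric
  have hφ : ContDiffOn ℝ ∞ (fun y => -Real.log (w y)) (box I W) :=
    (hw.log fun y hy => (hpos y hy).ne').neg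
  have dw : ∀ z ∈ box I W, DifferentiableAt ℝ w z := fun z hz =>
    (hw.contDiffAt (hS.mem_nhds hz)).differentiableAt (by simp)
  have hpd : ∀ i, ∀ z ∈ box I W, pd i (fun y => -Real.log (w y)) z = -((w z)⁻¹ * pd i w z) := by
    intro i z hz
    rw [pd_neg, pd_comp (Real.hasDerivAt_log (hpos z hz).ne') (dw z hz)]
  intro y hy i j k l
  have hwy := (hpos y hy).ne'
  have hpdpd : ∀ i j, pd i (pd j fun y => -Real.log (w y)) y
      = -((w y)⁻¹ * pd i (pd j w) y) + (w y)⁻¹ ^ 2 * (pd i w y * pd j w y) := by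
    intro i j
    have hinv : HasDerivAt (fun t : ℝ => t⁻¹) (-(w y ^ 2)⁻¹) (w y) := hasDerivAt_inv hwy
    have dinv : DifferentiableAt ℝ (fun z => (w z)⁻¹) y := (dw y hy).fun_inv hwy
    have dp : DifferentiableAt ℝ (pd j w) y :=
      ((contDiffOn_pd hS hw j).contDiffAt (hS.mem_nhds hy)).differentiableAt (by simp)
    rw [pd_congr hS hy fun z hz => hpd j z hz, pd_neg, pd_mul dinv dp, pd_comp hinv (dw y hy)]
    field_simp
    ring
  have hhess : ∀ i j, hessian (prodMetric gt) (fun y => -Real.log (w y)) i j y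
      = -((w y)⁻¹ * hessian (prodMetric gt) w i j y) + (w y)⁻¹ ^ 2 * (pd i w y * pd j w y) := by
    intro i j
    have : ∀ m, christoffel (prodMetric gt) m i j y * -((w y)⁻¹ * pd m w y)
        = -(w y)⁻¹ * (christoffel (prodMetric gt) m i j y * pd m w y) := fun m => by ring
    simp only [hessian, hpdpd, hpd _ y hy, this, ← Finset.mul_sum]
    ring
  have hsq : gradSq (prodMetric gt) (fun y => -Real.log (w y)) y
      = (w y)⁻¹ ^ 2 * gradSq (prodMetric gt) w y := by
    simp only [gradSq, gradVec, hpd _ y hy, Finset.mul_sum, Finset.sum_mul]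
    exact Finset.sum_congr rfl fun a _ => Finset.sum_congr rfl fun b _ => by ring
  -- The Schouten tensor κ/2 (g̃ - dt²), written as κ/2 (g - 2dt²).
  set T : Fin (n + 1) → Fin (n + 1) → ℝ := fun i j =>
    κ / 2 * (prodMetric gt y i j - if i = 0 ∧ j = 0 then 2 else 0) with hTdef
  -- For φ = -log w the terms dw ⊗ dw in Hess φ and dφ ⊗ dφ cancel, so hypothesis `hH` divided by
  -- -w² is this identity.
  have hT : ∀ i j, T i j = hessian (prodMetric gt) (fun y => -Real.log (w y)) i j y
      - pd i (fun y => -Real.log (w y)) y * pd j (fun y => -Real.log (w y)) y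
      + 1 / 2 * gradSq (prodMetric gt) (fun y => -Real.log (w y)) y * prodMetric gt y i j := by
    intro i j
    rw [hhess, hsq, hpd i y hy, hpd j y hy]
    have h1 : w y ^ 2 * T i j = -(hessian (prodMetric gt) w i j y * w y
      - 1 / 2 * gradSq (prodMetric gt) w y * prodMetric gt y i j) := by rw [hH y hy]; ring
    rw [← mul_right_inj' (pow_ne_zero 2 hwy), h1]
    field_simp
    ring
  set Tup : Fin (n + 1) → Fin (n + 1) → ℝ := fun i l =>
    κ / 2 * ((if l = i then 1 else 0) - if i = 0 ∧ l = 0 then 2 else 0) with hTupdef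
  have hTup : ∀ i l, Tup i l = ∑ m, (prodMetric gt y)⁻¹ l m * T i m := by
    intro i l
    have h1 : ∀ m, (prodMetric gt y)⁻¹ l m * T i m
        = κ / 2 * ((prodMetric gt y)⁻¹ l m * prodMetric gt y m i
          - if m = 0 then (if i = 0 then 2 * (prodMetric gt y)⁻¹ l m else 0) else 0) := by
      intro m
      simp only [T]
      rw [hG.symm hy i m]
      by_cases hi : i = 0 <;> by_cases hm : m = 0 <;> simp [hi, hm] <;> ring
    have h2 : (prodMetric gt y)⁻¹ l 0 = if l = 0 then 1 else 0 := by
      rw [(isUmbilic_prodMetric hI hW hgt).inv_eq hy]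
      refine Fin.cases ?_ (fun l => ?_) l
      · simp
      · simp
    simp only [h1, ← Finset.mul_sum, Finset.sum_sub_distrib, hG.sum_inv_mul hy,
      Finset.sum_ite_eq', Finset.mem_univ, if_true, h2, Tup]
    by_cases hi : i = 0 <;> by_cases hl : l = 0 <;> simp [hi, hl]
  -- The curvature of the product is exactly the combination of T and g subtracted by the conformal
  -- change; it is compared component by component, separating the index 0.
  have hR : ∀ l, riemannUp (fun y => Real.exp (2 * -Real.log (w y)) • prodMetric gt y) i j k l y
      = 0 := by
    intro l
    rw [hG.riemannUp_conformal hS hφ hy hT hTup, riemannUp_prodMetric hI hW hgt hκ hy]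
    simp only [T, Tup]
    have e00 : prodMetric gt y 0 0 = 1 := rfl
    have e0s : ∀ a : Fin n, prodMetric gt y 0 a.succ = 0 := fun _ => rfl
    have es0 : ∀ a : Fin n, prodMetric gt y a.succ 0 = 0 := fun _ => rfl
    refine Fin.cases ?_ (fun i => ?_) i <;> refine Fin.cases ?_ (fun j => ?_) j <;>
      refine Fin.cases ?_ (fun k => ?_) k <;> refine Fin.cases ?_ (fun l => ?_) l <;>
      simp [e00, e0s, es0, Fin.succ_ne_zero, (Fin.succ_ne_zero _).symm] <;>
      (try split_ifs) <;> ring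
  simp only [riemann, hR, zero_mul, Finset.sum_const_zero]

end Product

/-! ### Conformal factors that flatten a product of a line with a space form. -/

section ConformalFactor

variable {n : ℕ} {gt : Eu n → Matrix (Fin n) (Fin n) ℝ} {I : Set ℝ} {W : Set (Eu n)}

/-- The factor lives on the fibre: the dt² component of the required identity uses |du|² = -κ u²,
and the fibre components combine it with the Hessian equation. -/
theorem isFlatOn_prodMetric_of_tail (hI : IsOpen I) (hW : IsOpen W) (hgt : IsMetricOn gt W)
    {κ : ℝ} (hκ : IsSpaceForm gt W κ) {u : Eu n → ℝ} (hu : ContDiffOn ℝ ∞ u W)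
    (hpos : ∀ x ∈ W, 0 < u x) (hH : ∀ x ∈ W, ∀ i j, hessian gt u i j x = -κ * u x * gt x i j)
    (hsq : ∀ x ∈ W, gradSq gt u x = -κ * u x ^ 2) :
    IsFlatOn (fun y => Real.exp (2 * -Real.log (u (tailPt y))) • prodMetric gt y) (box I W) := by
  have hS := isOpen_box hI hW
  have du : ∀ x ∈ W, DifferentiableAt ℝ u x := fun x hx =>
    (hu.contDiffAt (hW.mem_nhds hx)).differentiableAt (by simp)
  have dp : ∀ x ∈ W, ∀ a, DifferentiableAt ℝ (pd a u) x := fun x hx a =>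
    ((contDiffOn_pd hW hu a).contDiffAt (hW.mem_nhds hx)).differentiableAt (by simp)
  have p0 : ∀ z ∈ box I W, pd 0 (fun y => u (tailPt y)) z = 0 := fun z hz =>
    pd_zero_comp_tailPt (du _ hz.2)
  have ps : ∀ z ∈ box I W, ∀ a : Fin n, pd a.succ (fun y => u (tailPt y)) z = pd a u (tailPt z) :=
    fun z hz a => pd_succ_comp_tailPt (du _ hz.2) a
  refine isFlatOn_conformal_prodMetric hI hW hgt hκ
    (hu.comp contDiff_tailPt.contDiffOn fun y hy => hy.2) (fun y hy => hpos _ hy.2)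
    fun y hy i j => ?_
  have hl := fun k j => christoffel_prodMetric_zero_left hI hW hgt hy k j
  have hr := fun k j => christoffel_prodMetric_zero_right hI hW hgt hy k j
  have hgr : gradSq (prodMetric gt) (fun y => u (tailPt y)) y = -κ * u (tailPt y) ^ 2 := by
    rw [← hsq _ hy.2]
    simp only [gradSq, gradVec, (isUmbilic_prodMetric hI hW hgt).inv_eq hy, Fin.sum_univ_succ,
      p0 y hy, ps y hy, blockMat_zero_zero, blockMat_zero_succ, blockMat_succ_zero,
      blockMat_succ_succ]
    simp only [mul_zero, zero_add]
    rfl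
  rw [hgr]
  refine Fin.cases (Fin.cases ?_ (fun j => ?_) j) (fun i => Fin.cases ?_ (fun j => ?_) j) i
  · have h1 : pd 0 (pd 0 fun y => u (tailPt y)) y = 0 := pd_eq_zero hS hy fun z hz => p0 z hz
    simp [hessian, hl, h1, prodMetric]
    ring
  · have h1 : pd 0 (pd j.succ fun y => u (tailPt y)) y = 0 := by
      rw [pd_congr hS hy fun z hz => ps z hz j]
      exact pd_zero_comp_tailPt (dp _ hy.2 j)
    simp [hessian, hl, h1, prodMetric]
  · have h1 : pd i.succ (pd 0 fun y => u (tailPt y)) y = 0 := pd_eq_zero hS hy fun z hz => p0 z hz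
    simp [hessian, hr, h1, prodMetric]
  · have h1 : hessian (prodMetric gt) (fun y => u (tailPt y)) i.succ j.succ y
        = hessian gt u i j (tailPt y) := by
      rw [hessian, hessian, pd_congr hS hy fun z hz => ps z hz j,
        pd_succ_comp_tailPt (dp _ hy.2 j), Fin.sum_univ_succ]
      simp only [p0 y hy, ps y hy, christoffel_prodMetric_succ hI hW hgt hy, mul_zero, zero_add]
    rw [h1, hH _ hy.2]
    simp [prodMetric]
    ring

/-- The model is polar coordinates: for c ≠ 0, setting ρ = exp(-ct)/|c| turns the rescaled product
into dρ² + ρ² c² g̃, a cone over a metric of curvature 1. -/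
theorem isFlatOn_prodMetric_of_exp (hI : IsOpen I) (hW : IsOpen W) (hgt : IsMetricOn gt W)
    {c : ℝ} (hκ : IsSpaceForm gt W (c ^ 2)) :
    IsFlatOn (fun y => Real.exp (2 * -Real.log (Real.exp (c * y 0))) • prodMetric gt y)
      (box I W) := by
  have hexp : ∀ t : ℝ, HasDerivAt (fun t => Real.exp (c * t)) (Real.exp (c * t) * (c * 1)) t :=
    fun t => ((hasDerivAt_id t).const_mul c).exp
  have dcoord : ∀ z : Eu (n + 1), DifferentiableAt ℝ (fun y : Eu (n + 1) => y 0) z := fun z =>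
    (contDiff_coord 0).differentiable (by simp) z
  have hw : ContDiff ℝ ∞ (fun y : Eu (n + 1) => Real.exp (c * y 0)) :=
    (contDiff_const.mul (contDiff_coord 0)).exp
  have hp : ∀ i z, pd i (fun y : Eu (n + 1) => Real.exp (c * y 0)) z
      = if i = 0 then c * Real.exp (c * z 0) else 0 := by
    intro i z
    rw [pd_comp (θ := fun t => Real.exp (c * t)) (hexp _) (dcoord z), pd_coord]
    split_ifs <;> ring
  have hpp : ∀ i j z, pd i (pd j fun y : Eu (n + 1) => Real.exp (c * y 0)) z
      = if i = 0 ∧ j = 0 then c ^ 2 * Real.exp (c * z 0) else 0 := by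
    intro i j z
    have h1 : (pd j fun y : Eu (n + 1) => Real.exp (c * y 0))
        = fun z => (if j = 0 then c else 0) * Real.exp (c * z 0) := by
      funext z
      rw [hp]
      split_ifs <;> ring
    rw [h1, pd_mul (differentiableAt_const _) (hw.differentiable (by simp) z), pd_const, hp]
    by_cases hi : i = 0 <;> by_cases hj : j = 0 <;> simp [hi, hj]
    ring
  refine isFlatOn_conformal_prodMetric hI hW hgt hκ hw.contDiffOn (fun y _ => Real.exp_pos _)
    fun y hy i j => ?_
  have hu := fun i j => christoffel_prodMetric_zero_up hI hW hgt hy i j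
  have hgr : gradSq (prodMetric gt) (fun y => Real.exp (c * y 0)) y
      = c ^ 2 * Real.exp (c * y 0) ^ 2 := by
    simp only [gradSq, gradVec, (isUmbilic_prodMetric hI hW hgt).inv_eq hy, Fin.sum_univ_succ, hp]
    simp
    ring
  have hhess : hessian (prodMetric gt) (fun y => Real.exp (c * y 0)) i j y
      = if i = 0 ∧ j = 0 then c ^ 2 * Real.exp (c * y 0) else 0 := by
    rw [hessian, hpp, Fin.sum_univ_succ]
    simp [hu, hp]
  rw [hgr, hhess]
  split_ifs <;> ring

/-- Every product of a line with a space form is locally conformally flat. -/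
theorem exists_conformal_factor {gt : Eu (n + 1) → Matrix (Fin (n + 1)) (Fin (n + 1)) ℝ}
    {W : Set (Eu (n + 1))} (hI : IsOpen I) (hW : IsOpen W) (hgt : IsMetricOn gt W) {κ : ℝ}
    (hκ : IsSpaceForm gt W κ) {x₀ : Eu (n + 1)} (hx₀ : x₀ ∈ W) :
    ∃ (w : Eu (n + 2) → ℝ) (r : ℝ), 0 < r ∧ Metric.ball x₀ r ⊆ W ∧
      ContDiffOn ℝ ∞ w (box I (Metric.ball x₀ r)) ∧
      (∀ y ∈ box I (Metric.ball x₀ r), 0 < w y) ∧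
      IsFlatOn (fun y => Real.exp (2 * -Real.log (w y)) • prodMetric gt y)
        (box I (Metric.ball x₀ r)) := by
  -- Nonnegative curvature uses the exponential in the line variable; nonpositive curvature uses a
  -- horospherical function on the fibre.
  rcases le_total 0 κ with h | h
  · obtain ⟨r, hr, hrW⟩ := Metric.isOpen_iff.1 hW x₀ hx₀
    refine ⟨fun y => Real.exp (√κ * y 0), r, hr, hrW, ?_, fun y _ => Real.exp_pos _, ?_⟩
    · exact (contDiff_const.mul (contDiff_coord 0)).exp.contDiffOn
    · refine isFlatOn_prodMetric_of_exp hI Metric.isOpen_ball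
        ⟨fun i j => (hgt.1 i j).mono hrW, fun y hy => hgt.2 y (hrW hy)⟩ ?_
      rw [Real.sq_sqrt h]
      exact fun y hy => hκ y (hrW hy)
  · obtain ⟨u, r, hr, hrW, hu, hu'⟩ := hκ.exists_horospherical hW hgt h hx₀
    refine ⟨fun y => u (tailPt y), r, hr, hrW,
      hu.comp contDiff_tailPt.contDiffOn fun y hy => hy.2, fun y hy => (hu' _ hy.2).1, ?_⟩
    exact isFlatOn_prodMetric_of_tail hI Metric.isOpen_ball
      ⟨fun i j => (hgt.1 i j).mono hrW, fun y hy => hgt.2 y (hrW hy)⟩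
      (fun y hy => hκ y (hrW hy)) hu (fun x hx => (hu' x hx).1) (fun x hx => (hu' x hx).2.1)
      fun x hx => (hu' x hx).2.2

end ConformalFactor

/-! ### Umbilic slices with curvature depending on s alone: warped products. -/

section FirstCoordinate

variable {n : ℕ}

theorem hasDerivAt_consPt {F : Eu (n + 1) → ℝ} {s : ℝ} {x : Eu n}
    (hF : DifferentiableAt ℝ F (consPt s x)) :
    HasDerivAt (fun t => F (consPt t x)) (pd 0 F (consPt s x)) s := by
  have hline : ∀ t : ℝ, consPt t x
      = consPt s x + (t - s) • EuclideanSpace.single (0 : Fin (n + 1)) (1 : ℝ) := by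
    intro t
    ext i
    refine Fin.cases ?_ (fun j => ?_) i <;> simp
  have h1 : HasDerivAt (fun t : ℝ => consPt s x
      + (t - s) • EuclideanSpace.single (0 : Fin (n + 1)) (1 : ℝ))
      (EuclideanSpace.single (0 : Fin (n + 1)) (1 : ℝ)) s := by
    simpa using (((hasDerivAt_id s).sub_const s).smul_const
      (EuclideanSpace.single (0 : Fin (n + 1)) (1 : ℝ))).const_add (consPt s x)
  have h2 : (fun t => F (consPt t x)) = fun t : ℝ => F (consPt s x
      + (t - s) • EuclideanSpace.single (0 : Fin (n + 1)) (1 : ℝ)) :=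
    funext fun t => congrArg F (hline t)
  rw [h2]
  exact hasDerivAt_comp_curve hF.hasFDerivAt h1 (by simp)

theorem pd_of_eq_first {F : Eu (n + 1) → ℝ} {S : Set (Eu (n + 1))} (hS : IsOpen S) {β : ℝ → ℝ}
    (hF : ∀ y ∈ S, F y = β (y 0)) {y : Eu (n + 1)} (hy : y ∈ S) {β' : ℝ}
    (hβ : HasDerivAt β β' (y 0)) (i : Fin (n + 1)) : pd i F y = if i = 0 then β' else 0 := by
  rw [pd_congr hS hy hF, pd_comp (F := fun z : Eu (n + 1) => z 0) hβ
    ((contDiff_coord 0).differentiable (by simp) y), pd_coord]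
  split_ifs <;> simp

/-- `Γ^0_ij` for a metric of the form `ds² + g_s`. -/
theorem IsMetricOn.christoffel_zero {G : Eu (n + 1) → Matrix (Fin (n + 1)) (Fin (n + 1)) ℝ}
    {S : Set (Eu (n + 1))} (hG : IsMetricOn G S) (hS : IsOpen S) (h00 : ∀ y ∈ S, G y 0 0 = 1)
    (h0s : ∀ y ∈ S, ∀ i : Fin n, G y 0 i.succ = 0) {y : Eu (n + 1)} (hy : y ∈ S)
    (i j : Fin (n + 1)) : christoffel G 0 i j y = -(1 / 2 * pd 0 (fun z => G z i j) y) := by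
  have hpd : ∀ a b, pd a (fun z => G z 0 b) y = 0 := fun a b =>
    Fin.cases (pd_eq_zero hS hy h00) (fun b => pd_eq_zero hS hy fun z hz => h0s z hz b) b
  have := hG.sum_mul_christoffel hy 0 i j
  rw [Fin.sum_univ_succ] at this
  simp only [h00 y hy, h0s y hy, hpd, one_mul, zero_mul, Finset.sum_const_zero, add_zero] at this
  rw [this]
  ring

/-- If the slices are totally umbilic with principal curvature depending only on `s`, the metric
is a warped product. -/
theorem IsUmbilic.eq_exp_sq_mul_slice {G : Eu (n + 1) → Matrix (Fin (n + 1)) (Fin (n + 1)) ℝ}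
    {a b : ℝ} {W : Set (Eu n)} {ζ : Eu (n + 1) → ℝ} (h : IsUmbilic G (Set.Ioo a b) W ζ)
    {η θ : ℝ → ℝ} (hη : ∀ y ∈ box (Set.Ioo a b) W, ζ y = η (y 0)) {s₀ : ℝ}
    (hs₀ : s₀ ∈ Set.Ioo a b) (hθ0 : θ s₀ = 0) (hθ : ∀ s ∈ Set.Ioo a b, HasDerivAt θ (η s) s) :
    ∀ s ∈ Set.Ioo a b, ∀ x ∈ W, ∀ i j : Fin n,
      G (consPt s x) i.succ j.succ = Real.exp (θ s) ^ 2 * slice G s₀ x i j := by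
  intro s hs x hx i j
  -- ∂_s g_s = 2η g_s and θ' = η, so exp(-2θ) g_s is independent of s and equals g_{s₀}.
  have hd : ∀ t ∈ Set.Ioo a b, HasDerivAt
      (fun t => Real.exp (-2 * θ t) * G (consPt t x) i.succ j.succ) 0 t := by
    intro t ht
    have hy : consPt t x ∈ box (Set.Ioo a b) W := ⟨ht, hx⟩
    have h1 := hasDerivAt_consPt (F := fun z => G z i.succ j.succ) (h.differentiableAt hy _ _)
    rw [h.pd_zero _ hy, hη _ hy, consPt_zero] at h1
    refine (((hθ t ht).const_mul (-2)).exp.fun_mul h1).congr_deriv ?_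
    ring
  have := (convex_Ioo a b).is_const_of_fderivWithin_eq_zero (𝕜 := ℝ)
    (f := fun t => Real.exp (-2 * θ t) * G (consPt t x) i.succ j.succ)
    (fun t ht => (hd t ht).differentiableAt.differentiableWithinAt)
    (fun t ht => by
      rw [fderivWithin_of_isOpen isOpen_Ioo ht, (hd t ht).hasFDerivAt.fderiv]; ext; simp)
    hs hs₀
  simp only [hθ0, mul_zero, Real.exp_zero, one_mul] at this
  have h2 : Real.exp (θ s) ^ 2 * Real.exp (-2 * θ s) = 1 := by
    rw [← Real.exp_nat_mul, ← Real.exp_add]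
    simp
  rw [slice, Matrix.submatrix_apply, ← this, ← mul_assoc, h2, one_mul]

/-- By the traced Gauss equation with n = 3 the slice has Ricci tensor (m + η' + 3η²) times its
metric, a constant multiple, so it is Einstein; its curvature is half that constant. -/
theorem IsUmbilic.isSpaceForm_slice {G : Eu 4 → Matrix (Fin 4) (Fin 4) ℝ}
    {I : Set ℝ} {W : Set (Eu 3)} {ζ : Eu 4 → ℝ} (h : IsUmbilic G I W ζ) {η : ℝ → ℝ} {s₀ η' m : ℝ}
    (hs₀ : s₀ ∈ I) (hη : ∀ y ∈ box I W, ζ y = η (y 0)) (hη' : HasDerivAt η η' s₀)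
    (hric : ∀ x ∈ W, ∀ i j : Fin 3, ricci G i.succ j.succ (consPt s₀ x)
      = m * G (consPt s₀ x) i.succ j.succ) :
    IsSpaceForm (slice G s₀) W ((m + η' + 3 * η s₀ ^ 2) / 2) := by
  refine isSpaceForm_of_einstein h.isOpen_snd (isMetricOn_slice h.metric hs₀) fun x hx i j => ?_
  have hy : consPt s₀ x ∈ box I W := ⟨hs₀, hx⟩
  have h1 := h.ricci_succ_succ hy i j
  have h2 : pd 0 ζ (consPt s₀ x) = η' := by
    rw [pd_of_eq_first h.isOpen hη hy hη', if_pos rfl]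
  rw [hric x hx, h2, hη _ hy, consPt_zero, tailPt_consPt] at h1
  have h3 : slice G s₀ x i j = G (consPt s₀ x) i.succ j.succ := rfl
  rw [h3]
  push_cast at h1
  linarith

end FirstCoordinate

/-! ### Warped product structure and conformal flatness of the soliton. -/

section Soliton

/-- Near a regular point of the potential of a soliton whose gradient is a Ricci eigenvector there
is a chart in which the metric is `ds² + g_s` and the potential depends only on `s`. -/
theorem exists_geodesic_chart {n : ℕ} {M : Type*} [TopologicalSpace M]
    [ChartedSpace (Eu (n + 1)) M] [IsManifold (𝓡 (n + 1)) ∞ M] (g : RMetric (n + 1) M)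
    {f : M → ℝ} {lam : ℝ} (hsol : IsGradientRicciSoliton g f lam) {U : Set M} (hU : IsOpen U)
    (hgrad : ∀ x ∈ U, grad g f x ≠ 0) {E : Fin (n + 1) → (x : M) → TangentSpace (𝓡 (n + 1)) x}
    {ev : Fin (n + 1) → M → ℝ} (hE : IsAdaptedFrame g f U E ev) {μ : M → ℝ}
    (hμ : ∀ x ∈ U, ∀ i, i ≠ 0 → ev i x = μ x) {p : M} (hp : p ∈ U) :
    ∃ e ∈ Charts (n + 1) M, p ∈ e.source ∧ e.source ⊆ U ∧
      ∃ (a b : ℝ) (c : Eu n) (r : ℝ) (β : ℝ → ℝ), 0 < r ∧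
        e.target = box (Set.Ioo a b) (Metric.ball c r) ∧
        ∀ y ∈ e.target, f (e.symm y) = β (y 0) ∧
          HasDerivAt β (gradNorm g f (e.symm y)) (y 0) ∧ inChart g e y 0 0 = 1 ∧
          ∀ i : Fin n, inChart g e y 0 i.succ = 0 := by
  obtain ⟨e₁, he₁, hp₁, hsrc₁, ⟨a, b, c, r, htgt₁⟩, hf₁, hG₁⟩ :=
    exists_gradient_chart g hsol.1 hU hgrad hp
  have hS₁ : IsOpen e₁.target := e₁.open_target
  set G := inChart g e₁ with hGdef
  have hG : IsMetricOn G e₁.target := isMetricOn_inChart g he₁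
  have hU₁ : ∀ y ∈ e₁.target, e₁.symm y ∈ U := fun y hy => hsrc₁ (e₁.map_target hy)
  have hpd : ∀ y ∈ e₁.target, ∀ i, pd i (f ∘ e₁.symm) y = if i = 0 then 1 else 0 := fun y hy i =>
    pd_of_eq_first hS₁ (β := id) (fun z hz => hf₁ z hz) hy (hasDerivAt_id _) i
  have hr : 0 < r := by
    have := e₁.map_source hp₁
    rw [htgt₁] at this
    exact Metric.pos_of_mem_ball this.2
  -- In the component (a, 0) of the soliton equation both Rc and g vanish, while Hess f = -Γ^0_{a0};
  -- hence g_00 = |∇f|⁻² is constant on the levels.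
  have hdG : ∀ y ∈ e₁.target, ∀ i : Fin n, pd i.succ (fun z => G z 0 0) y = 0 := by
    intro y hy i
    have h1 := hsol.2 e₁ he₁ y hy i.succ 0
    rw [ricci_of_adaptedFrame g hsol.1 hE he₁ hy (hU₁ y hy) (fun j hj => hμ _ (hU₁ y hy) j hj)
      (by rw [hpd y hy, if_neg (Fin.succ_ne_zero i)]), ← hGdef] at h1
    have h2 : G y i.succ 0 = 0 := by rw [hG.symm hy, (hG₁ y hy).2]
    have h3 : pd i.succ (pd 0 (f ∘ e₁.symm)) y = 0 :=
      pd_eq_zero hS₁ hy fun z hz => hpd z hz 0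
    rw [hessian, h2, h3, Fin.sum_univ_succ] at h1
    simp only [hpd y hy, Fin.succ_ne_zero, if_true, if_false, mul_zero, mul_one,
      Finset.sum_const_zero, add_zero, zero_sub, neg_zero, neg_eq_zero] at h1
    rw [christoffel_zero_succ_zero hS₁ hG (fun z hz => (hG₁ z hz).2) hy] at h1
    have hpos : 0 < G y 0 0 := (hG.2 y hy).diag_pos
    simpa [hpos.ne'] using h1
  have hconst : ∀ s ∈ Set.Ioo a b, ∀ x ∈ Metric.ball c r,
      G (consPt s x) 0 0 = G (consPt s c) 0 0 := fun s hs x hx =>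
    eq_of_pd_succ_eq_zero (F := fun z => G z 0 0) isOpen_Ioo Metric.isOpen_ball (convex_ball c r)
      (by rw [← htgt₁]; exact (hG.1 0 0).differentiableOn (by simp))
      (by rw [← htgt₁]; exact hdG) hs hx (Metric.mem_ball_self hr)
  have hmem : ∀ s ∈ Set.Ioo a b, consPt s c ∈ e₁.target := fun s hs => by
    rw [htgt₁]; exact ⟨hs, Metric.mem_ball_self hr⟩
  -- q = √g_00 = 1/|∇f|, a function of f alone, so the new coordinate satisfies ds = df/|∇f|.
  have hq : ContDiffOn ℝ ∞ (fun s => √(G (consPt s c) 0 0)) (Set.Ioo a b) := by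
    refine ContDiffOn.sqrt ?_ fun s hs => (hG.2 _ (hmem s hs)).diag_pos.ne'
    exact (hG.1 0 0).comp (contDiffOn_consPt contDiffOn_id contDiffOn_const) hmem
  obtain ⟨e, he, hpe, hsrc, a', b', β, htgt, -, hβ', he'⟩ := exists_reparam_chart g he₁ htgt₁ hq
    (fun s hs => Real.sqrt_pos.2 (hG.2 _ (hmem s hs)).diag_pos) hp₁
  refine ⟨e, he, hpe, hsrc.trans hsrc₁, a', b', c, r, β, hr, htgt, fun y hy => ?_⟩
  have hyB : y ∈ box (Set.Ioo a' b') (Metric.ball c r) := by rw [← htgt]; exact hy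
  obtain ⟨hβI, hβd⟩ := hβ' _ hyB.1
  have hy₁ : consPt (β (y 0)) (tailPt y) ∈ e₁.target := by rw [htgt₁]; exact ⟨hβI, hyB.2⟩
  obtain ⟨h1, h2, h3, -⟩ := he' y hy
  have hGc := hconst _ hβI _ hyB.2
  have hGpos : 0 < G (consPt (β (y 0)) c) 0 0 := (hG.2 _ (hmem _ hβI)).diag_pos
  refine ⟨?_, ?_, ?_, fun i => ?_⟩
  · rw [h1, hf₁ _ hy₁]
    rfl
  · convert hβd using 1
    have hw := gradNorm_pos g f (hgrad _ (hU₁ _ hy₁))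
    rw [← hGc, (hG₁ _ hy₁).1, h1, Real.sqrt_inv, inv_inv, Real.sqrt_sq hw.le]
  · rw [h2, ← hGdef, hGc, inv_pow, Real.sq_sqrt hGpos.le, inv_mul_cancel₀ hGpos.ne']
  · rw [h3, ← hGdef, (hG₁ _ hy₁).2, mul_zero]

variable {M : Type*} [TopologicalSpace M] [ChartedSpace (Eu 4) M] [IsManifold (𝓡 4) ∞ M]

/-- A four-dimensional gradient Ricci soliton whose Ricci eigenvalues in the directions tangent to
the levels of the potential coincide is locally a warped product over an interval, whose fibre is a
space form. -/
theorem exists_warped_chart (g : RMetric 4 M)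
    {f : M → ℝ} {lam : ℝ} (hsol : IsGradientRicciSoliton g f lam) {U : Set M} (hU : IsOpen U)
    (hgrad : ∀ x ∈ U, grad g f x ≠ 0) {E : Fin 4 → (x : M) → TangentSpace (𝓡 4) x}
    {ev : Fin 4 → M → ℝ} (hE : IsAdaptedFrame g f U E ev) {μ : M → ℝ}
    (hμ : ∀ x ∈ U, ∀ i, i ≠ 0 → ev i x = μ x) {p : M} (hp : p ∈ U) :
    ∃ e ∈ Charts 4 M, p ∈ e.source ∧ e.source ⊆ U ∧
      ∃ (a b : ℝ) (W : Set (Eu 3)) (h : ℝ → ℝ) (gt : Eu 3 → Matrix (Fin 3) (Fin 3) ℝ) (k : ℝ),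
        IsOpen W ∧ e.target = box (Set.Ioo a b) W ∧
        ContDiffOn ℝ ∞ h (Set.Ioo a b) ∧ (∀ s ∈ Set.Ioo a b, 0 < h s) ∧
        IsMetricOn gt W ∧ IsSpaceForm gt W k ∧
        (∀ y ∈ e.target, inChart g e y = warped h gt y) ∧
        (∀ y ∈ e.target, ∀ i,
          pd i (f ∘ e.symm) y = if i = 0 then gradNorm g f (e.symm y) else 0) := by
  obtain ⟨e, he, hpe, hsrc, a, b, c, r, β, hr, htgt, hch⟩ :=
    exists_geodesic_chart g hsol hU hgrad hE hμ hp
  have hS : IsOpen e.target := e.open_target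
  set G := inChart g e with hGdef
  have hG : IsMetricOn G e.target := isMetricOn_inChart g he
  have hUe : ∀ y ∈ e.target, e.symm y ∈ U := fun y hy => hsrc (e.map_target hy)
  have h00 : ∀ y ∈ e.target, G y 0 0 = 1 := fun y hy => (hch y hy).2.2.1
  have h0s : ∀ y ∈ e.target, ∀ i : Fin 3, G y 0 i.succ = 0 := fun y hy => (hch y hy).2.2.2
  have hpd : ∀ y ∈ e.target, ∀ i,
      pd i (f ∘ e.symm) y = if i = 0 then gradNorm g f (e.symm y) else 0 := fun y hy i =>
    pd_of_eq_first hS (fun z hz => (hch z hz).1) hy (hch y hy).2.1 i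
  have hric : ∀ y ∈ e.target, ∀ i : Fin 3, ∀ j,
      ricci G i.succ j y = μ (e.symm y) * G y i.succ j := fun y hy i j =>
    ricci_of_adaptedFrame g hsol.1 hE he hy (hUe y hy) (fun j hj => hμ _ (hUe y hy) j hj)
      (by rw [hpd y hy, if_neg (Fin.succ_ne_zero i)]) j
  have hψ : ∀ y ∈ e.target, 0 < gradNorm g f (e.symm y) := fun y hy =>
    gradNorm_pos g f (hgrad _ (hUe y hy))
  -- The tangential part of the soliton equation: Hess f(∂_a, ∂_b) = ½ |∇f| ∂_s g_ab, equated with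
  -- (λ - μ) g_ab.
  have hdK : ∀ y ∈ e.target, ∀ i j : Fin 3, pd 0 (fun z => G z i.succ j.succ) y
      = 2 * ((lam - μ (e.symm y)) / gradNorm g f (e.symm y)) * G y i.succ j.succ := by
    intro y hy i j
    have h1 := hsol.2 e he y hy i.succ j.succ
    have h3 : pd i.succ (pd j.succ (f ∘ e.symm)) y = 0 :=
      pd_eq_zero hS hy fun z hz => by rw [hpd z hz, if_neg (Fin.succ_ne_zero j)]
    rw [← hGdef, hric y hy, hessian, h3, Fin.sum_univ_succ, hG.christoffel_zero hS h00 h0s hy] at h1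
    simp only [hpd y hy, Fin.succ_ne_zero, if_true, if_false, mul_zero,
      Finset.sum_const_zero, add_zero, zero_sub] at h1
    have := (hψ y hy).ne'
    field_simp
    linarith
  -- The principal curvature is defined from one diagonal metric component, which makes it smooth
  -- without any regularity of μ.
  set ζ : Eu 4 → ℝ := fun y => pd 0 (fun z => G z 1 1) y * (2 * G y 1 1)⁻¹ with hζdef
  have h11 : ∀ y ∈ e.target, 0 < G y 1 1 := fun y hy => (hG.2 y hy).diag_pos
  have hζ : ContDiffOn ℝ ∞ ζ e.target := (contDiffOn_pd hS (hG.1 1 1) 0).mul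
    ((contDiffOn_const.mul (hG.1 1 1)).inv fun y hy => (by have := h11 y hy; positivity))
  have hζeq : ∀ y ∈ e.target, ζ y = (lam - μ (e.symm y)) / gradNorm g f (e.symm y) := by
    intro y hy
    have := hdK y hy 0 0
    have h1 := (h11 y hy).ne'
    simp only [hζdef]
    change pd 0 (fun z => G z 1 1) y = _ * G y 1 1 at this
    rw [this]
    field_simp
  have humb : IsUmbilic G (Set.Ioo a b) (Metric.ball c r) ζ :=
    { isOpen_fst := isOpen_Ioo
      isOpen_snd := Metric.isOpen_ball
      metric := by rw [← htgt]; exact hG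
      zero_zero := by rw [← htgt]; exact h00
      zero_succ := by rw [← htgt]; exact h0s
      contDiffOn := by rw [← htgt]; exact hζ
      pd_zero := by
        rw [← htgt]
        intro y hy i j
        rw [hdK y hy, hζeq y hy] }
  -- By the Codazzi equation -2 ∂_a ζ = Rc(∂_a, ∂_s) = μ g(∂_a, ∂_s) = 0.
  have hζconst : ∀ s ∈ Set.Ioo a b, ∀ x ∈ Metric.ball c r, ζ (consPt s x) = ζ (consPt s c) := by
    intro s hs x hx
    refine eq_of_pd_succ_eq_zero isOpen_Ioo Metric.isOpen_ball (convex_ball c r)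
      (humb.contDiffOn.differentiableOn (by simp)) (fun y hy i => ?_) hs hx
      (Metric.mem_ball_self hr)
    have h1 := humb.ricci_succ_zero hy i
    rw [← htgt] at hy
    rw [hric y hy, hG.symm hy, h0s y hy, mul_zero] at h1
    norm_num at h1
    exact h1
  have hmem : ∀ s ∈ Set.Ioo a b, ∀ x ∈ Metric.ball c r, consPt s x ∈ e.target := fun s hs x hx => by
    rw [htgt]; exact ⟨hs, hx⟩
  have hcb : c ∈ Metric.ball c r := Metric.mem_ball_self hr
  set η : ℝ → ℝ := fun s => ζ (consPt s c) with hηdef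
  have hη : ContDiffOn ℝ ∞ η (Set.Ioo a b) :=
    hζ.comp (contDiffOn_consPt contDiffOn_id contDiffOn_const) fun s hs => hmem s hs c hcb
  set s₀ : ℝ := e p 0 with hs₀
  have hs₀I : s₀ ∈ Set.Ioo a b := by
    have := e.map_source hpe
    rw [htgt] at this
    exact this.1
  obtain ⟨θ, hθ, hθ0, hθd⟩ := exists_primitive hη hs₀I
  have hζη : ∀ y ∈ box (Set.Ioo a b) (Metric.ball c r), ζ y = η (y 0) := by
    intro y hy
    conv_lhs => rw [← consPt_tailPt y]
    exact hζconst _ hy.1 _ hy.2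
  have hprod := humb.eq_exp_sq_mul_slice hζη hs₀I hθ0 hθd
  have hgt : IsMetricOn (slice G s₀) (Metric.ball c r) := isMetricOn_slice humb.metric hs₀I
  set ψ₀ : ℝ := gradNorm g f (e.symm (consPt s₀ c)) with hψ₀
  have hηd : HasDerivAt η (deriv η s₀) s₀ :=
    ((hη.contDiffAt (isOpen_Ioo.mem_nhds hs₀I)).differentiableAt (by simp)).hasDerivAt
  -- On the slice s = s₀ the eigenvalue is μ = λ - ψ₀ η(s₀), because both |∇f| and ζ are constant
  -- there.
  have hform : IsSpaceForm (slice G s₀) (Metric.ball c r)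
      ((lam - ψ₀ * η s₀ + deriv η s₀ + 3 * η s₀ ^ 2) / 2) := by
    refine humb.isSpaceForm_slice hs₀I hζη hηd fun x hx i j => ?_
    have hy := hmem s₀ hs₀I x hx
    have h3 : gradNorm g f (e.symm (consPt s₀ x)) = ψ₀ :=
      (hch _ hy).2.1.unique (hch _ (hmem s₀ hs₀I c hcb)).2.1
    have h5 := hζeq _ hy
    rw [hζη (consPt s₀ x) ⟨hs₀I, hx⟩, h3, consPt_zero] at h5
    have h6 : ψ₀ ≠ 0 := (hψ _ (hmem s₀ hs₀I c hcb)).ne'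
    rw [hric _ hy, h5]
    congr 1
    field_simp
    ring
  refine ⟨e, he, hpe, hsrc, a, b, Metric.ball c r, fun s => Real.exp (θ s), slice G s₀, _,
    Metric.isOpen_ball, htgt, hθ.exp, fun s _ => Real.exp_pos _, hgt,
    hform, fun y hy => ?_, hpd⟩
  rw [← hGdef, eq_blockMat (hG.2 y hy) (h0s y hy), h00 y hy]
  rw [htgt] at hy
  change blockMat 1 _ = blockMat 1
    (Matrix.of fun i j => Real.exp (θ (y 0)) ^ 2 * slice G s₀ (tailPt y) i j)
  congr 1
  ext i j
  have := hprod (y 0) hy.1 (tailPt y) hy.2 i j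
  rw [consPt_tailPt] at this
  exact this

/-- Warped products over an interval with a space form as fibre are locally conformally flat. -/
theorem exists_conformally_flat_chart (g : RMetric 4 M) {e : OpenPartialHomeomorph M (Eu 4)}
    (he : e ∈ Charts 4 M) {p : M} (hp : p ∈ e.source) {a b : ℝ} {W : Set (Eu 3)} {h : ℝ → ℝ}
    {gt : Eu 3 → Matrix (Fin 3) (Fin 3) ℝ} {k : ℝ} (hW : IsOpen W)
    (htgt : e.target = box (Set.Ioo a b) W) (hh : ContDiffOn ℝ ∞ h (Set.Ioo a b))
    (hpos : ∀ s ∈ Set.Ioo a b, 0 < h s) (hgt : IsMetricOn gt W) (hk : IsSpaceForm gt W k)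
    (hwarp : ∀ y ∈ e.target, inChart g e y = warped h gt y) :
    ∃ e' ∈ Charts 4 M, p ∈ e'.source ∧ e'.source ⊆ e.source ∧
      ∃ φ : Eu 4 → ℝ, ContDiffOn ℝ ∞ φ e'.target ∧
        IsFlatOn (fun y => Real.exp (2 * φ y) • inChart g e' y) e'.target := by
  -- The coordinate t with dt = ds/h turns ds² + h² g̃ into h²(dt² + g̃).
  obtain ⟨e₂, he₂, hp₂, hsrc₂, a', b', β, htgt₂, hβ, hβ', hch⟩ := exists_reparam_chart g he htgt
    (hh.inv fun s hs => (hpos s hs).ne') (fun s hs => inv_pos.2 (hpos s hs)) hp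
  have hG₂ : ∀ y ∈ e₂.target, inChart g e₂ y = h (β (y 0)) ^ 2 • prodMetric gt y := by
    intro y hy
    have hyB : y ∈ box (Set.Ioo a' b') W := by rw [← htgt₂]; exact hy
    have hy₁ : consPt (β (y 0)) (tailPt y) ∈ e.target := by
      rw [htgt]; exact ⟨(hβ' _ hyB.1).1, hyB.2⟩
    obtain ⟨-, h1, h2, h3⟩ := hch y hy
    rw [eq_blockMat ((isMetricOn_inChart g he₂).2 y hy) fun i => by
      rw [h2, hwarp _ hy₁]; exact mul_zero _]
    ext i j
    refine Fin.cases (Fin.cases ?_ (fun j => ?_) j) (fun i => Fin.cases ?_ (fun j => ?_) j) i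
    · rw [blockMat_zero_zero, h1, hwarp _ hy₁, Pi.inv_apply, inv_inv]
      rfl
    · exact (mul_zero _).symm
    · exact (mul_zero _).symm
    · rw [blockMat_succ_succ, Matrix.submatrix_apply, h3, hwarp _ hy₁]
      rfl
  have hp₂t := e₂.map_source hp₂
  rw [htgt₂] at hp₂t
  obtain ⟨w, r, hr, hrW, hw, hwpos, hflat⟩ := exists_conformal_factor (I := Set.Ioo a' b')
    isOpen_Ioo hW hgt hk hp₂t.2
  have hBo : IsOpen (box (Set.Ioo a' b') (Metric.ball (tailPt (e₂ p)) r)) :=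
    isOpen_box isOpen_Ioo Metric.isOpen_ball
  obtain ⟨e₃, he₃, hp₃, hsrc₃, -, htgt₃, hch₃⟩ := exists_box_chart g he₂ hp₂
    (e₂.isOpen_inter_preimage hBo) ⟨hp₂, hp₂t.1, Metric.mem_ball_self hr⟩
  have hsub : e₃.target ⊆ box (Set.Ioo a' b') (Metric.ball (tailPt (e₂ p)) r) := by
    intro y hy
    have h1 := (hsrc₃ (e₃.map_target hy)).2.2
    rwa [Set.mem_preimage, (hch₃ y hy).1, e₂.right_inv (htgt₃ hy)] at h1
  have hhβ : ContDiffOn ℝ ∞ (fun y : Eu 4 => h (β (y 0))) e₃.target :=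
    (hh.comp hβ fun s hs => (hβ' s hs).1).comp (contDiff_coord 0).contDiffOn
      fun y hy => (hsub hy).1
  have hhpos : ∀ y ∈ e₃.target, 0 < h (β (y 0)) := fun y hy => hpos _ (hβ' _ (hsub hy).1).1
  -- The exponent -log(h w) first removes the factor h² and then applies the flattening factor w⁻²
  -- to the product metric.
  refine ⟨e₃, he₃, hp₃, fun x hx => hsrc₂ (hsrc₃ hx).1,
    fun y => -Real.log (h (β (y 0)) * w y), ?_, ?_⟩
  · exact ((hhβ.mul (hw.mono hsub)).log fun y hy =>
      (mul_pos (hhpos y hy) (hwpos y (hsub hy))).ne').neg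
  · refine IsFlatOn.congr (G := fun y => Real.exp (2 * -Real.log (w y)) • prodMetric gt y)
      e₃.open_target (fun y hy => ?_) fun y hy => hflat y (hsub hy)
    have h1 := hhpos y hy
    have h2 := hwpos y (hsub hy)
    simp only
    rw [(hch₃ y hy).2, hG₂ y (htgt₃ hy), smul_smul]
    congr 1
    rw [Real.log_mul h1.ne' h2.ne']
    have h3 : h (β (y 0)) ^ 2 = Real.exp (2 * Real.log (h (β (y 0)))) := by
      rw [two_mul, Real.exp_add, Real.exp_log h1, sq]
    rw [h3, ← Real.exp_add]
    congr 1
    ring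

end Soliton

end RicciSoliton

end

theorem mainTheorem8 {M : Type*} [TopologicalSpace M] [ChartedSpace (Eu 4) M]
    [IsManifold (𝓡 4) ∞ M] (g : RMetric 4 M) (f : M → ℝ) (lam : ℝ)
    (hsol : IsGradientRicciSoliton g f lam) (hW : HasHarmonicWeyl g)
    (hf : ¬ ∃ c : ℝ, ∀ x, f x = c)
    (U : Set M) (hU : IsOpen U) (hUA : U ⊆ regularSet g ∩ {x | grad g f x ≠ 0})
    (E : Fin 4 → (x : M) → TangentSpace (𝓡 4) x) (ev : Fin 4 → M → ℝ)
    (hE : IsAdaptedFrame g f U E ev)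
    (hev : ∀ x ∈ U, ev 1 x = ev 2 x ∧ ev 2 x = ev 3 x ∧ ev 1 x ≠ ev 0 x) :
    (∀ p₀ ∈ U, ∃ e ∈ Charts 4 M, p₀ ∈ e.source ∧ e.source ⊆ U ∧
      ∃ (a b : ℝ) (W : Set (Eu 3)) (h : ℝ → ℝ) (gt : Eu 3 → Matrix (Fin 3) (Fin 3) ℝ) (k : ℝ),
        IsOpen W ∧ e.target = {y | y 0 ∈ Set.Ioo a b ∧ tailPt y ∈ W} ∧
        ContDiffOn ℝ ∞ h (Set.Ioo a b) ∧ (∀ s ∈ Set.Ioo a b, 0 < h s) ∧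
        IsMetricOn gt W ∧ HasConstantCurvatureOn gt W k ∧
        (∀ y ∈ e.target, inChart g e y = warped h gt y) ∧
        (∀ y ∈ e.target, ∀ i,
          pd i (f ∘ e.symm) y = if i = 0 then gradNorm g f (e.symm y) else 0)) ∧
    IsLocallyConformallyFlatOn g U := by
  have hgrad : ∀ x ∈ U, grad g f x ≠ 0 := fun x hx => (hUA hx).2
  have hμ : ∀ x ∈ U, ∀ i, i ≠ 0 → ev i x = ev 1 x := by
    intro x hx i hi
    obtain ⟨h1, h2, -⟩ := hev x hx
    fin_cases i
    · exact absurd rfl hi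
    · rfl
    · exact h1.symm
    · exact (h1.trans h2).symm
  refine ⟨fun p hp => ?_, fun p hp => ?_⟩
  · obtain ⟨e, he, hpe, hsrc, a, b, W, h, gt, k, hW, htgt, hh, hpos, hgt, hk, hwarp, hpd⟩ :=
      exists_warped_chart g hsol hU hgrad hE hμ hp
    exact ⟨e, he, hpe, hsrc, a, b, W, h, gt, k, hW, htgt, hh, hpos, hgt,
      hk.hasConstantCurvatureOn hgt, hwarp, hpd⟩
  · obtain ⟨e, he, hpe, hsrc, a, b, W, h, gt, k, hW, htgt, hh, hpos, hgt, hk, hwarp, -⟩ :=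
      exists_warped_chart g hsol hU hgrad hE hμ hp
    obtain ⟨e', he', hpe', hsrc', hφ⟩ :=
      exists_conformally_flat_chart g he hpe hW htgt hh hpos hgt hk hwarp
    exact ⟨e', he', hpe', hsrc'.trans hsrc, hφ⟩
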